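/- **Setting.** There are $n$ nodes and a server; node $i$ holds a data item $d_i$ from a totally ordered set, and the data items are pairwise distinct whenever an operation INITIALIZE or REFRESH is run. A message from a node to the server and a broadcast of the server cost one message each. Let $\log=\log_2$, $0<\varphi<1$, $\mathfrak h=\log_{1/\varphi}\log n$, $h_{\max}=\lceil\log_{1/\varphi} n\rceil$ and let $\kappa$ be a constant. A random height is geometric, $\Pr[h]=\varphi^{h-1}(1-\varphi)$ for $h\ge 1$, cut off at $h_{\max}$. Class $\ell\ge 0$ has the heights $(8\kappa\ell\mathfrak h,8\kappa(\ell+1)\mathfrak h]$, and its sub-class $\tau\in\{0,1,2,3\}$ has the heights $((8\ell+2\tau+1)\kappa\mathfrak h,(8\ell+2\tau+3)\kappa\mathfrak h]$; the classes in use are those with $8\kappa(\ell+1)\mathfrak h\le\log_{1/\varphi}n$. The server stores a set $DS$ of pairs $(h_i,d_i)$; $S_{\ell,\tau}$ are the stored pairs with height in sub-class $(\ell,\tau)$, and $S_\ell=\bigcup_\tau S_{\ell,\tau}$. Class $\ell$ is *filled* if it has an alarm $a_\ell\in S_{\ell,1}$ and a representative $r_\ell\in S_{\ell,2}$. * **INITIALIZE**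 on a set $P$ of nodes: the nodes of $P$ draw new independent heights. For $h=h_{\max},\dots,1$ the nodes $i\in P$ with $h_i=h$ and $d_i<d_{\min}$ respond (initially $d_{\min}=\infty$), and $d_{\min}$ becomes the smallest response, if there is one. The smallest responses of all heights replace the pairs of $P$ in $DS$, and a stored pair is dropped if another one has at least its height and a smaller data item. Alarms and representatives that took part or were dropped are given up, and missing $a_\ell$, $r_\ell$ are chosen uniformly at random from $S_{\ell,1}$, $S_{\ell,2}$. INITIALIZE$()$ does this with $P$ the set of all nodes, and repeats it until all classes are filled. Counted messages: one broadcast for the start, every response, one broadcast for each probe with $d_{\min}<\infty$, and one broadcast for each new choice of an alarm or a representative. * **UPDATE**$(i,d)$: node $i$ replaces $d_i$ by $d$ and its pair is deleted from $DS$. For each $\ell$, if node $i$ held $a_\ell$ or $r_\ell$, or if $h(a_\ell)\le h_i\le h(r_\ell)$ and $d<a_\ell$, then $S_\ell$ is deleted from $DS$ together with $a_\ell,r_\ell$. Then node $i$ draws a new height. * **REFRESH**$()$: let $\ell$ be the larger of the highest level that is not filled and the level of the maximal height among the nodes updated since the last INITIALIZE or REFRESH. The body of INITIALIZE is executed on the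 nodes with $d_i<r_\ell$ (with $d_i<r_{\ell+1}$ if class $\ell$ is not filled; on all nodes if that representative does not exist because it lies above the last class; on no nodes if there is no such $\ell$). This is repeated until all classes are filled. In addition to the messages of INITIALIZE, each repetition counts one broadcast asking for the maximal height and the responses of the updated nodes of maximal height. **Theorem.** For every sufficiently large $\kappa$ there are constants $C$ and $n_0$, depending on $\kappa$ only, such that the following holds for all $n\ge n_0$ and all $\varphi$ with $\frac1{\log n}\le\varphi<1$ (hence for every fixed $\varphi$ and all sufficiently large $n$), for all initial data items. 1. INITIALIZE terminates with probability one and uses at most $C\cdot\frac1\varphi\log_{1/\varphi}(n)$ messages in expectation. 2. Run INITIALIZE and then at most $\log n$ rounds, each consisting of finitely many UPDATEs followed by one REFRESH, where the UPDATEs are fixed in advance (independently of the random choices). All operations terminate with probability one, and the last REFRESH uses at most $C\cdot\frac1\varphi\log_{1/\varphi}(\max\{m,\log n\})$ messages in expectation, where $m$ is the number of UPDATEs since the previous INITIALIZE or REFRESH. In particular, it uses $O\big(\frac1\varphi\log_{1/\varphi}(m)\big)$ messages in expectation if $m\ge\log n$. -/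

import Mathlib

open scoped ENNReal

noncomputable section

namespace SeleMon

/-- The parameters: `n` sensor nodes, failure probability `φ` of the geometric distribution, and
the constant `κ` that fixes the width of the classes. -/
structure Params where
  n : ℕ
  φ : ℝ
  κ : ℝ
  φ_pos : 0 < φ
  φ_lt_one : φ < 1

/-- A node of the network. -/
abbrev Params.Node (p : Params) : Type := Fin p.n

/-- `log n` (base two). -/
def Params.logN (p : Params) : ℝ := Real.logb 2 p.n

/-- `log_{1/φ} x`. -/
def Params.logPhi (p : Params) (x : ℝ) : ℝ := Real.logb (1 / p.φ) x

/-- The unit of height `log_{1/φ} (log n)`. -/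
def Params.unit (p : Params) : ℝ := p.logPhi p.logN

/-- The maximal height `log_{1/φ} n`, rounded up. -/
def Params.hmax (p : Params) : ℕ := ⌈p.logPhi p.n⌉₊

/-- The number of classes: class `ℓ` has the heights `(8κℓ·unit, 8κ(ℓ+1)·unit]`, and the classes
in use are those with `8κ(ℓ+1)·unit ≤ log_{1/φ} n`. -/
def Params.classes (p : Params) : ℕ := ⌊p.logPhi p.n / (8 * p.κ * p.unit)⌋₊

/-- The level `ℓ` with `h ∈ (8κℓ·unit, 8κ(ℓ+1)·unit]`. -/
def Params.levelOf (p : Params) (h : ℕ) : ℕ := ⌈(h : ℝ) / (8 * p.κ * p.unit)⌉₊ - 1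

/-- `h` is a height of the sub-class `(ℓ, τ)`. -/
def Params.InSub (p : Params) (ℓ τ h : ℕ) : Prop :=
  (8 * ℓ + (2 * τ + 1)) * p.κ * p.unit < h ∧ (h : ℝ) ≤ (8 * ℓ + (2 * τ + 3)) * p.κ * p.unit

/-- The number of failures before the first success, with success probability `1 - φ`. -/
def Params.failures (p : Params) : PMF ℕ :=
  ⟨fun k => ENNReal.ofReal (p.φ ^ k * (1 - p.φ)), by
    have h := (hasSum_geometric_of_lt_one p.φ_pos.le p.φ_lt_one).mul_right (1 - p.φ)
    rw [inv_mul_cancel₀ (sub_pos.2 p.φ_lt_one).ne'] at h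
    have hn : ∀ k : ℕ, 0 ≤ p.φ ^ k * (1 - p.φ) := fun k =>
      mul_nonneg (pow_nonneg p.φ_pos.le k) (sub_nonneg.2 p.φ_lt_one.le)
    have e := ENNReal.ofReal_tsum_of_nonneg hn h.summable
    rw [h.tsum_eq, ENNReal.ofReal_one] at e
    rw [e]
    exact ENNReal.summable.hasSum⟩

/-- A random height: geometric on `{1, 2, …}`, `Pr[h] = φ^(h-1) (1-φ)`, then cut off at `hmax`. -/
def Params.heightLaw (p : Params) : PMF ℕ := p.failures.map fun k => min (k + 1) p.hmax

/-- The state of the nodes and of the server's data structure. -/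
structure State (p : Params) (D : Type*) where
  /-- the current data item `d_i` of each node -/
  data : p.Node → D
  /-- the current height `h_i` of each node -/
  height : p.Node → ℕ
  /-- the data structure `DS`: the nodes `i` whose pair `(h_i, d_i)` is stored -/
  ds : Finset p.Node
  /-- the node holding the alarm `a_ℓ` of class `ℓ`, if there is one -/
  alarm : ℕ → Option p.Node
  /-- the node holding the representative `r_ℓ` of class `ℓ`, if there is one -/
  rep : ℕ → Option p.Node
  /-- the nodes with an UPDATE since the last INITIALIZE or REFRESH -/
  touched : Finset p.Node

/-- The operations; `setup` is INITIALIZE. -/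
inductive Op (p : Params) (D : Type*) where
  | setup : Op p D
  | update (i : p.Node) (d : D) : Op p D
  | refresh : Op p D

variable {p : Params} {D : Type*}

/-- Draw independent new heights for the nodes in a list. -/
def redraw : List p.Node → (p.Node → ℕ) → PMF (p.Node → ℕ)
  | [], h => PMF.pure h
  | i :: is, h => p.heightLaw.bind fun x => redraw is (Function.update h i x)

open scoped Classical in
/-- The sub-class `S_{ℓ,τ}` of the data structure. -/
def State.sub (s : State p D) (ℓ τ : ℕ) : Finset p.Node :=
  s.ds.filter fun i => p.InSub ℓ τ (s.height i)

/-- Class `ℓ` is filled: it has an alarm in `S_{ℓ,1}` and a representative in `S_{ℓ,2}`. -/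
def State.Filled (s : State p D) (ℓ : ℕ) : Prop :=
  (∃ a ∈ s.sub ℓ 1, s.alarm ℓ = some a) ∧ ∃ r ∈ s.sub ℓ 2, s.rep ℓ = some r

/-- All classes are filled. -/
def State.AllFilled (s : State p D) : Prop := ∀ ℓ < p.classes, s.Filled ℓ

/-- Keep the current choice, if it still is an element of `S`; otherwise choose uniformly at random
from `S` (none if `S` is empty). The number is that of the messages: one broadcast announces a new
choice. -/
def choose (cur : Option p.Node) (S : Finset p.Node) : PMF (Option p.Node × ℕ) :=
  open scoped Classical in
  if ∃ i ∈ S, cur = some i then PMF.pure (cur, 0)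
  else if h : S.Nonempty then (PMF.uniformOfFinset S h).map fun i => (some i, 1)
  else PMF.pure (none, 0)

/-- Choose alarms and representatives for the classes below `k`, with the number of messages. -/
def chooseAll : ℕ → State p D → PMF (State p D × ℕ)
  | 0, s => PMF.pure (s, 0)
  | k + 1, s => (chooseAll k s).bind fun q =>
      (choose (q.1.alarm k) (q.1.sub k 1)).bind fun a =>
        (choose (q.1.rep k) (q.1.sub k 2)).map fun r =>
          ({ q.1 with
              alarm := Function.update q.1.alarm k a.1
              rep := Function.update q.1.rep k r.1 }, q.2 + a.2 + r.2)

section Order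

variable [LinearOrder D]

open scoped Classical in
/-- The probing loop of CoFaSel (without early termination, `h_min = 1`) from height `h` down to
height `1` on the participating nodes `P`, with threshold `dmin`. In the round of height `h + 1` the
nodes `i ∈ P` with `h_i = h + 1` and `d_i < dmin` respond, and the smallest response becomes the
threshold. The result is the number of messages and the set of nodes with the smallest response of
their height.
Messages: one for each response, and one broadcast for each probe with a threshold `dmin < ∞`. As
long as no node has responded (`dmin = ∞`) the nodes just count the rounds. -/
def sweep (data : p.Node → D) (height : p.Node → ℕ) (P : Finset p.Node) :
    ℕ → WithTop D → ℕ × Finset p.Node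
  | 0, _ => (0, ∅)
  | h + 1, dmin =>
    let R := P.filter fun i => height i = h + 1 ∧ (data i : WithTop D) < dmin
    let lower := sweep data height P h (min dmin (R.inf fun i => (data i : WithTop D)))
    ((if dmin = ⊤ then 0 else 1) + R.card + lower.1,
      (R.filter fun i => ∀ j ∈ R, data i ≤ data j) ∪ lower.2)

open scoped Classical in
/-- The left-most path: the nodes of `A` that have no node of `A` of at least their height and with
a smaller data item. -/
def leftPath (data : p.Node → D) (height : p.Node → ℕ) (A : Finset p.Node) : Finset p.Node :=
  A.filter fun i => ∀ j ∈ A, height i ≤ height j → data i ≤ data j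

open scoped Classical in
/-- One execution of the body of INITIALIZE on the participating nodes `P`, with the number of
messages. The nodes of `P` draw new heights and CoFaSel is run on them (one broadcast starts it); the
pairs it yields replace those of `P` in the data structure. Alarms and representatives among the
nodes of `P` are given up, and the missing ones are chosen at random. -/
def build (P : Finset p.Node) (s : State p D) : PMF (State p D × ℕ) :=
  (redraw ((List.finRange p.n).filter fun i => i ∈ P) s.height).bind fun h =>
    let r := sweep s.data h P p.hmax ⊤
    (chooseAll p.classes
      { data := s.data
        height := h
        ds := leftPath s.data h ((s.ds \ P) ∪ r.2)
        alarm := fun ℓ => (s.alarm ℓ).filter fun i => i ∉ P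
        rep := fun ℓ => (s.rep ℓ).filter fun i => i ∉ P
        touched := ∅ }).map fun q => (q.1, 1 + r.1 + q.2)

/-- The update of node `i` to the data item `d` makes class `ℓ` invalid. -/
def State.Invalidates (s : State p D) (i : p.Node) (d : D) (ℓ : ℕ) : Prop :=
  s.alarm ℓ = some i ∨ s.rep ℓ = some i ∨
    ∃ a r, s.alarm ℓ = some a ∧ s.rep ℓ = some r ∧
      s.height a ≤ s.height i ∧ s.height i ≤ s.height r ∧ d < s.data a

open scoped Classical in
/-- UPDATE. The pair of node `i` is deleted, so are all pairs of the classes that become invalid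
(those in one of their four sub-classes), and node `i` draws a new height. -/
def update (i : p.Node) (d : D) (s : State p D) : PMF (State p D) :=
  p.heightLaw.map fun x =>
    { data := Function.update s.data i d
      height := Function.update s.height i x
      ds := (s.ds.erase i).filter fun j =>
        ¬ ∃ ℓ < p.classes, s.Invalidates i d ℓ ∧ ∃ τ < 4, p.InSub ℓ τ (s.height j)
      alarm := fun ℓ => if s.Invalidates i d ℓ then none else s.alarm ℓ
      rep := fun ℓ => if s.Invalidates i d ℓ then none else s.rep ℓ
      touched := insert i s.touched }

open scoped Classical in
/-- The least `u` such that all classes `ℓ ≥ u` are filled. -/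
def State.unfilledTop (s : State p D) : ℕ :=
  ((Finset.range p.classes).filter fun ℓ => ¬ s.Filled ℓ).sup fun ℓ => ℓ + 1

/-- One more than the level of the maximal height among the updated nodes (`0` if there are none).-/
def State.touchedTop (s : State p D) : ℕ := s.touched.sup fun i => p.levelOf (s.height i) + 1

open scoped Classical in
/-- The nodes with a data item smaller than `r_b`; all nodes, if there is no `r_b`. -/
def State.below (s : State p D) (b : ℕ) : Finset p.Node :=
  match s.rep b with
  | some r => Finset.univ.filter fun i => s.data i < s.data r
  | none => Finset.univ

open scoped Classical in
/-- The nodes on which REFRESH calls INITIALIZE. Here `t = ℓ + 1` for the level `ℓ` of REFRESH, i.e.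
all classes above `ℓ` are filled and no updated node has a height of a class above `ℓ`. The
participants are the nodes with `d_i < r_ℓ`; if class `ℓ` was deleted, then `r_{ℓ+1}` takes the place
of `r_ℓ`, and above the last class all nodes take part. If `t = 0`, nothing has to be done. -/
def State.participants (s : State p D) : Finset p.Node :=
  match max s.unfilledTop s.touchedTop with
  | 0 => ∅
  | ℓ + 1 => if s.Filled ℓ then s.below ℓ else s.below (ℓ + 1)

open scoped Classical in
/-- One execution of the body of REFRESH, with the number of messages. For the maximal height, one
broadcast asks for it and the updated nodes of maximal height respond. -/
def refresh (s : State p D) : PMF (State p D × ℕ) :=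
  (build s.participants s).map fun q =>
    (q.1, 1 + (s.touched.filter fun i => ∀ j ∈ s.touched, s.height j ≤ s.height i).card + q.2)

/-- A configuration: the state, the operations that are not finished, and the number of messages
that the last operation of the sequence has used so far. -/
structure Config (p : Params) (D : Type*) where
  state : State p D
  todo : List (Op p D)
  msgs : ℕ

open scoped Classical in
/-- The configuration after the body of INITIALIZE or REFRESH was executed with `c` messages: the
operation `o` is repeated until all classes are filled. -/
def Config.next (o : Op p D) (os : List (Op p D)) (msgs : ℕ) (q : State p D × ℕ) : Config p D where
  state := q.1
  todo := if q.1.AllFilled then os else o :: os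
  msgs := if os = [] then msgs + q.2 else msgs

/-- One step of the execution. -/
def Config.step (c : Config p D) : PMF (Config p D) :=
  match c.todo with
  | [] => PMF.pure c
  | Op.setup :: os =>
      (build Finset.univ c.state).map (Config.next Op.setup os c.msgs)
  | Op.update i d :: os => (update i d c.state).map fun s => ⟨s, os, c.msgs⟩
  | Op.refresh :: os => (refresh c.state).map (Config.next Op.refresh os c.msgs)

/-- The nodes have observed the data items `d`, and nothing has been computed yet. -/
def start (d : p.Node → D) (ops : List (Op p D)) : Config p D where
  state := ⟨d, fun _ => 0, ∅, fun _ => none, fun _ => none, ∅⟩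
  todo := ops
  msgs := 0

/-- The law of the configuration after `k` steps. -/
def law (d : p.Node → D) (ops : List (Op p D)) : ℕ → PMF (Config p D)
  | 0 => PMF.pure (start d ops)
  | k + 1 => (law d ops k).bind Config.step

/-- The expected number of messages used by the last operation of the sequence `ops`. The number of
messages used within `k` steps is monotone in `k`. -/
def expectedMessages (d : p.Node → D) (ops : List (Op p D)) : ℝ≥0∞ :=
  ⨆ k, ∑' c, law d ops k c * (c.msgs : ℝ≥0∞)

/-- All operations of the sequence terminate with probability one. -/
def Terminates (d : p.Node → D) (ops : List (Op p D)) : Prop :=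
  ⨆ k, (law d ops k).toOuterMeasure {c | c.todo = []} = 1

end Order

/-- The operations of a batch of updates, followed by REFRESH. -/
def cycle (B : List (p.Node × D)) : List (Op p D) :=
  B.map (fun u => Op.update u.1 u.2) ++ [Op.refresh]

/-- INITIALIZE, then each batch of updates followed by REFRESH. -/
def history (Bs : List (List (p.Node × D))) : List (Op p D) :=
  Op.setup :: Bs.flatMap cycle

/-- The data items of the nodes after a sequence of updates. -/
def dataAfter (d : p.Node → D) (us : List (p.Node × D)) : p.Node → D :=
  us.foldl (fun e u => Function.update e u.1 u.2) d

/-- The data items are pairwise different initially and after each batch. -/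
def Distinct (d : p.Node → D) (Bs : List (List (p.Node × D))) : Prop :=
  ∀ k ≤ Bs.length, Function.Injective (dataAfter d (Bs.take k).flatten)

end SeleMon

end

/-!
The analysis rests on an invariant of the data structure and on keeping the heights random although
the participants of REFRESH depend on them.

*Structure.* The stored pairs always form a left-most path, alarms and representatives lie in their
sub-classes, and REFRESH calls INITIALIZE on nobody, on all nodes, or on the nodes below a
representative `r_b` such that all classes from `b` on are filled (`State.participants_cases`). When
the nodes of `P` draw new heights, the first node in the order of the data items that exceeds the
lower end of a sub-class also exceeds its upper end with probability at most `(log n)^(1 - 2κ)`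
(`expect_draws_until_first`, `expect_not_noBadEdge_le`). Otherwise the sub-class is met, so an
execution fills all classes as soon as one of the new heights is large enough; and if none is, class
`b` loses its alarm and the next repetition acts on a higher level. Hence the number of levels that
are left decreases in expectation (`expect_refresh_patience`), from any state. This gives
termination and crude bounds on the costs; for INITIALIZE on all nodes they are the claimed ones.

*Cost of one execution.* In CoFaSel a probe is paid for only if a greater height was drawn, and a
node of height `h` responds only if it precedes all nodes of greater height, which in expectation
are `(1 - φ) / φ` nodes per height. On `K` nodes this amounts to `(log_{1/φ} K + O(log_{1/φ} log n))
/ φ` (`expect_sweep_le`); the term `φ / (1 - φ)` that remains is at most one unit of height.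

*Histories.* Consider the process in which every operation before the last one is executed once. For
a fixed set of nodes the law of the heights after `r` executions is that of independent new heights
up to a factor `(n + 2)^r`, since the participants are one of `n + 2` sets that the data items
determine, and a single node has had at most `r` heights (`Tame`). With `r ≤ log n` this is harmless
against the tails of the heights, which are powers of `log n` with exponents proportional to `κ`. So
a representative `r_b` most likely has `(log n)^(κ(8b+4))` nodes below it, and an execution fails
with probability at most `3 (log n)^(3 - κ)` (`Tame.expect_fail_le`); all failures together contribute
little.

*The last REFRESH.* For `m` updates, let `8κL` be about `log m / log log n`. With large probability
neither the old nor the new heights of the updated nodes reach class `L`, so the classes from `L` on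
remain filled (`Steady.expect_not_calm_le`); then there are at most `(log n)^(8κ(L+2))`
participants, since otherwise as many nodes with the smallest data items had small heights
(`Tame.expect_many_participants_le`). The cost of an execution on so many nodes, which leaves the
alarms and representatives of the classes above `L + 2` alone, is the claimed one.
-/

open scoped ENNReal

namespace SeleMon

/-! ### Expectations under a discrete law -/

section Expectation

variable {α β : Type*}

/-- The expectation of a function with values in `[0, ∞]` under a discrete law. -/
noncomputable def expect (μ : PMF α) (f : α → ℝ≥0∞) : ℝ≥0∞ := ∑' x, μ x * f x

open scoped Classical in
/-- The indicator of a proposition, with values in `[0, ∞]`. -/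
noncomputable def ind (P : Prop) : ℝ≥0∞ := if P then 1 else 0

lemma ind_of {P : Prop} (h : P) : ind P = 1 := if_pos h

lemma ind_of_not {P : Prop} (h : ¬ P) : ind P = 0 := if_neg h

lemma ind_le_one (P : Prop) : ind P ≤ 1 := by
  unfold ind; split_ifs <;> simp

lemma ind_mono {P Q : Prop} (h : P → Q) : ind P ≤ ind Q := by
  by_cases hP : P
  · rw [ind_of hP, ind_of (h hP)]
  · rw [ind_of_not hP]; exact zero_le

lemma ind_congr {P Q : Prop} (h : P ↔ Q) : ind P = ind Q := by rw [propext h]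

lemma ind_add_not (P : Prop) : ind P + ind (¬ P) = 1 := by
  by_cases hP : P
  · rw [ind_of hP, ind_of_not (not_not.2 hP), add_zero]
  · rw [ind_of_not hP, ind_of hP, zero_add]

lemma ind_or_le (P Q : Prop) : ind (P ∨ Q) ≤ ind P + ind Q := by
  by_cases hP : P
  · rw [ind_of hP, ind_of (Or.inl hP)]; exact le_self_add
  · rw [ind_of_not hP, zero_add]; exact ind_mono fun h => h.resolve_left hP

lemma ind_and (P Q : Prop) : ind (P ∧ Q) = ind P * ind Q := by
  by_cases hP : P <;> by_cases hQ : Q <;> simp [ind, hP, hQ]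

lemma ind_exists_mem_le {s : Finset α} {P : α → Prop} :
    ind (∃ i ∈ s, P i) ≤ ∑ i ∈ s, ind (P i) := by
  by_cases h : ∃ i ∈ s, P i
  · obtain ⟨i, hi, hP⟩ := h
    calc ind (∃ i ∈ s, P i) ≤ 1 := ind_le_one _
      _ = ind (P i) := (ind_of hP).symm
      _ ≤ _ := Finset.single_le_sum (f := fun i => ind (P i)) (fun _ _ => zero_le) hi
  · rw [ind_of_not h]; exact zero_le

lemma card_filter_eq_sum_ind (s : Finset α) (P : α → Prop) [DecidablePred P] :
    ((s.filter P).card : ℝ≥0∞) = ∑ i ∈ s, ind (P i) := by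
  rw [Finset.card_filter]
  push_cast
  exact Finset.sum_congr rfl fun i _ => by unfold ind; congr

lemma expect_pure (a : α) (f : α → ℝ≥0∞) : expect (PMF.pure a) f = f a := by
  classical
  unfold expect
  rw [tsum_eq_single a]
  · simp
  · intro b hb; simp [PMF.pure_apply, hb]

lemma expect_bind (μ : PMF α) (g : α → PMF β) (f : β → ℝ≥0∞) :
    expect (μ.bind g) f = expect μ fun x => expect (g x) f := by
  unfold expect
  simp_rw [PMF.bind_apply, ← ENNReal.tsum_mul_right, ← ENNReal.tsum_mul_left]
  rw [ENNReal.tsum_comm]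
  simp_rw [mul_assoc]

lemma expect_map (μ : PMF α) (g : α → β) (f : β → ℝ≥0∞) :
    expect (μ.map g) f = expect μ fun x => f (g x) := by
  rw [← PMF.bind_pure_comp, expect_bind]
  simp [expect_pure]

lemma expect_mono {μ : PMF α} {f g : α → ℝ≥0∞} (h : ∀ x ∈ μ.support, f x ≤ g x) :
    expect μ f ≤ expect μ g := by
  refine ENNReal.tsum_le_tsum fun x => ?_
  by_cases hx : μ x = 0
  · simp [hx]
  · exact mul_le_mul_right (h x ((PMF.mem_support_iff _ _).2 hx)) _

lemma expect_congr {μ : PMF α} {f g : α → ℝ≥0∞} (h : ∀ x ∈ μ.support, f x = g x) :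
    expect μ f = expect μ g :=
  le_antisymm (expect_mono fun x hx => (h x hx).le) (expect_mono fun x hx => (h x hx).ge)

lemma expect_const (μ : PMF α) (c : ℝ≥0∞) : expect μ (fun _ => c) = c := by
  unfold expect
  rw [ENNReal.tsum_mul_right, μ.tsum_coe, one_mul]

lemma expect_le_of_forall {μ : PMF α} {f : α → ℝ≥0∞} {c : ℝ≥0∞} (h : ∀ x ∈ μ.support, f x ≤ c) :
    expect μ f ≤ c :=
  (expect_mono h).trans (expect_const μ c).le

lemma expect_add (μ : PMF α) (f g : α → ℝ≥0∞) :
    expect μ (fun x => f x + g x) = expect μ f + expect μ g := by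
  unfold expect
  simp_rw [mul_add]
  exact ENNReal.tsum_add

lemma expect_const_mul (μ : PMF α) (c : ℝ≥0∞) (f : α → ℝ≥0∞) :
    expect μ (fun x => c * f x) = c * expect μ f := by
  unfold expect
  rw [← ENNReal.tsum_mul_left]
  exact tsum_congr fun x => by ring

lemma expect_mul_const (μ : PMF α) (c : ℝ≥0∞) (f : α → ℝ≥0∞) :
    expect μ (fun x => f x * c) = expect μ f * c := by
  simp_rw [mul_comm _ c]; exact expect_const_mul μ c f

lemma expect_sum {ι : Type*} (μ : PMF α) (s : Finset ι) (f : ι → α → ℝ≥0∞) :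
    expect μ (fun x => ∑ i ∈ s, f i x) = ∑ i ∈ s, expect μ (f i) := by
  classical
  induction s using Finset.induction_on with
  | empty => simp [expect_const]
  | insert a s ha ih => simp_rw [Finset.sum_insert ha, expect_add, ih]

end Expectation

/-! ### Random heights -/

section Heights

variable {p : Params}

/-- The probability that a new height exceeds `e`. -/
noncomputable def Params.tail (p : Params) (e : ℝ) : ℝ≥0∞ :=
  expect p.heightLaw fun x => ind (e < (x : ℝ))

lemma Params.tail_le_one (p : Params) (e : ℝ) : p.tail e ≤ 1 :=
  expect_le_of_forall fun _ _ => ind_le_one _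

lemma Params.expect_not_lt (p : Params) (e : ℝ) :
    expect p.heightLaw (fun x => ind ((x : ℝ) ≤ e)) = 1 - p.tail e := by
  have h : expect p.heightLaw (fun x => ind ((x : ℝ) ≤ e)) + p.tail e = 1 := by
    rw [Params.tail, ← expect_add, ← expect_const p.heightLaw 1]
    refine expect_congr fun x _ => ?_
    rw [← ind_add_not ((x : ℝ) ≤ e), ind_congr (not_le (a := (x : ℝ)) (b := e))]
  rw [← h, ENNReal.add_sub_cancel_right]
  exact ne_top_of_le_ne_top ENNReal.one_ne_top (p.tail_le_one e)

lemma Params.le_hmax_of_mem_support {x : ℕ} (hx : x ∈ p.heightLaw.support) : x ≤ p.hmax := by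
  rw [Params.heightLaw, PMF.mem_support_map_iff] at hx
  obtain ⟨k, _, rfl⟩ := hx
  exact min_le_right _ _

lemma Params.pos_of_mem_support (hm : 1 ≤ p.hmax) {x : ℕ} (hx : x ∈ p.heightLaw.support) :
    1 ≤ x := by
  rw [Params.heightLaw, PMF.mem_support_map_iff] at hx
  obtain ⟨k, _, rfl⟩ := hx
  exact le_min (by omega) hm

lemma redraw_swap (i j : p.Node) (hij : i ≠ j) (l : List p.Node) (h : p.Node → ℕ) :
    redraw (i :: j :: l) h = redraw (j :: i :: l) h := by
  simp only [redraw]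
  rw [PMF.bind_comm]
  simp_rw [Function.update_comm hij]

lemma redraw_perm {l l' : List p.Node} (hl : l.Perm l') (nd : l.Nodup) (h : p.Node → ℕ) :
    redraw l h = redraw l' h := by
  induction hl generalizing h with
  | nil => rfl
  | cons x _ ih =>
    simp only [redraw]
    congr 1; funext y
    exact ih (List.nodup_cons.1 nd).2 _
  | swap x y l =>
    refine redraw_swap _ _ ?_ _ _
    rintro rfl
    simp at nd
  | trans h1 _ ih1 ih2 => rw [ih1 nd, ih2 (h1.nodup_iff.1 nd)]

/-- New independent heights for the nodes of a finite set. -/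
noncomputable def draws (P : Finset p.Node) (h : p.Node → ℕ) : PMF (p.Node → ℕ) :=
  redraw ((List.finRange p.n).filter fun i => i ∈ P) h

lemma draws_eq_redraw {P : Finset p.Node} {l : List p.Node} (nd : l.Nodup)
    (hl : ∀ i, i ∈ l ↔ i ∈ P) (h : p.Node → ℕ) : draws P h = redraw l h := by
  refine redraw_perm ?_ ((List.nodup_finRange _).filter _) h
  refine (List.perm_ext_iff_of_nodup ((List.nodup_finRange _).filter _) nd).2 fun i => ?_
  simp [hl]

@[simp] lemma draws_empty (h : p.Node → ℕ) : draws ∅ h = PMF.pure h := by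
  rw [draws_eq_redraw (l := []) List.nodup_nil (by simp)]; rfl

lemma draws_insert {a : p.Node} {P : Finset p.Node} (ha : a ∉ P) (h : p.Node → ℕ) :
    draws (insert a P) h = p.heightLaw.bind fun x => draws P (Function.update h a x) := by
  rw [draws_eq_redraw (l := a :: P.toList)
    (List.nodup_cons.2 ⟨by simpa using ha, P.nodup_toList⟩) (by simp)]
  simp only [redraw]
  congr 1; funext x
  exact (draws_eq_redraw P.nodup_toList (by simp) _).symm

lemma draws_update_of_mem {a : p.Node} {P : Finset p.Node} (ha : a ∈ P) (h : p.Node → ℕ) (x : ℕ) :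
    draws P (Function.update h a x) = draws P h := by
  rw [← Finset.insert_erase ha, draws_insert (Finset.notMem_erase a P),
    draws_insert (Finset.notMem_erase a P)]
  simp

/-- Drawing repeatedly for the same node amounts to a single draw. -/
lemma redraw_eq_draws (l : List p.Node) (h : p.Node → ℕ) : redraw l h = draws l.toFinset h := by
  induction l generalizing h with
  | nil => simp [redraw]
  | cons i l ih =>
    simp only [redraw, ih, List.toFinset_cons]
    by_cases hi : i ∈ l.toFinset
    · rw [Finset.insert_eq_of_mem hi]
      simp_rw [draws_update_of_mem hi]
      exact PMF.bind_const _ _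
    · rw [draws_insert hi]

lemma draws_support {P : Finset p.Node} {h h' : p.Node → ℕ} (hh : h' ∈ (draws P h).support) :
    (∀ i ∉ P, h' i = h i) ∧ ∀ i ∈ P, h' i ∈ p.heightLaw.support := by
  induction P using Finset.induction_on generalizing h with
  | empty =>
    rw [draws_empty, PMF.support_pure, Set.mem_singleton_iff] at hh
    simp [hh]
  | insert a P ha ih =>
    rw [draws_insert ha, PMF.mem_support_bind_iff] at hh
    obtain ⟨x, hx, hh⟩ := hh
    obtain ⟨h1, h2⟩ := ih hh
    refine ⟨fun i hi => ?_, fun i hi => ?_⟩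
    · rw [Finset.mem_insert, not_or] at hi
      rw [h1 i hi.2, Function.update_of_ne hi.1]
    · rcases Finset.mem_insert.1 hi with rfl | hi
      · rw [h1 i ha, Function.update_self]; exact hx
      · exact h2 i hi

/-- The heights of the nodes in `P` are independent and the others are unchanged, so that the
expectation of a product factorizes. -/
lemma expect_draws_prod (P A : Finset p.Node) (w : ℕ → ℝ≥0∞) (h : p.Node → ℕ) :
    expect (draws P h) (fun h' => ∏ i ∈ A, w (h' i)) =
      (∏ i ∈ A \ P, w (h i)) * expect p.heightLaw w ^ (A ∩ P).card := by
  induction P using Finset.induction_on generalizing h A with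
  | empty => simp [expect_pure]
  | insert a P ha ih =>
    rw [draws_insert ha, expect_bind]
    simp_rw [ih]
    by_cases hA : a ∈ A
    · have e1 : A \ P = insert a (A \ insert a P) := by
        ext i; simp only [Finset.mem_insert, Finset.mem_sdiff]
        by_cases hi : i = a
        · subst hi; simp [hA, ha]
        · simp [hi]
      have e2 : A ∩ insert a P = insert a (A ∩ P) := by
        ext i; simp only [Finset.mem_insert, Finset.mem_inter]
        by_cases hi : i = a
        · subst hi; simp [hA]
        · simp [hi]
      have e3 : ∀ x, ∏ i ∈ A \ P, w (Function.update h a x i) =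
          w x * ∏ i ∈ A \ insert a P, w (h i) := by
        intro x
        rw [e1, Finset.prod_insert (by simp), Function.update_self]
        congr 1
        refine Finset.prod_congr rfl fun i hi => ?_
        rw [Function.update_of_ne]
        rintro rfl; simp at hi
      simp_rw [e3]
      rw [expect_mul_const, expect_mul_const, e2, Finset.card_insert_of_notMem (by simp [ha])]
      ring
    · have e1 : A \ insert a P = A \ P := by
        ext i; simp only [Finset.mem_insert, Finset.mem_sdiff]
        by_cases hi : i = a
        · subst hi; simp [hA]
        · simp [hi]
      have e2 : A ∩ insert a P = A ∩ P := by
        ext i; simp only [Finset.mem_insert, Finset.mem_inter]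
        by_cases hi : i = a
        · subst hi; simp [hA]
        · simp [hi]
      have e3 : ∀ x, ∏ i ∈ A \ P, w (Function.update h a x i) = ∏ i ∈ A \ P, w (h i) := by
        intro x
        refine Finset.prod_congr rfl fun i hi => ?_
        rw [Function.update_of_ne]
        rintro rfl; simp [hA] at hi
      simp_rw [e3, e1, e2, expect_const]

lemma expect_draws_of_mem {P : Finset p.Node} {i : p.Node} (hi : i ∈ P) (w : ℕ → ℝ≥0∞)
    (h : p.Node → ℕ) : expect (draws P h) (fun h' => w (h' i)) = expect p.heightLaw w := by
  have := expect_draws_prod P {i} w h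
  have e : ({i} : Finset p.Node) \ P = ∅ := by simpa using hi
  simpa [e, Finset.singleton_inter_of_mem hi] using this

lemma expect_draws_of_notMem {P : Finset p.Node} {i : p.Node} (hi : i ∉ P) (w : ℕ → ℝ≥0∞)
    (h : p.Node → ℕ) : expect (draws P h) (fun h' => w (h' i)) = w (h i) := by
  rw [← expect_const (draws P h) (w (h i))]
  exact expect_congr fun h' hh => by rw [(draws_support hh).1 i hi]

/-- The probability that all nodes of `P` draw a height of at most `e`. -/
lemma expect_draws_forall_le (P : Finset p.Node) (e : ℝ) (h : p.Node → ℕ) :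
    expect (draws P h) (fun h' => ind (∀ i ∈ P, (h' i : ℝ) ≤ e)) = (1 - p.tail e) ^ P.card := by
  have := expect_draws_prod P P (fun x => ind ((x : ℝ) ≤ e)) h
  rw [p.expect_not_lt] at this
  simp only [Finset.sdiff_self, Finset.prod_empty, Finset.inter_self, one_mul] at this
  rw [← this]
  refine expect_congr fun h' _ => ?_
  by_cases hh : ∀ i ∈ P, (h' i : ℝ) ≤ e
  · rw [ind_of hh, Finset.prod_eq_one fun i hi => ind_of (hh i hi)]
  · rw [ind_of_not hh]
    push Not at hh
    obtain ⟨i, hi, hlt⟩ := hh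
    rw [Finset.prod_eq_zero hi (ind_of_not (not_le.2 hlt))]

lemma expect_draws_sum (P : Finset p.Node) (w : ℕ → ℝ≥0∞) (h : p.Node → ℕ) :
    expect (draws P h) (fun h' => ∑ i ∈ P, w (h' i)) = P.card * expect p.heightLaw w := by
  rw [expect_sum, Finset.sum_congr rfl fun i hi => expect_draws_of_mem hi w h, Finset.sum_const,
    nsmul_eq_mul]

lemma expect_draws_exists_lt (P : Finset p.Node) (e : ℝ) (h : p.Node → ℕ) :
    expect (draws P h) (fun h' => ind (∃ i ∈ P, e < (h' i : ℝ))) ≤ P.card * p.tail e :=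
  (expect_mono fun _ _ => ind_exists_mem_le).trans (expect_draws_sum P _ h).le

/-- Go through the nodes of `P` in the order of their data items up to the first one with property
`A`. If a new height has property `B` with at most `ρ` times the probability of `A`, then at most
`ρ` nodes with property `B` are met in expectation: each node that has `A` ends the search. -/
lemma expect_draws_until_first {D : Type*} [LinearOrder D] {data : p.Node → D}
    (hd : Function.Injective data) (A B : ℕ → Prop) (ρ : ℝ≥0∞)
    (hAB : expect p.heightLaw (fun x => ind (B x)) ≤ ρ * expect p.heightLaw fun x => ind (A x))
    (P : Finset p.Node) (h : p.Node → ℕ) :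
    expect (draws P h) (fun h' =>
      ∑ i ∈ P, ind (B (h' i) ∧ ∀ j ∈ P, A (h' j) → data i ≤ data j)) ≤ ρ := by
  induction P using Finset.induction_on_min_value data generalizing h with
  | empty => simp [expect_const]
  | insert a P ha hmin ih =>
    rw [draws_insert ha, expect_bind]
    have key : ∀ x, expect (draws P (Function.update h a x)) (fun h' =>
        ∑ i ∈ insert a P, ind (B (h' i) ∧ ∀ j ∈ insert a P, A (h' j) → data i ≤ data j)) ≤
          ind (B x) + ind (¬ A x) * ρ := by
      intro x
      calc _ ≤ expect (draws P (Function.update h a x)) (fun h' => ind (B x) + ind (¬ A x) *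
            ∑ i ∈ P, ind (B (h' i) ∧ ∀ j ∈ P, A (h' j) → data i ≤ data j)) := by
            refine expect_mono fun h' hh => ?_
            have hx : h' a = x := by rw [(draws_support hh).1 a ha, Function.update_self]
            rw [Finset.sum_insert ha, hx, Finset.mul_sum]
            refine add_le_add (ind_mono And.left) (Finset.sum_le_sum fun i hi => ?_)
            rw [← ind_and]
            refine ind_mono fun hh => ⟨fun hA => ?_, hh.1, fun j hj =>
              hh.2 j (Finset.mem_insert_of_mem hj)⟩
            -- a node above the minimum `a` is not met, if `a` has property `A`
            have h1 := hh.2 a (Finset.mem_insert_self a P) (hx ▸ hA)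
            exact ha (hd (le_antisymm h1 (hmin i hi)) ▸ hi)
        _ ≤ _ := by
            rw [expect_add, expect_const, expect_const_mul]
            exact add_le_add le_rfl (mul_le_mul_right (ih _) _)
    calc _ ≤ expect p.heightLaw (fun x => ind (B x) + ind (¬ A x) * ρ) :=
          expect_mono fun x _ => key x
      _ ≤ ρ * expect p.heightLaw (fun x => ind (A x)) +
          expect p.heightLaw (fun x => ind (¬ A x)) * ρ := by
          rw [expect_add, expect_mul_const]
          exact add_le_add hAB le_rfl
      _ = ρ * expect p.heightLaw (fun x => ind (A x) + ind (¬ A x)) := by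
          rw [expect_add]; ring
      _ = ρ := by simp_rw [ind_add_not, expect_const, mul_one]

end Heights

/-! ### The outcome of one execution of the body of INITIALIZE -/

section Choose

variable {p : Params} {D : Type*}

lemma choose_support {cur : Option p.Node} {S : Finset p.Node} {q : Option p.Node × ℕ}
    (hq : q ∈ (choose cur S).support) :
    ((∃ i ∈ S, cur = some i) → q = (cur, 0)) ∧ (S.Nonempty → ∃ i ∈ S, q.1 = some i) ∧
      (∀ i, q.1 = some i → i ∈ S) ∧ q.2 ≤ 1 := by
  classical
  unfold choose at hq
  split_ifs at hq with h1 h2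
  · rw [PMF.support_pure, Set.mem_singleton_iff] at hq
    subst hq
    obtain ⟨i, hi, rfl⟩ := h1
    exact ⟨fun _ => rfl, fun _ => ⟨i, hi, rfl⟩,
      fun j hj => by simpa using (by simpa using hj : i = j) ▸ hi, by simp⟩
  · rw [PMF.mem_support_map_iff] at hq
    obtain ⟨i, hi, rfl⟩ := hq
    rw [PMF.mem_support_uniformOfFinset_iff] at hi
    exact ⟨fun h => absurd h h1, fun _ => ⟨i, hi, rfl⟩,
      fun j hj => by simpa using (by simpa using hj : i = j) ▸ hi, by simp⟩
  · rw [PMF.support_pure, Set.mem_singleton_iff] at hq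
    subst hq
    exact ⟨fun h => absurd h h1, fun h => absurd h h2, fun j hj => by simp at hj, by simp⟩

/-- What `chooseAll k` makes of the state `s`: only alarms and representatives change; those of the
classes below `k` are members of their sub-classes, and exist if these are nonempty; nothing is paid
for the classes that were filled. -/
structure Chosen (k : ℕ) (s : State p D) (q : State p D × ℕ) : Prop where
  data : q.1.data = s.data
  height : q.1.height = s.height
  ds : q.1.ds = s.ds
  touched : q.1.touched = s.touched
  alarm_ge : ∀ c, k ≤ c → q.1.alarm c = s.alarm c
  rep_ge : ∀ c, k ≤ c → q.1.rep c = s.rep c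
  alarm_mem : ∀ c < k, ∀ i, q.1.alarm c = some i → i ∈ s.sub c 1
  rep_mem : ∀ c < k, ∀ i, q.1.rep c = some i → i ∈ s.sub c 2
  alarm_some : ∀ c < k, (s.sub c 1).Nonempty → ∃ i ∈ s.sub c 1, q.1.alarm c = some i
  rep_some : ∀ c < k, (s.sub c 2).Nonempty → ∃ i ∈ s.sub c 2, q.1.rep c = some i
  cost : ∀ L, (∀ c, L ≤ c → c < k → s.Filled c) → q.2 ≤ 2 * L

lemma sub_congr {s s' : State p D} (hd : s'.ds = s.ds) (hh : s'.height = s.height) (c τ : ℕ) :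
    s'.sub c τ = s.sub c τ := by
  unfold State.sub; rw [hd, hh]

lemma chosen_of_mem_support {k : ℕ} {s : State p D} {q : State p D × ℕ}
    (hq : q ∈ (chooseAll k s).support) : Chosen k s q := by
  induction k generalizing q with
  | zero =>
    simp only [chooseAll, PMF.support_pure, Set.mem_singleton_iff] at hq
    subst hq
    constructor <;> simp
  | succ k ih =>
    simp only [chooseAll, PMF.mem_support_bind_iff, PMF.mem_support_map_iff] at hq
    obtain ⟨q', hq', a, ha, r, hr, rfl⟩ := hq
    have C := ih hq'
    rw [C.alarm_ge k le_rfl, sub_congr C.ds C.height] at ha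
    rw [C.rep_ge k le_rfl, sub_congr C.ds C.height] at hr
    obtain ⟨a1, a2, a3, a4⟩ := choose_support ha
    obtain ⟨r1, r2, r3, r4⟩ := choose_support hr
    refine ⟨C.data, C.height, C.ds, C.touched, fun c hc => ?_, fun c hc => ?_, fun c hc i => ?_,
      fun c hc i => ?_, fun c hc => ?_, fun c hc => ?_, fun L hL => ?_⟩
    · simp only [Function.update_of_ne (show c ≠ k by omega)]
      exact C.alarm_ge c (by omega)
    · simp only [Function.update_of_ne (show c ≠ k by omega)]
      exact C.rep_ge c (by omega)
    · by_cases hk : c = k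
      · subst hk; simpa only [Function.update_self] using a3 i
      · simpa only [Function.update_of_ne hk] using C.alarm_mem c (by omega) i
    · by_cases hk : c = k
      · subst hk; simpa only [Function.update_self] using r3 i
      · simpa only [Function.update_of_ne hk] using C.rep_mem c (by omega) i
    · by_cases hk : c = k
      · subst hk; simpa only [Function.update_self] using a2
      · simpa only [Function.update_of_ne hk] using C.alarm_some c (by omega)
    · by_cases hk : c = k
      · subst hk; simpa only [Function.update_self] using r2
      · simpa only [Function.update_of_ne hk] using C.rep_some c (by omega)
    · rcases Nat.lt_or_ge k L with h | h
      · have := C.cost k (fun c h1 h2 => by omega)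
        show q'.2 + a.2 + r.2 ≤ _
        omega
      · have := C.cost L (fun c h1 h2 => hL c h1 (by omega))
        obtain ⟨⟨x, hx, hx'⟩, ⟨y, hy, hy'⟩⟩ := hL k h (by omega)
        have e1 := a1 ⟨x, hx, hx'⟩
        have e2 := r1 ⟨y, hy, hy'⟩
        show q'.2 + a.2 + r.2 ≤ _
        rw [e1, e2]
        simpa using this

end Choose

section Build

variable {p : Params} {D : Type*} [LinearOrder D]

lemma coe_lt_inf_coe {ι : Type*} {R : Finset ι} {f : ι → D} {a : D} :
    (a : WithTop D) < R.inf (fun i => (f i : WithTop D)) ↔ ∀ j ∈ R, a < f j := by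
  rw [Finset.lt_inf_iff (show (a : WithTop D) < ⊤ from WithTop.coe_lt_top a)]
  simp only [WithTop.coe_lt_coe]

open scoped Classical in
lemma mem_sweep (data : p.Node → D) (height : p.Node → ℕ) (P : Finset p.Node) (H : ℕ)
    (dmin : WithTop D) (i : p.Node) :
    i ∈ (sweep data height P H dmin).2 ↔
      i ∈ P ∧ 1 ≤ height i ∧ height i ≤ H ∧ (data i : WithTop D) < dmin ∧
        ∀ j ∈ P, height j ≤ H → height i ≤ height j →
          data i ≤ data j ∧ (height i < height j → data i < data j) := by
  induction H generalizing dmin with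
  | zero => simp only [sweep, Finset.notMem_empty, false_iff]; omega
  | succ H ih =>
    simp only [sweep, Finset.mem_union, Finset.mem_filter, ih, lt_min_iff,
      coe_lt_inf_coe]
    constructor
    · rintro (⟨⟨hP, hh, hd⟩, hmin⟩ | ⟨hP, h1, hH, ⟨hd, hR⟩, hj⟩)
      · refine ⟨hP, by omega, by omega, hd, fun j hj hjH hij => ⟨?_, fun _ => by omega⟩⟩
        by_cases hjd : (data j : WithTop D) < dmin
        · exact hmin j ⟨hj, by omega, hjd⟩
        · exact (WithTop.coe_lt_coe.1 (hd.trans_le (not_lt.1 hjd))).le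
      · refine ⟨hP, h1, by omega, hd, fun j hjP hjH hij => ?_⟩
        rcases Nat.lt_or_ge H (height j) with hlt | hle
        · have : data i < data j := by
            by_cases hjd : (data j : WithTop D) < dmin
            · exact hR j ⟨hjP, by omega, hjd⟩
            · exact WithTop.coe_lt_coe.1 (hd.trans_le (not_lt.1 hjd))
          exact ⟨this.le, fun _ => this⟩
        · exact hj j hjP hle hij
    · rintro ⟨hP, h1, hH, hd, hj⟩
      rcases Nat.lt_or_ge H (height i) with hlt | hle
      · left
        exact ⟨⟨hP, by omega, hd⟩, fun j hjR => (hj j hjR.1 (by omega) (by omega)).1⟩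
      · right
        exact ⟨hP, h1, hle, ⟨hd, fun j hjR => by
          exact (hj j hjR.1 (by omega) (by omega)).2 (by omega)⟩,
          fun j hjP hjH hij => hj j hjP (by omega) hij⟩

open scoped Classical in
/-- Every probe with a threshold is charged to a node of greater height, and only nodes with a
smaller data item than all nodes of greater height respond. -/
lemma sweep_cost_le (data : p.Node → D) (height : p.Node → ℕ) (P : Finset p.Node) (H : ℕ)
    (dmin : WithTop D) :
    (sweep data height P H dmin).1 ≤ ∑ k ∈ Finset.range H,
      ((if dmin ≠ ⊤ ∨ ∃ j ∈ P, k + 1 < height j ∧ height j ≤ H then 1 else 0) +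
        (P.filter fun i => height i = k + 1 ∧ (data i : WithTop D) < dmin ∧
          ∀ j ∈ P, k + 1 < height j → height j ≤ H → data i < data j).card) := by
  induction H generalizing dmin with
  | zero => simp [sweep]
  | succ H ih =>
    rw [Finset.sum_range_succ]
    simp only [sweep]
    refine (add_comm _ _).trans_le (add_le_add ((ih _).trans (Finset.sum_le_sum fun k hk => ?_)) ?_)
    · rw [Finset.mem_range] at hk
      refine add_le_add ?_ (Finset.card_le_card fun i => ?_)
      · split_ifs with h1 h2 <;> try omega
        exfalso
        apply h2
        rcases h1 with h1 | ⟨j, hj, h3, h4⟩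
        · by_cases hd : dmin = ⊤
          · subst hd
            right
            rw [top_inf_eq] at h1
            by_contra hne
            apply h1
            rw [Finset.inf_eq_top_iff]
            intro j hj
            rw [Finset.mem_filter] at hj
            exact absurd ⟨j, hj.1, by omega, by omega⟩ hne
          · exact Or.inl hd
        · exact Or.inr ⟨j, hj, h3, by omega⟩
      · simp only [Finset.mem_filter, lt_min_iff, coe_lt_inf_coe]
        rintro ⟨hP, hh, ⟨hd, hR⟩, hj⟩
        refine ⟨hP, hh, hd, fun j hjP h1 h2 => ?_⟩
        rcases Nat.lt_or_ge H (height j) with hlt | hle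
        · by_cases hjd : (data j : WithTop D) < dmin
          · exact hR j ⟨hjP, by omega, hjd⟩
          · exact WithTop.coe_lt_coe.1 (hd.trans_le (not_lt.1 hjd))
        · exact hj j hjP h1 hle
    · refine add_le_add ?_ (Finset.card_le_card fun i => ?_)
      · split_ifs <;> simp_all
      · simp only [Finset.mem_filter]
        rintro ⟨hP, hh, hd⟩
        exact ⟨hP, hh, hd, fun j _ h1 h2 => by omega⟩

open scoped Classical in
/-- The state in which `build P s` chooses the missing alarms and representatives, if the new
heights are `h`. -/
noncomputable def State.prepared (s : State p D) (P : Finset p.Node) (h : p.Node → ℕ) :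
    State p D where
  data := s.data
  height := h
  ds := leftPath s.data h ((s.ds \ P) ∪ (sweep s.data h P p.hmax ⊤).2)
  alarm := fun ℓ => (s.alarm ℓ).filter fun i => i ∉ P
  rep := fun ℓ => (s.rep ℓ).filter fun i => i ∉ P
  touched := ∅

/-- The possible results of `build P s`, if the new heights are `h`. -/
def Outcome (s : State p D) (P : Finset p.Node) (h : p.Node → ℕ) (q : State p D × ℕ) : Prop :=
  ∃ c, Chosen p.classes (s.prepared P h) (q.1, c) ∧ q.2 = 1 + (sweep s.data h P p.hmax ⊤).1 + c

lemma build_eq (P : Finset p.Node) (s : State p D) :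
    build P s = (draws P s.height).bind fun h =>
      (chooseAll p.classes (s.prepared P h)).map fun q =>
        (q.1, 1 + (sweep s.data h P p.hmax ⊤).1 + q.2) := by
  rfl

lemma outcome_of_mem_support {P : Finset p.Node} {s : State p D} {q : State p D × ℕ}
    (hq : q ∈ (build P s).support) :
    ∃ h ∈ (draws P s.height).support, Outcome s P h q := by
  simp only [build_eq, PMF.mem_support_bind_iff, PMF.mem_support_map_iff] at hq
  obtain ⟨h, hh, q', hq', rfl⟩ := hq
  exact ⟨h, hh, q'.2, chosen_of_mem_support hq', rfl⟩

/-- An expectation over the result of `build` is bounded through the new heights. -/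
lemma expect_build_le {P : Finset p.Node} {s : State p D} {f : State p D × ℕ → ℝ≥0∞}
    {g : (p.Node → ℕ) → ℝ≥0∞}
    (H : ∀ h ∈ (draws P s.height).support, ∀ q, Outcome s P h q → f q ≤ g h) :
    expect (build P s) f ≤ expect (draws P s.height) g := by
  rw [build_eq, expect_bind]
  refine expect_mono fun h hh => ?_
  rw [expect_map]
  exact expect_le_of_forall fun q hq => H h hh _ ⟨q.2, chosen_of_mem_support hq, rfl⟩

end Build

/-! ### Heights, levels and classes -/

section Levels

variable {p : Params} {D : Type*}

/-- The width of half a sub-class. -/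
noncomputable def Params.width (p : Params) : ℝ := p.κ * p.unit

lemma Params.inSub_iff {c τ h : ℕ} : p.InSub c τ h ↔
    (8 * c + (2 * τ + 1)) * p.width < h ∧ (h : ℝ) ≤ (8 * c + (2 * τ + 3)) * p.width := by
  unfold Params.InSub Params.width
  simp only [mul_assoc]

lemma Params.levelOf_mono (hw : 0 < p.width) {h h' : ℕ} (hh : h ≤ h') :
    p.levelOf h ≤ p.levelOf h' := by
  have h8 : 0 < 8 * p.κ * p.unit := by unfold Params.width at hw; linarith
  unfold Params.levelOf
  refine Nat.sub_le_sub_right (Nat.ceil_le_ceil ?_) 1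
  gcongr

lemma Params.levelOf_le_iff (hw : 0 < p.width) {h c : ℕ} :
    p.levelOf h ≤ c ↔ (h : ℝ) ≤ 8 * (c + 1) * p.width := by
  have h8 : 0 < 8 * p.κ * p.unit := by unfold Params.width at hw; linarith
  unfold Params.levelOf
  rw [Nat.sub_le_iff_le_add, Nat.ceil_le, div_le_iff₀ h8]
  unfold Params.width
  push_cast
  constructor <;> intro h <;> linarith

lemma Params.levelOf_of_inSub (hw : 0 < p.width) {c τ h : ℕ} (hτ : τ ≤ 2) (hh : p.InSub c τ h) :
    p.levelOf h = c := by
  rw [Params.inSub_iff] at hh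
  have hτ' : (τ : ℝ) ≤ 2 := by exact_mod_cast hτ
  have hτ0 : (0 : ℝ) ≤ τ := by positivity
  refine le_antisymm ((Params.levelOf_le_iff hw).2 (hh.2.trans ?_)) ?_
  · nlinarith
  · by_contra hlt
    rw [not_le] at hlt
    obtain ⟨c', rfl⟩ : ∃ c', c = c' + 1 := ⟨c - 1, by omega⟩
    have := (Params.levelOf_le_iff hw).1 (Nat.lt_succ_iff.1 hlt)
    push_cast at hh
    nlinarith

lemma State.mem_sub {s : State p D} {c τ : ℕ} {i : p.Node} :
    i ∈ s.sub c τ ↔ i ∈ s.ds ∧ p.InSub c τ (s.height i) := by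
  simp [State.sub]

lemma State.filled_of_unfilledTop_le {s : State p D} {c : ℕ} (h : s.unfilledTop ≤ c)
    (hc : c < p.classes) : s.Filled c := by
  classical
  by_contra hf
  have : c + 1 ≤ s.unfilledTop :=
    Finset.le_sup (f := fun ℓ => ℓ + 1) (Finset.mem_filter.2 ⟨Finset.mem_range.2 hc, hf⟩)
  omega

lemma State.unfilledTop_le {s : State p D} {L : ℕ} (h : ∀ c, L ≤ c → c < p.classes → s.Filled c) :
    s.unfilledTop ≤ L := by
  classical
  refine Finset.sup_le fun c hc => ?_
  rw [Finset.mem_filter, Finset.mem_range] at hc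
  by_contra hlt
  exact hc.2 (h c (by omega) hc.1)

lemma State.unfilledTop_le_classes (s : State p D) : s.unfilledTop ≤ p.classes :=
  State.unfilledTop_le fun _ h1 h2 => absurd h2 (by omega)

lemma State.lt_unfilledTop {s : State p D} {c : ℕ} (hc : c < p.classes) (hf : ¬ s.Filled c) :
    c < s.unfilledTop := by
  by_contra h
  exact hf (State.filled_of_unfilledTop_le (not_lt.1 h) hc)

lemma State.level_lt_touchedTop {s : State p D} {j : p.Node} (hj : j ∈ s.touched) :
    p.levelOf (s.height j) < s.touchedTop :=
  Finset.le_sup (f := fun i => p.levelOf (s.height i) + 1) hj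

end Levels

/-! ### Invariants of the execution -/

section Invariants

variable {p : Params} {D : Type*} [LinearOrder D]

/-- The invariant of all reachable states: the stored pairs form a left-most path; no node that was
not updated has a smaller data item and a higher level than a stored pair; alarms and
representatives belong to classes in use and are stored in their sub-classes. -/
structure State.Valid (s : State p D) : Prop where
  left : ∀ i ∈ s.ds, ∀ j ∈ s.ds, s.height i ≤ s.height j → s.data i ≤ s.data j
  above : ∀ r ∈ s.ds, ∀ j ∉ s.touched, s.data j < s.data r →
    p.levelOf (s.height j) ≤ p.levelOf (s.height r)
  alarm_mem : ∀ c i, s.alarm c = some i → c < p.classes ∧ i ∈ s.sub c 1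
  rep_mem : ∀ c i, s.rep c = some i → c < p.classes ∧ i ∈ s.sub c 2

/-- The sets of nodes on which INITIALIZE may be called: they contain the nodes with the smallest
data items, and no stored pair outside has a lower level than an updated node outside. -/
structure State.Admissible (s : State p D) (P : Finset p.Node) : Prop where
  lt : ∀ i ∈ P, ∀ j ∉ P, s.data i < s.data j
  level : ∀ r ∈ s.ds, r ∉ P → ∀ j ∈ s.touched, j ∉ P →
    p.levelOf (s.height j) ≤ p.levelOf (s.height r)

variable {s : State p D} {P : Finset p.Node} {h : p.Node → ℕ} {q : State p D × ℕ}

lemma mem_sweep_top (hm : 1 ≤ p.hmax) (hd : Function.Injective s.data)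
    (hh : h ∈ (draws P s.height).support) {i : p.Node} :
    i ∈ (sweep s.data h P p.hmax ⊤).2 ↔ i ∈ P ∧ ∀ j ∈ P, h i ≤ h j → s.data i ≤ s.data j := by
  have hsup := (draws_support hh).2
  rw [mem_sweep]
  constructor
  · rintro ⟨hP, -, -, -, hj⟩
    exact ⟨hP, fun j hjP hij => (hj j hjP (Params.le_hmax_of_mem_support (hsup j hjP)) hij).1⟩
  · rintro ⟨hP, hj⟩
    refine ⟨hP, Params.pos_of_mem_support hm (hsup i hP), Params.le_hmax_of_mem_support (hsup i hP),
      WithTop.coe_lt_top _, fun j hjP _ hij => ⟨hj j hjP hij, fun hlt => ?_⟩⟩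
    refine lt_of_le_of_ne (hj j hjP hij) fun he => ?_
    rw [hd he] at hlt
    exact lt_irrefl _ hlt

lemma exists_sweep_dominating (hm : 1 ≤ p.hmax) (hd : Function.Injective s.data)
    (hh : h ∈ (draws P s.height).support) {j : p.Node} (hj : j ∈ P) :
    ∃ k ∈ (sweep s.data h P p.hmax ⊤).2, h j ≤ h k ∧ s.data k ≤ s.data j := by
  classical
  obtain ⟨k, hk, hmin⟩ := Finset.exists_min_image (P.filter fun k => h j ≤ h k) s.data
    ⟨j, Finset.mem_filter.2 ⟨hj, le_rfl⟩⟩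
  rw [Finset.mem_filter] at hk
  refine ⟨k, (mem_sweep_top hm hd hh).2 ⟨hk.1, fun i hi hki => ?_⟩, hk.2,
    hmin j (Finset.mem_filter.2 ⟨hj, le_rfl⟩)⟩
  exact hmin i (Finset.mem_filter.2 ⟨hi, hk.2.trans hki⟩)

lemma mem_prepared_ds {i : p.Node} : i ∈ (s.prepared P h).ds ↔
    ((i ∈ s.ds ∧ i ∉ P) ∨ i ∈ (sweep s.data h P p.hmax ⊤).2) ∧
      ∀ j, ((j ∈ s.ds ∧ j ∉ P) ∨ j ∈ (sweep s.data h P p.hmax ⊤).2) → h i ≤ h j →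
        s.data i ≤ s.data j := by
  classical
  simp only [State.prepared, leftPath, Finset.mem_filter, Finset.mem_union, Finset.mem_sdiff]

/-- A node of `P` enters the data structure, if its data item is the smallest one above a bound of
the heights. -/
lemma mem_prepared_ds_of_first (hm : 1 ≤ p.hmax) (hd : Function.Injective s.data)
    (hP : s.Admissible P) (hh : h ∈ (draws P s.height).support) {e : ℝ} {i : p.Node} (hi : i ∈ P)
    (he : e < h i) (hmin : ∀ j ∈ P, e < h j → s.data i ≤ s.data j) :
    i ∈ (s.prepared P h).ds := by
  have hlow : ∀ j ∈ P, h i ≤ h j → s.data i ≤ s.data j := fun j hj hij =>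
    hmin j hj (he.trans_le (by exact_mod_cast hij))
  refine mem_prepared_ds.2 ⟨Or.inr ((mem_sweep_top hm hd hh).2 ⟨hi, hlow⟩), fun j hj hij => ?_⟩
  rcases hj with hj | hj
  · exact (hP.lt i hi j hj.2).le
  · exact hlow j ((mem_sweep_top hm hd hh).1 hj).1 hij

lemma mem_prepared_ds_of_old (hs : s.Valid) (hm : 1 ≤ p.hmax) (hd : Function.Injective s.data)
    (hh : h ∈ (draws P s.height).support) {i : p.Node} (hi : i ∈ s.ds) (hiP : i ∉ P)
    (hlow : ∀ j ∈ P, h j < h i) : i ∈ (s.prepared P h).ds := by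
  refine mem_prepared_ds.2 ⟨Or.inl ⟨hi, hiP⟩, fun j hj hij => ?_⟩
  rcases hj with hj | hj
  · rw [(draws_support hh).1 i hiP, (draws_support hh).1 j hj.2] at hij
    exact hs.left i hi j hj.1 hij
  · exact absurd (hlow j ((mem_sweep_top hm hd hh).1 hj).1) (by omega)

lemma Outcome.data_eq (ho : Outcome s P h q) : q.1.data = s.data := by
  obtain ⟨c, C, -⟩ := ho; exact C.data

lemma Outcome.height_eq (ho : Outcome s P h q) : q.1.height = h := by
  obtain ⟨c, C, -⟩ := ho; exact C.height

lemma Outcome.ds_eq (ho : Outcome s P h q) : q.1.ds = (s.prepared P h).ds := by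
  obtain ⟨c, C, -⟩ := ho; exact C.ds

lemma Outcome.touched_eq (ho : Outcome s P h q) : q.1.touched = ∅ := by
  obtain ⟨c, C, -⟩ := ho; exact C.touched

lemma Outcome.sub_eq (ho : Outcome s P h q) (c τ : ℕ) : q.1.sub c τ = (s.prepared P h).sub c τ :=
  sub_congr ho.ds_eq ho.height_eq c τ

lemma Outcome.filled (ho : Outcome s P h q) {c : ℕ} (hc : c < p.classes)
    (h1 : (q.1.sub c 1).Nonempty) (h2 : (q.1.sub c 2).Nonempty) : q.1.Filled c := by
  have e1 := ho.sub_eq c 1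
  have e2 := ho.sub_eq c 2
  obtain ⟨x, C, -⟩ := ho
  unfold State.Filled
  rw [e1] at h1 ⊢
  rw [e2] at h2 ⊢
  exact ⟨C.alarm_some c hc h1, C.rep_some c hc h2⟩

lemma Outcome.valid (ho : Outcome s P h q) (hw : 0 < p.width) (hs : s.Valid) (hm : 1 ≤ p.hmax)
    (hd : Function.Injective s.data) (hP : s.Admissible P)
    (hh : h ∈ (draws P s.height).support) : q.1.Valid := by
  have hold := (draws_support hh).1
  refine ⟨?_, ?_, fun c i hi => ?_, fun c i hi => ?_⟩
  · rw [ho.ds_eq, ho.height_eq, ho.data_eq]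
    intro i hi j hj hij
    exact (mem_prepared_ds.1 hi).2 j (mem_prepared_ds.1 hj).1 hij
  · rw [ho.ds_eq, ho.height_eq, ho.data_eq]
    intro r hr j _ hjr
    rw [mem_prepared_ds] at hr
    obtain ⟨hrU, hrmin⟩ := hr
    refine (le_or_gt (h j) (h r)).elim (fun hle => Params.levelOf_mono hw hle) fun hlt => ?_
    by_cases hjP : j ∈ P
    · obtain ⟨k, hk, hjk, hkj⟩ := exists_sweep_dominating hm hd hh hjP
      exact absurd (hrmin k (Or.inr hk) (by omega)) (not_le.2 (hkj.trans_lt hjr))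
    rcases hrU with ⟨hrd, hrP⟩ | hrS
    · rw [hold j hjP, hold r hrP]
      by_cases hjt : j ∈ s.touched
      · exact hP.level r hrd hrP j hjt hjP
      · exact hs.above r hrd j hjt hjr
    · exact absurd hjr (not_lt.2 (hP.lt r ((mem_sweep_top hm hd hh).1 hrS).1 j hjP).le)
  · have e1 := ho.sub_eq c 1
    obtain ⟨x, C, -⟩ := ho
    rcases lt_or_ge c p.classes with hc | hc
    · exact ⟨hc, e1 ▸ C.alarm_mem c hc i hi⟩
    · have := C.alarm_ge c hc
      dsimp only at this hi
      rw [hi] at this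
      have := (Option.filter_eq_some_iff.1 this.symm).1
      exact absurd (hs.alarm_mem c i this).1 (by omega)
  · have e1 := ho.sub_eq c 2
    obtain ⟨x, C, -⟩ := ho
    rcases lt_or_ge c p.classes with hc | hc
    · exact ⟨hc, e1 ▸ C.rep_mem c hc i hi⟩
    · have := C.rep_ge c hc
      dsimp only at this hi
      rw [hi] at this
      have := (Option.filter_eq_some_iff.1 this.symm).1
      exact absurd (hs.rep_mem c i this).1 (by omega)

lemma admissible_univ (s : State p D) : s.Admissible Finset.univ :=
  ⟨fun _ _ j hj => absurd (Finset.mem_univ j) hj, fun r _ hr => absurd (Finset.mem_univ r) hr⟩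

lemma State.below_eq {s : State p D} {b : ℕ} {r : p.Node} (hr : s.rep b = some r) :
    s.below b = Finset.univ.filter fun i => s.data i < s.data r := by
  classical
  unfold State.below
  rw [hr]

lemma State.mem_below {s : State p D} {b : ℕ} {r i : p.Node} (hr : s.rep b = some r) :
    i ∈ s.below b ↔ s.data i < s.data r := by
  rw [State.below_eq hr]; simp

/-- The three possibilities for the nodes on which REFRESH calls INITIALIZE. -/
lemma State.participants_cases (s : State p D) :
    (s.participants = ∅ ∧ s.AllFilled ∧ s.touched = ∅) ∨
    (s.participants = Finset.univ ∧ p.classes ≤ max s.unfilledTop s.touchedTop) ∨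
    ∃ b r, s.rep b = some r ∧ s.participants = s.below b ∧ s.unfilledTop ≤ b ∧
      s.touchedTop ≤ b + 1 ∧ b ≤ max s.unfilledTop s.touchedTop := by
  classical
  unfold State.participants
  rcases hT : max s.unfilledTop s.touchedTop with _ | ℓ
  · left
    have h1 : s.unfilledTop = 0 := by omega
    have h2 : s.touchedTop = 0 := by omega
    refine ⟨rfl, fun c hc => State.filled_of_unfilledTop_le (by omega) hc, ?_⟩
    rw [Finset.eq_empty_iff_forall_notMem]
    intro j hj
    have := State.level_lt_touchedTop hj
    omega
  · right
    dsimp only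
    split_ifs with hf
    · right
      obtain ⟨r, -, hr⟩ := hf.2
      refine ⟨ℓ, r, hr, rfl, ?_, by omega, by omega⟩
      refine State.unfilledTop_le fun c hc hcc => ?_
      rcases hc.eq_or_lt with rfl | hlt
      · exact hf
      · exact State.filled_of_unfilledTop_le (by omega) hcc
    · rcases hr : s.rep (ℓ + 1) with _ | r
      · left
        refine ⟨?_, ?_⟩
        · unfold State.below; rw [hr]
        · by_contra hlt
          obtain ⟨r, -, hr'⟩ := (State.filled_of_unfilledTop_le (s := s) (c := ℓ + 1)
            (by omega) (by omega)).2
          rw [hr] at hr'; cases hr'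
      · right
        exact ⟨ℓ + 1, r, hr, rfl, by omega, by omega, by omega⟩

lemma State.Valid.not_mem_below (hs : s.Valid) {b : ℕ} {r i : p.Node} (hr : s.rep b = some r)
    (hi : i ∈ s.ds) (hri : s.height r ≤ s.height i) : i ∉ s.below b := by
  rw [State.mem_below hr, not_lt]
  exact hs.left r (State.mem_sub.1 (hs.rep_mem b r hr).2).1 i hi hri

lemma State.Valid.admissible_below (hw : 0 < p.width) (hs : s.Valid)
    (hd : Function.Injective s.data) {b : ℕ} {r : p.Node} (hr : s.rep b = some r)
    (ht : s.touchedTop ≤ b + 1) : s.Admissible (s.below b) := by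
  have hrs := State.mem_sub.1 (hs.rep_mem b r hr).2
  refine ⟨fun i hi j hj => ?_, fun i hi hib j hj _ => ?_⟩
  · rw [State.mem_below hr] at hi hj
    exact hi.trans_le (not_lt.1 hj)
  · rw [State.mem_below hr, not_lt] at hib
    have h1 := State.level_lt_touchedTop hj
    have h2 : p.levelOf (s.height r) = b := Params.levelOf_of_inSub hw le_rfl hrs.2
    have h3 : s.height r ≤ s.height i := by
      by_contra hlt
      have := hs.left i hi r hrs.1 (by omega)
      rw [hd (le_antisymm this hib)] at hlt
      exact hlt le_rfl
    have := Params.levelOf_mono hw h3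
    omega

lemma State.Valid.admissible_participants (hw : 0 < p.width) (hs : s.Valid)
    (hd : Function.Injective s.data) : s.Admissible s.participants := by
  rcases s.participants_cases with ⟨hp, -, ht⟩ | ⟨hp, -⟩ | ⟨b, r, hr, hp, -, ht, -⟩
  · rw [hp]
    exact ⟨fun i hi => absurd hi (Finset.notMem_empty i), fun r _ _ j hj => by simp [ht] at hj⟩
  · rw [hp]; exact admissible_univ s
  · rw [hp]; exact hs.admissible_below hw hd hr ht

/-- The smallest data item of `P` above a height belonging to the lower end of a sub-class is above
its upper end. -/
def BadEdge (data : p.Node → D) (P : Finset p.Node) (h : p.Node → ℕ) (e : ℝ) : Prop :=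
  ∃ i ∈ P, e + 2 * p.width < h i ∧ ∀ j ∈ P, e < h j → data i ≤ data j

/-- No sub-class of alarms or representatives is skipped by the new heights. -/
def NoBadEdge (data : p.Node → D) (P : Finset p.Node) (h : p.Node → ℕ) : Prop :=
  ∀ c < p.classes, ¬ BadEdge data P h ((8 * c + 3) * p.width) ∧
    ¬ BadEdge data P h ((8 * c + 5) * p.width)

lemma NoBadEdge.not_bad (hn : NoBadEdge s.data P h) {c τ : ℕ} (hc : c < p.classes)
    (hτ : τ = 1 ∨ τ = 2) : ¬ BadEdge s.data P h ((8 * c + (2 * τ + 1)) * p.width) := by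
  rcases hτ with rfl | rfl
  · convert (hn c hc).1 using 2; push_cast; norm_num
  · convert (hn c hc).2 using 2; push_cast; norm_num

lemma Outcome.sub_nonempty_of_exists (ho : Outcome s P h q) (hm : 1 ≤ p.hmax)
    (hd : Function.Injective s.data) (hP : s.Admissible P)
    (hh : h ∈ (draws P s.height).support) (hn : NoBadEdge s.data P h) {c τ : ℕ}
    (hc : c < p.classes) (hτ : τ = 1 ∨ τ = 2)
    (he : ∃ i ∈ P, (8 * c + (2 * τ + 1)) * p.width < h i) : (q.1.sub c τ).Nonempty := by
  classical
  obtain ⟨i, hi, hie⟩ := he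
  obtain ⟨k, hk, hmin⟩ := Finset.exists_min_image
    (P.filter fun k => (8 * c + (2 * τ + 1)) * p.width < (h k : ℝ)) s.data
    ⟨i, Finset.mem_filter.2 ⟨hi, hie⟩⟩
  rw [Finset.mem_filter] at hk
  have hmin' : ∀ j ∈ P, (8 * c + (2 * τ + 1)) * p.width < (h j : ℝ) → s.data k ≤ s.data j :=
    fun j hj hje => hmin j (Finset.mem_filter.2 ⟨hj, hje⟩)
  refine ⟨k, ?_⟩
  rw [ho.sub_eq, State.mem_sub]
  refine ⟨mem_prepared_ds_of_first hm hd hP hh hk.1 hk.2 hmin', ?_⟩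
  rw [Params.inSub_iff]
  refine ⟨hk.2, ?_⟩
  by_contra hlt
  refine hn.not_bad hc hτ ⟨k, hk.1, ?_, hmin'⟩
  rw [not_le] at hlt
  change _ < (h k : ℝ) at hlt
  linarith

lemma Outcome.sub_nonempty_of_old (ho : Outcome s P h q) (hs : s.Valid) (hm : 1 ≤ p.hmax)
    (hd : Function.Injective s.data) (hP : s.Admissible P)
    (hh : h ∈ (draws P s.height).support) (hn : NoBadEdge s.data P h) {c τ : ℕ}
    (hc : c < p.classes) (hτ : τ = 1 ∨ τ = 2) {a : p.Node} (ha : a ∈ s.sub c τ) (haP : a ∉ P) :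
    (q.1.sub c τ).Nonempty := by
  by_cases he : ∃ i ∈ P, (8 * c + (2 * τ + 1)) * p.width < h i
  · exact ho.sub_nonempty_of_exists hm hd hP hh hn hc hτ he
  · push Not at he
    have hha := (draws_support hh).1 a haP
    rw [State.mem_sub] at ha
    refine ⟨a, ?_⟩
    rw [ho.sub_eq, State.mem_sub]
    have ha2 := ha.2
    rw [← hha] at ha2
    refine ⟨mem_prepared_ds_of_old hs hm hd hh ha.1 haP fun j hj => ?_, ha2⟩
    have := (he j hj).trans_lt (Params.inSub_iff.1 ha2).1
    exact_mod_cast this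

/-- If all classes from `b` on are filled and the nodes below `r_b` draw new heights, one of which
exceeds the lower end of sub-class `(b, 1)`, then all classes get filled. -/
lemma Outcome.allFilled_of_below {b : ℕ} {r : p.Node} (ho : Outcome s (s.below b) h q)
    (hw : 0 < p.width) (hs : s.Valid) (hm : 1 ≤ p.hmax) (hd : Function.Injective s.data)
    (hr : s.rep b = some r) (hP : s.Admissible (s.below b)) (hb : s.unfilledTop ≤ b)
    (hh : h ∈ (draws (s.below b) s.height).support) (hn : NoBadEdge s.data (s.below b) h)
    (he : ∃ i ∈ s.below b, (8 * b + 3) * p.width < h i) : q.1.AllFilled := by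
  intro c hc
  obtain ⟨i, hi, hie⟩ := he
  have hrs := hs.rep_mem b r hr
  have hrs' := State.mem_sub.1 hrs.2
  rcases lt_trichotomy c b with hcb | rfl | hcb
  · have hcb' : (c : ℝ) + 1 ≤ b := by exact_mod_cast hcb
    refine ho.filled hc (ho.sub_nonempty_of_exists hm hd hP hh hn hc (Or.inl rfl) ⟨i, hi, ?_⟩)
      (ho.sub_nonempty_of_exists hm hd hP hh hn hc (Or.inr rfl) ⟨i, hi, ?_⟩) <;>
    · refine lt_of_le_of_lt ?_ hie
      push_cast
      nlinarith
  · refine ho.filled hc (ho.sub_nonempty_of_exists hm hd hP hh hn hc (Or.inl rfl) ⟨i, hi, ?_⟩)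
      (ho.sub_nonempty_of_old hs hm hd hP hh hn hc (Or.inr rfl) hrs.2
        (hs.not_mem_below hr hrs'.1 le_rfl))
    refine lt_of_le_of_lt ?_ hie
    push_cast
    linarith
  · have hcb' : (b : ℝ) + 1 ≤ c := by exact_mod_cast hcb
    have hf := State.filled_of_unfilledTop_le (show s.unfilledTop ≤ c by omega) hc
    have aux : ∀ τ, τ = 1 ∨ τ = 2 → ∀ a ∈ s.sub c τ, a ∉ s.below b := by
      intro τ hτ a ha
      rw [State.mem_sub] at ha
      refine hs.not_mem_below hr ha.1 ?_
      have h1 := (Params.inSub_iff.1 hrs'.2).2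
      have h2 := (Params.inSub_iff.1 ha.2).1
      have hτ0 : (0 : ℝ) ≤ τ := by positivity
      have : (s.height r : ℝ) ≤ s.height a := by
        refine h1.trans (le_trans ?_ h2.le)
        push_cast
        nlinarith
      exact_mod_cast this
    obtain ⟨⟨a, ha, -⟩, ⟨a', ha', -⟩⟩ := hf
    exact ho.filled hc
      (ho.sub_nonempty_of_old hs hm hd hP hh hn hc (Or.inl rfl) ha (aux 1 (Or.inl rfl) a ha))
      (ho.sub_nonempty_of_old hs hm hd hP hh hn hc (Or.inr rfl) ha' (aux 2 (Or.inr rfl) a' ha'))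

/-- If none of the nodes below `r_b` draws a height above the lower end of sub-class `(b, 1)`, then
class `b` loses its alarm: all former candidates have drawn new heights. -/
lemma Outcome.lt_unfilledTop_of_below {b : ℕ} {r : p.Node} (ho : Outcome s (s.below b) h q)
    (hs : s.Valid) (hm : 1 ≤ p.hmax) (hd : Function.Injective s.data)
    (hr : s.rep b = some r) (hh : h ∈ (draws (s.below b) s.height).support)
    (he : ∀ i ∈ s.below b, (h i : ℝ) ≤ (8 * b + 3) * p.width) : b < q.1.unfilledTop := by
  have hrs := hs.rep_mem b r hr
  have hrs' := State.mem_sub.1 hrs.2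
  refine State.lt_unfilledTop hrs.1 fun hf => ?_
  obtain ⟨⟨a, ha, -⟩, -⟩ := hf
  rw [ho.sub_eq, State.mem_sub] at ha
  obtain ⟨ha1, ha2⟩ := ha
  change p.InSub b 1 (h a) at ha2
  rw [Params.inSub_iff] at ha2
  push_cast at ha2
  have ha3 : (8 * b + 3) * p.width < h a := by linarith [ha2.1]
  have haP : a ∉ s.below b := fun hb => absurd (he a hb) (not_le.2 ha3)
  rcases (mem_prepared_ds.1 ha1).1 with ⟨had, -⟩ | haS
  · have h1 := (Params.inSub_iff.1 hrs'.2).1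
    push_cast at h1
    rw [(draws_support hh).1 a haP] at ha2
    have hlt : s.height a < s.height r := by
      have : (s.height a : ℝ) < s.height r := by linarith [ha2.2]
      exact_mod_cast this
    rw [State.mem_below hr, not_lt] at haP
    have := hd (le_antisymm (hs.left a had r hrs'.1 hlt.le) haP)
    rw [this] at hlt
    exact lt_irrefl _ hlt
  · exact haP ((mem_sweep_top hm hd hh).1 haS).1

lemma Outcome.allFilled_of_univ (ho : Outcome s Finset.univ h q) (hw : 0 < p.width)
    (hm : 1 ≤ p.hmax) (hd : Function.Injective s.data)
    (hh : h ∈ (draws Finset.univ s.height).support) (hn : NoBadEdge s.data Finset.univ h)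
    (he : ∃ i ∈ Finset.univ, (8 * p.classes - 3) * p.width < h i) : q.1.AllFilled := by
  intro c hc
  obtain ⟨i, hi, hie⟩ := he
  have hcb' : (c : ℝ) + 1 ≤ p.classes := by exact_mod_cast hc
  refine ho.filled hc
    (ho.sub_nonempty_of_exists hm hd (admissible_univ s) hh hn hc (Or.inl rfl) ⟨i, hi, ?_⟩)
    (ho.sub_nonempty_of_exists hm hd (admissible_univ s) hh hn hc (Or.inr rfl) ⟨i, hi, ?_⟩) <;>
  · refine lt_of_le_of_lt ?_ hie
    push_cast
    nlinarith

/-- If nobody takes part, nothing is lost. -/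
lemma Outcome.allFilled_of_empty (ho : Outcome s ∅ h q) (hs : s.Valid) (hm : 1 ≤ p.hmax)
    (hd : Function.Injective s.data) (hh : h ∈ (draws ∅ s.height).support) (hf : s.AllFilled) :
    q.1.AllFilled := by
  intro c hc
  have aux : ∀ τ, ∀ a ∈ s.sub c τ, (q.1.sub c τ).Nonempty := by
    intro τ a ha
    rw [State.mem_sub] at ha
    refine ⟨a, ?_⟩
    rw [ho.sub_eq, State.mem_sub]
    refine ⟨mem_prepared_ds_of_old hs hm hd hh ha.1 (Finset.notMem_empty a)
      fun j hj => absurd hj (Finset.notMem_empty j), ?_⟩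
    change p.InSub c τ (h a)
    rw [(draws_support hh).1 a (Finset.notMem_empty a)]
    exact ha.2
  obtain ⟨⟨a, ha, -⟩, ⟨a', ha', -⟩⟩ := hf c hc
  exact ho.filled hc (aux 1 a ha) (aux 2 a' ha')

end Invariants

/-! ### The tail of a random height -/

section Tails

variable {p : Params}

lemma Params.tail_eq (p : Params) {e : ℝ} (he : 0 ≤ e) :
    p.tail e = if ⌊e⌋₊ < p.hmax then ENNReal.ofReal (p.φ ^ ⌊e⌋₊) else 0 := by
  unfold Params.tail Params.heightLaw
  rw [expect_map]
  set m := ⌊e⌋₊ with hm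
  have key : ∀ k : ℕ, (e < ((min (k + 1) p.hmax : ℕ) : ℝ)) ↔ (m ≤ k ∧ m < p.hmax) := fun k => by
    rw [← Nat.floor_lt he, lt_min_iff]; omega
  simp_rw [key]
  split_ifs with h
  · simp only [h, and_true]
    unfold expect
    rw [← Summable.sum_add_tsum_nat_add' (k := m) ENNReal.summable, Finset.sum_eq_zero, zero_add]
    · have : ∀ k : ℕ, p.failures (k + m) * ind (m ≤ k + m) =
          ENNReal.ofReal (p.φ ^ m) * p.failures k := by
        intro k
        rw [ind_of (by omega), mul_one]
        change ENNReal.ofReal _ = ENNReal.ofReal _ * ENNReal.ofReal _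
        rw [← ENNReal.ofReal_mul (pow_nonneg p.φ_pos.le m)]
        congr 1
        ring
      simp_rw [this]
      rw [ENNReal.tsum_mul_left, PMF.tsum_coe, mul_one]
    · intro k hk
      rw [Finset.mem_range] at hk
      exact (congrArg _ (ind_of_not (by omega))).trans (mul_zero _)
  · simp only [h, and_false]
    rw [← expect_const p.failures 0]
    exact expect_congr fun _ _ => ind_of_not id

lemma Params.tail_le_pow (p : Params) {e : ℝ} (he : 0 ≤ e) :
    p.tail e ≤ ENNReal.ofReal (p.φ ^ ⌊e⌋₊) := by
  rw [p.tail_eq he]; split_ifs <;> simp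

lemma Params.expect_eq_add_tail (p : Params) (k : ℕ) :
    expect p.heightLaw (fun x => ind (x = k + 1)) + p.tail ((k + 1 : ℕ) : ℝ) = p.tail (k : ℝ) := by
  unfold Params.tail
  rw [← expect_add]
  refine expect_congr fun x _ => ?_
  simp only [Nat.cast_lt]
  by_cases h1 : x = k + 1
  · rw [ind_of h1, ind_of_not (by omega), ind_of (by omega), add_zero]
  · rw [ind_of_not h1, zero_add]
    exact ind_congr (by omega)

lemma Params.expect_eq_le_tail (p : Params) (k : ℕ) :
    expect p.heightLaw (fun x => ind (x = k + 1)) ≤ p.tail (k : ℝ) := by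
  rw [← p.expect_eq_add_tail k]; exact le_self_add

lemma Params.expect_eq_eq (p : Params) {k : ℕ} (hk : k + 1 < p.hmax) :
    expect p.heightLaw (fun x => ind (x = k + 1)) =
      ENNReal.ofReal ((1 - p.φ) / p.φ) * ENNReal.ofReal (p.φ ^ (k + 1)) := by
  have h := p.expect_eq_add_tail k
  rw [p.tail_eq (by positivity), p.tail_eq (by positivity), Nat.floor_natCast, Nat.floor_natCast,
    if_pos hk, if_pos (by omega)] at h
  have hφ := p.φ_pos
  have h1 := p.φ_lt_one
  rw [← ENNReal.ofReal_mul (div_nonneg (by linarith) hφ.le)]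
  have e : (1 - p.φ) / p.φ * p.φ ^ (k + 1) = p.φ ^ k - p.φ ^ (k + 1) := by
    field_simp; ring
  rw [e, ENNReal.ofReal_sub _ (by positivity), ← h]
  exact (ENNReal.add_sub_cancel_right ENNReal.ofReal_ne_top).symm

/-- The range of the parameters in which the analysis is carried out. -/
structure Params.Large (p : Params) : Prop where
  κ_ge : 10 ≤ p.κ
  φ_ge : 1 / p.logN ≤ p.φ
  logN_ge : 16 ≤ p.logN

lemma Params.Large.logN_pos (hp : p.Large) : 0 < p.logN := by linarith [hp.logN_ge]

lemma Params.Large.one_le_log_logN (hp : p.Large) : 1 ≤ Real.log p.logN := by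
  rw [Real.le_log_iff_exp_le hp.logN_pos]
  have := Real.exp_one_lt_d9
  linarith [hp.logN_ge]

lemma Params.Large.inv_φ_le (hp : p.Large) : 1 / p.φ ≤ p.logN := by
  have := hp.φ_ge
  rw [div_le_iff₀ hp.logN_pos] at this
  rw [div_le_iff₀ p.φ_pos]
  linarith

lemma Params.one_lt_inv_φ (p : Params) : 1 < 1 / p.φ := by
  rw [one_lt_div p.φ_pos]; exact p.φ_lt_one

lemma Params.log_inv_φ_pos (p : Params) : 0 < Real.log (1 / p.φ) := Real.log_pos p.one_lt_inv_φ

lemma Params.Large.one_le_unit (hp : p.Large) : 1 ≤ p.unit := by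
  unfold Params.unit Params.logPhi
  rw [Real.le_logb_iff_rpow_le p.one_lt_inv_φ hp.logN_pos, Real.rpow_one]
  exact hp.inv_φ_le

lemma Params.Large.width_pos (hp : p.Large) : 0 < p.width :=
  mul_pos (by linarith [hp.κ_ge]) (by linarith [hp.one_le_unit])

/-- Heights in terms of powers of `log n`: the unit of height is `log_{1/φ} (log n)`. -/
lemma Params.Large.rpow_unit (hp : p.Large) (x : ℝ) : p.φ ^ (x * p.unit) = p.logN ^ (-x) := by
  have h1 : (1 / p.φ) ^ p.unit = p.logN :=
    Real.rpow_logb (by have := p.one_lt_inv_φ; linarith) p.one_lt_inv_φ.ne' hp.logN_pos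
  rw [mul_comm, Real.rpow_mul p.φ_pos.le, Real.rpow_neg hp.logN_pos.le,
    ← Real.inv_rpow hp.logN_pos.le]
  congr 1
  rw [← h1, one_div, Real.inv_rpow p.φ_pos.le, inv_inv]

lemma Params.Large.φ_div_le_unit (hp : p.Large) : p.φ / (1 - p.φ) ≤ p.unit := by
  have hφ := p.φ_pos
  have hφ1 : 0 < 1 - p.φ := by linarith [p.φ_lt_one]
  have h1 : Real.log (1 / p.φ) ≤ 1 / p.φ - 1 := Real.log_le_sub_one_of_pos (by positivity)
  have h2 : 1 / p.φ - 1 = (1 - p.φ) / p.φ := by field_simp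
  unfold Params.unit Params.logPhi Real.logb
  rw [le_div_iff₀ p.log_inv_φ_pos]
  calc p.φ / (1 - p.φ) * Real.log (1 / p.φ) ≤ p.φ / (1 - p.φ) * ((1 - p.φ) / p.φ) := by
        rw [← h2]; gcongr
    _ = 1 := by field_simp
    _ ≤ _ := hp.one_le_log_logN

lemma Params.Large.tail_le (hp : p.Large) {x : ℝ} (hx : 0 ≤ x) :
    p.tail (x * p.width) ≤ ENNReal.ofReal (p.logN ^ (1 - p.κ * x)) := by
  have hw := hp.width_pos
  have he : 0 ≤ x * p.width := by positivity
  refine (p.tail_le_pow he).trans (ENNReal.ofReal_le_ofReal ?_)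
  have h1 : p.φ ^ ⌊x * p.width⌋₊ ≤ p.φ ^ (x * p.width - 1) := by
    rw [← Real.rpow_natCast]
    exact Real.rpow_le_rpow_of_exponent_ge p.φ_pos p.φ_lt_one.le (by
      linarith [Nat.lt_floor_add_one (x * p.width)])
  have h2 : p.φ ^ (x * p.width - 1) = 1 / p.φ * p.logN ^ (-(p.κ * x)) := by
    rw [← hp.rpow_unit, Real.rpow_sub p.φ_pos, Real.rpow_one]
    unfold Params.width
    rw [show x * (p.κ * p.unit) = p.κ * x * p.unit by ring]
    ring
  rw [h2] at h1
  refine h1.trans ?_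
  rw [sub_eq_add_neg, Real.rpow_add hp.logN_pos, Real.rpow_one]
  exact mul_le_mul_of_nonneg_right hp.inv_φ_le (Real.rpow_nonneg hp.logN_pos.le _)

lemma Params.Large.le_tail (hp : p.Large) {x : ℝ} (hx : 0 ≤ x) (hm : x * p.width < p.hmax) :
    ENNReal.ofReal (p.logN ^ (-(p.κ * x))) ≤ p.tail (x * p.width) := by
  have hw := hp.width_pos
  have he : 0 ≤ x * p.width := by positivity
  rw [p.tail_eq he, if_pos ((Nat.floor_lt he).2 hm)]
  refine ENNReal.ofReal_le_ofReal ?_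
  rw [← hp.rpow_unit, ← Real.rpow_natCast]
  refine Real.rpow_le_rpow_of_exponent_ge p.φ_pos p.φ_lt_one.le ((Nat.floor_le he).trans ?_)
  unfold Params.width
  exact (by ring : x * (p.κ * p.unit) = p.κ * x * p.unit).le

/-- A height above the lower end of a sub-class is rarely above its upper end. -/
lemma Params.Large.tail_add_le (hp : p.Large) {e : ℝ} (he : 0 ≤ e) :
    p.tail (e + 2 * p.width) ≤ ENNReal.ofReal (p.logN ^ (1 - 2 * p.κ)) * p.tail e := by
  have hw := hp.width_pos
  have he' : 0 ≤ e + 2 * p.width := by positivity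
  by_cases hm : ⌊e⌋₊ < p.hmax
  · refine (p.tail_le_pow he').trans ?_
    rw [p.tail_eq he, if_pos hm, ← ENNReal.ofReal_mul (Real.rpow_nonneg hp.logN_pos.le _)]
    refine ENNReal.ofReal_le_ofReal ?_
    have h1 : p.φ ^ ⌊e + 2 * p.width⌋₊ ≤ p.φ ^ (⌊e⌋₊ + 2 * p.width - 1) := by
      rw [← Real.rpow_natCast]
      exact Real.rpow_le_rpow_of_exponent_ge p.φ_pos p.φ_lt_one.le (by
        linarith [Nat.lt_floor_add_one (e + 2 * p.width), Nat.floor_le he])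
    have h2 : p.φ ^ (⌊e⌋₊ + 2 * p.width - 1) =
        1 / p.φ * p.logN ^ (-(2 * p.κ)) * p.φ ^ ⌊e⌋₊ := by
      rw [← hp.rpow_unit, ← Real.rpow_natCast, Real.rpow_sub p.φ_pos, Real.rpow_one,
        Real.rpow_add p.φ_pos]
      unfold Params.width
      rw [show 2 * (p.κ * p.unit) = 2 * p.κ * p.unit by ring]
      ring
    rw [h2] at h1
    refine h1.trans ?_
    rw [sub_eq_add_neg, Real.rpow_add hp.logN_pos, Real.rpow_one]
    gcongr
    · exact pow_nonneg p.φ_pos.le _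
    · exact Real.rpow_nonneg hp.logN_pos.le _
    · exact hp.inv_φ_le
  · rw [p.tail_eq he', if_neg]
    · exact zero_le
    · intro h
      exact hm ((Nat.floor_mono (by linarith)).trans_lt h)

end Tails

/-! ### The expected number of messages of CoFaSel -/

section Sweep

variable {p : Params} {D : Type*} [LinearOrder D]

lemma Params.logPhi_n_le_hmax (p : Params) : p.logPhi p.n ≤ p.hmax := Nat.le_ceil _

lemma Params.Large.n_pos (hp : p.Large) : 0 < (p.n : ℝ) := by
  have h := hp.logN_ge
  unfold Params.logN at h
  rcases Nat.eq_zero_or_pos p.n with h0 | h0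
  · rw [h0] at h; norm_num at h
  · exact_mod_cast h0

lemma Params.Large.logN_le_n (hp : p.Large) : p.logN ≤ p.n := by
  have h1 : (p.n : ℝ) = 2 ^ p.logN :=
    (Real.rpow_logb (by norm_num) (by norm_num) hp.n_pos).symm
  have h2 : p.logN * Real.log 2 + 1 ≤ 2 ^ p.logN := by
    rw [Real.rpow_def_of_pos (by norm_num), mul_comm]
    exact Real.add_one_le_exp _
  have h3 : Real.log p.logN ≤ p.logN * Real.log 2 := by
    have h4 := Real.log_le_sub_one_of_pos (show 0 < p.logN / 4 by linarith [hp.logN_pos])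
    have h5 : Real.log p.logN = Real.log (p.logN / 4) + 2 * Real.log 2 := by
      rw [Real.log_div hp.logN_pos.ne' (by norm_num),
        show (4 : ℝ) = 2 ^ (2 : ℕ) by norm_num, Real.log_pow]
      push_cast; ring
    have h6 := Real.log_two_gt_d9
    have h7 := Real.log_two_lt_d9
    have h8 := hp.logN_ge
    nlinarith
  rw [h1]
  calc p.logN = Real.exp (Real.log p.logN) := (Real.exp_log hp.logN_pos).symm
    _ ≤ Real.exp (p.logN * Real.log 2) := Real.exp_le_exp.2 h3
    _ = _ := by rw [Real.rpow_def_of_pos (by norm_num), mul_comm]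

lemma Params.Large.unit_le (hp : p.Large) : p.unit ≤ p.logPhi p.n :=
  Real.logb_le_logb_of_le p.one_lt_inv_φ hp.logN_pos hp.logN_le_n

lemma Params.Large.one_le_hmax (hp : p.Large) : 1 ≤ p.hmax := by
  have : (1 : ℝ) ≤ p.hmax := hp.one_le_unit.trans (hp.unit_le.trans p.logPhi_n_le_hmax)
  exact_mod_cast this

lemma Params.Large.n_mul_pow_hmax_le (hp : p.Large) : p.n * p.φ ^ p.hmax ≤ 1 := by
  have h1 : (p.n : ℝ) = (1 / p.φ) ^ p.logPhi p.n :=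
    (Real.rpow_logb (by linarith [p.one_lt_inv_φ]) p.one_lt_inv_φ.ne' hp.n_pos).symm
  have h2 : (p.n : ℝ) ≤ (1 / p.φ) ^ p.hmax := by
    rw [h1, ← Real.rpow_natCast]
    exact Real.rpow_le_rpow_of_exponent_le p.one_lt_inv_φ.le p.logPhi_n_le_hmax
  have hφ := p.φ_pos
  calc p.n * p.φ ^ p.hmax ≤ (1 / p.φ) ^ p.hmax * p.φ ^ p.hmax := by gcongr
    _ = 1 := by rw [← mul_pow, one_div, inv_mul_cancel₀ hφ.ne', one_pow]

/-- The first `log_{1/φ} K` terms are at most `1`, and the others decrease geometrically. -/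
lemma Params.sum_min_le (p : Params) {K : ℝ} (hK : 1 ≤ K) (M : ℕ) :
    ∑ k ∈ Finset.range M, min 1 (K * p.φ ^ (k + 1)) ≤ p.logPhi K + 1 + p.φ / (1 - p.φ) := by
  have hφ := p.φ_pos
  have hφ1 := p.φ_lt_one
  set H := ⌈p.logPhi K⌉₊ with hH
  have hlog : 0 ≤ p.logPhi K := Real.logb_nonneg p.one_lt_inv_φ hK
  have hKH : K * p.φ ^ H ≤ 1 := by
    have h1 : K = (1 / p.φ) ^ p.logPhi K :=
      (Real.rpow_logb (by linarith [p.one_lt_inv_φ]) p.one_lt_inv_φ.ne' (by linarith)).symm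
    have h2 : K ≤ (1 / p.φ) ^ H := by
      conv_lhs => rw [h1]
      rw [← Real.rpow_natCast]
      exact Real.rpow_le_rpow_of_exponent_le p.one_lt_inv_φ.le (Nat.le_ceil _)
    calc K * p.φ ^ H ≤ (1 / p.φ) ^ H * p.φ ^ H := by gcongr
      _ = 1 := by rw [← mul_pow, one_div, inv_mul_cancel₀ hφ.ne', one_pow]
  have hgeom : ∑ j ∈ Finset.range M, p.φ ^ j ≤ (1 - p.φ)⁻¹ := by
    rw [← tsum_geometric_of_lt_one hφ.le hφ1]
    exact (summable_geometric_of_lt_one hφ.le hφ1).sum_le_tsum _ fun i _ => pow_nonneg hφ.le i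
  calc ∑ k ∈ Finset.range M, min 1 (K * p.φ ^ (k + 1))
      ≤ ∑ k ∈ Finset.range (H + M), min 1 (K * p.φ ^ (k + 1)) :=
        Finset.sum_le_sum_of_subset_of_nonneg
          (Finset.range_subset_range.2 (by omega)) fun _ _ _ => by positivity
    _ = ∑ k ∈ Finset.range H, min 1 (K * p.φ ^ (k + 1)) +
        ∑ j ∈ Finset.range M, min 1 (K * p.φ ^ (H + j + 1)) := Finset.sum_range_add _ _ _
    _ ≤ ∑ k ∈ Finset.range H, (1 : ℝ) + ∑ j ∈ Finset.range M, p.φ * p.φ ^ j := by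
        refine add_le_add (Finset.sum_le_sum fun _ _ => min_le_left _ _)
          (Finset.sum_le_sum fun j _ => (min_le_right _ _).trans ?_)
        rw [show K * p.φ ^ (H + j + 1) = (K * p.φ ^ H) * (p.φ * p.φ ^ j) by ring]
        exact mul_le_of_le_one_left (by positivity) hKH
    _ ≤ (p.logPhi K + 1) + p.φ * (1 - p.φ)⁻¹ := by
        rw [← Finset.mul_sum]
        refine add_le_add ?_ (by gcongr)
        simpa using (Nat.ceil_lt_add_one hlog).le
    _ = _ := by ring

open scoped Classical in
/-- The expected cost of CoFaSel on at most `K` nodes with new heights. -/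
lemma expect_sweep_le (hp : p.Large) {data : p.Node → D} (hd : Function.Injective data)
    (P : Finset p.Node) (h₀ : p.Node → ℕ) {K : ℝ} (hPK : (P.card : ℝ) ≤ K) (hK : 1 ≤ K) :
    expect (draws P h₀) (fun h => ((sweep data h P p.hmax ⊤).1 : ℝ≥0∞)) ≤
      ENNReal.ofReal (1 / p.φ * (p.logPhi K + 3 * p.unit)) := by
  have hφ := p.φ_pos
  have hφ1 := p.φ_lt_one
  set ρ : ℝ := (1 - p.φ) / p.φ with hρ
  have hρ0 : 0 ≤ ρ := div_nonneg (by linarith) hφ.le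
  obtain ⟨M, hM⟩ : ∃ M, p.hmax = M + 1 := ⟨p.hmax - 1, by have := hp.one_le_hmax; omega⟩
  have hcardK : (P.card : ℝ≥0∞) ≤ ENNReal.ofReal K := by
    rw [← ENNReal.ofReal_natCast]; exact ENNReal.ofReal_le_ofReal hPK
  -- probes with a threshold
  have hA : ∀ k, expect (draws P h₀) (fun h => ind (∃ j ∈ P, ((k + 1 : ℕ) : ℝ) < (h j : ℝ))) ≤
      ENNReal.ofReal (min 1 (K * p.φ ^ (k + 1))) := by
    intro k
    rw [ENNReal.ofReal_min, ENNReal.ofReal_one, ENNReal.ofReal_mul (by linarith)]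
    refine le_min (expect_le_of_forall fun _ _ => ind_le_one _)
      ((expect_draws_exists_lt P _ h₀).trans (mul_le_mul' hcardK ?_))
    have := p.tail_le_pow (e := ((k + 1 : ℕ) : ℝ)) (by positivity)
    rwa [Nat.floor_natCast] at this
  -- responses
  have hB : ∀ k, k + 1 < p.hmax → expect (draws P h₀) (fun h => ((P.filter fun i => h i = k + 1 ∧
      ∀ j ∈ P, k + 1 < h j → data i ≤ data j).card : ℝ≥0∞)) ≤
      ENNReal.ofReal (ρ * min 1 (K * p.φ ^ (k + 1))) := by
    intro k hk
    rw [mul_min_of_nonneg _ _ hρ0, mul_one, ENNReal.ofReal_min]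
    refine le_min ?_ ?_
    · refine (expect_mono fun h _ => (card_filter_eq_sum_ind _ _).le).trans
        (expect_draws_until_first hd (fun x => k + 1 < x) (fun x => x = k + 1) _ ?_ P h₀)
      have h1 := p.tail_eq (e := ((k + 1 : ℕ) : ℝ)) (by positivity)
      rw [Nat.floor_natCast, if_pos hk] at h1
      unfold Params.tail at h1
      simp only [Nat.cast_lt] at h1
      rw [h1, p.expect_eq_eq hk]
    · calc _ ≤ expect (draws P h₀) (fun h => ∑ i ∈ P, ind (h i = k + 1)) := by
            refine expect_mono fun h _ => ?_
            rw [card_filter_eq_sum_ind]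
            exact Finset.sum_le_sum fun i _ => ind_mono And.left
        _ = P.card * (ENNReal.ofReal ρ * ENNReal.ofReal (p.φ ^ (k + 1))) := by
            rw [expect_draws_sum P (fun x => ind (x = k + 1)), p.expect_eq_eq hk]
        _ ≤ ENNReal.ofReal K * (ENNReal.ofReal ρ * ENNReal.ofReal (p.φ ^ (k + 1))) := by gcongr
        _ = _ := by
            rw [← ENNReal.ofReal_mul hρ0, ← ENNReal.ofReal_mul (by linarith)]
            congr 1; ring
  -- responses at the height `hmax = M + 1`, where the cut-off makes the probability larger
  have hC : expect (draws P h₀) (fun h => ((P.filter fun i => h i = M + 1 ∧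
      ∀ j ∈ P, M + 1 < h j → data i ≤ data j).card : ℝ≥0∞)) ≤ ENNReal.ofReal (1 / p.φ) := by
    calc _ ≤ expect (draws P h₀) (fun h => ∑ i ∈ P, ind (h i = M + 1)) := by
          refine expect_mono fun h _ => ?_
          rw [card_filter_eq_sum_ind]
          exact Finset.sum_le_sum fun i _ => ind_mono And.left
      _ ≤ P.card * ENNReal.ofReal (p.φ ^ M) := by
          rw [expect_draws_sum P (fun x => ind (x = M + 1))]
          refine mul_le_mul_right ((p.expect_eq_le_tail M).trans ?_) _
          have := p.tail_le_pow (e := (M : ℝ)) (by positivity)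
          rwa [Nat.floor_natCast] at this
      _ ≤ _ := by
          rw [← ENNReal.ofReal_natCast, ← ENNReal.ofReal_mul (by positivity)]
          refine ENNReal.ofReal_le_ofReal ?_
          have h1 := hp.n_mul_pow_hmax_le
          rw [hM, pow_succ] at h1
          have h2 : (P.card : ℝ) ≤ p.n := by
            have := P.card_le_univ
            rw [Fintype.card_fin] at this
            exact_mod_cast this
          rw [le_div_iff₀ hφ]
          calc P.card * p.φ ^ M * p.φ ≤ p.n * p.φ ^ M * p.φ := by gcongr
            _ ≤ 1 := by linarith
  have hcost : ∀ h ∈ (draws P h₀).support, ((sweep data h P p.hmax ⊤).1 : ℝ≥0∞) ≤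
      ∑ k ∈ Finset.range p.hmax, (ind (∃ j ∈ P, ((k + 1 : ℕ) : ℝ) < (h j : ℝ) ∧ h j ≤ p.hmax) +
        ((P.filter fun i => h i = k + 1 ∧
          ∀ j ∈ P, k + 1 < h j → data i ≤ data j).card : ℝ≥0∞)) := by
    intro h hh
    refine (Nat.cast_le.2 (sweep_cost_le data h P p.hmax ⊤)).trans ?_
    push_cast
    refine Finset.sum_le_sum fun k _ => add_le_add ?_ ?_
    · unfold ind
      simp only [ne_eq, not_true_eq_false, false_or]
      norm_cast
    · refine Nat.cast_le.2 (Finset.card_le_card fun i hi => ?_)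
      rw [Finset.mem_filter] at hi ⊢
      exact ⟨hi.1, hi.2.1, fun j hj hlt => (hi.2.2.2 j hj hlt
        (Params.le_hmax_of_mem_support ((draws_support hh).2 j hj))).le⟩
  refine (expect_mono hcost).trans ?_
  rw [expect_sum, hM, Finset.sum_range_succ]
  simp_rw [expect_add]
  have hlast : expect (draws P h₀) (fun h => ind (∃ j ∈ P, ((M + 1 : ℕ) : ℝ) < (h j : ℝ) ∧
      h j ≤ M + 1)) = 0 := by
    rw [← expect_const (draws P h₀) 0]
    refine expect_congr fun h _ => ind_of_not ?_
    rintro ⟨j, -, h1, h2⟩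
    rw [Nat.cast_lt] at h1
    omega
  rw [hlast, zero_add]
  calc _ ≤ ∑ k ∈ Finset.range M, ENNReal.ofReal (1 / p.φ * min 1 (K * p.φ ^ (k + 1))) +
        ENNReal.ofReal (1 / p.φ) := by
        refine add_le_add (Finset.sum_le_sum fun k hk => ?_) hC
        rw [Finset.mem_range] at hk
        have e : 1 / p.φ * min 1 (K * p.φ ^ (k + 1)) =
            min 1 (K * p.φ ^ (k + 1)) + ρ * min 1 (K * p.φ ^ (k + 1)) := by
          rw [hρ]; field_simp; ring
        rw [e, ENNReal.ofReal_add (by positivity) (by positivity)]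
        refine add_le_add ((expect_mono fun h _ => ind_mono ?_).trans (hA k)) (hB k (by omega))
        rintro ⟨j, hj, h1, -⟩
        exact ⟨j, hj, h1⟩
    _ = ENNReal.ofReal (∑ k ∈ Finset.range M, 1 / p.φ * min 1 (K * p.φ ^ (k + 1)) + 1 / p.φ) := by
        rw [ENNReal.ofReal_add (Finset.sum_nonneg fun _ _ => by positivity) (by positivity),
          ENNReal.ofReal_sum_of_nonneg fun _ _ => by positivity]
    _ ≤ _ := by
        refine ENNReal.ofReal_le_ofReal ?_
        rw [← Finset.mul_sum]
        have h1 := p.sum_min_le hK M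
        have h2 := hp.φ_div_le_unit
        have h3 := hp.one_le_unit
        have h4 : 0 < 1 / p.φ := by positivity
        nlinarith

/-- All sub-classes of alarms and representatives are likely to be met. -/
lemma expect_not_noBadEdge_le (hp : p.Large) {data : p.Node → D} (hd : Function.Injective data)
    (P : Finset p.Node) (h₀ : p.Node → ℕ) :
    expect (draws P h₀) (fun h => ind (¬ NoBadEdge data P h)) ≤
      p.classes * (2 * ENNReal.ofReal (p.logN ^ (1 - 2 * p.κ))) := by
  classical
  have hw := hp.width_pos
  have hbad : ∀ e : ℝ, 0 ≤ e → expect (draws P h₀) (fun h => ind (BadEdge data P h e)) ≤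
      ENNReal.ofReal (p.logN ^ (1 - 2 * p.κ)) := by
    intro e he
    refine le_trans (expect_mono fun h _ => ?_) (expect_draws_until_first hd
      (fun x => e < (x : ℝ)) (fun x => e + 2 * p.width < (x : ℝ)) _ (hp.tail_add_le he) P h₀)
    exact ind_exists_mem_le
  calc _ ≤ expect (draws P h₀) (fun h => ∑ c ∈ Finset.range p.classes,
        (ind (BadEdge data P h ((8 * c + 3) * p.width)) +
          ind (BadEdge data P h ((8 * c + 5) * p.width)))) := by
        refine expect_mono fun h _ => ?_
        calc ind (¬ NoBadEdge data P h) ≤ ind (∃ c ∈ Finset.range p.classes,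
              BadEdge data P h ((8 * c + 3) * p.width) ∨
                BadEdge data P h ((8 * c + 5) * p.width)) := by
              refine ind_mono fun hn => ?_
              unfold NoBadEdge at hn
              push Not at hn
              obtain ⟨c, hc, hn⟩ := hn
              exact ⟨c, Finset.mem_range.2 hc, or_iff_not_imp_left.2 hn⟩
          _ ≤ _ := ind_exists_mem_le.trans (Finset.sum_le_sum fun c _ => ind_or_le _ _)
    _ ≤ ∑ c ∈ Finset.range p.classes, (2 * ENNReal.ofReal (p.logN ^ (1 - 2 * p.κ))) := by
        rw [expect_sum]
        refine Finset.sum_le_sum fun c _ => ?_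
        rw [expect_add, two_mul]
        exact add_le_add (hbad _ (by positivity)) (hbad _ (by positivity))
    _ = _ := by simp

end Sweep

/-! ### Updates -/

section Update

variable {p : Params} {D : Type*}

lemma Params.inSub_unique (hw : 0 < p.width) {c c' τ σ h : ℕ} (hτ : τ < 4) (hσ : σ = 1 ∨ σ = 2)
    (h1 : p.InSub c τ h) (h2 : p.InSub c' σ h) : c = c' := by
  rw [Params.inSub_iff] at h1 h2
  have hτ' : (τ : ℝ) ≤ 3 := by exact_mod_cast Nat.lt_succ_iff.1 hτ
  have hτ0 : (0 : ℝ) ≤ τ := by positivity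
  have hσ1 : (1 : ℝ) ≤ σ := by rcases hσ with rfl | rfl <;> norm_num
  have hσ2 : (σ : ℝ) ≤ 2 := by rcases hσ with rfl | rfl <;> norm_num
  rcases lt_trichotomy c c' with hlt | rfl | hlt
  · have : (c : ℝ) + 1 ≤ c' := by exact_mod_cast hlt
    have := h2.1.trans_le h1.2
    have := lt_of_mul_lt_mul_right this hw.le
    linarith
  · rfl
  · have : (c' : ℝ) + 1 ≤ c := by exact_mod_cast hlt
    have := h1.1.trans_le h2.2
    have := lt_of_mul_lt_mul_right this hw.le
    linarith

variable [LinearOrder D]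

open scoped Classical in
/-- The state after `update i d s`, if the new height of node `i` is `x`. -/
noncomputable def State.updated (s : State p D) (i : p.Node) (d : D) (x : ℕ) : State p D where
  data := Function.update s.data i d
  height := Function.update s.height i x
  ds := (s.ds.erase i).filter fun j =>
    ¬ ∃ ℓ < p.classes, s.Invalidates i d ℓ ∧ ∃ τ < 4, p.InSub ℓ τ (s.height j)
  alarm := fun ℓ => if s.Invalidates i d ℓ then none else s.alarm ℓ
  rep := fun ℓ => if s.Invalidates i d ℓ then none else s.rep ℓ
  touched := insert i s.touched

lemma update_eq (i : p.Node) (d : D) (s : State p D) :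
    update i d s = p.heightLaw.map (s.updated i d) := rfl

variable {s : State p D} {i : p.Node} {d : D} {x : ℕ}

lemma State.mem_updated_ds {j : p.Node} : j ∈ (s.updated i d x).ds ↔ (j ≠ i ∧ j ∈ s.ds) ∧
    ¬ ∃ ℓ < p.classes, s.Invalidates i d ℓ ∧ ∃ τ < 4, p.InSub ℓ τ (s.height j) := by
  classical
  simp only [State.updated, Finset.mem_filter, Finset.mem_erase]

lemma State.mem_updated_sub (hw : 0 < p.width) {j : p.Node} {c σ : ℕ} (hσ : σ = 1 ∨ σ = 2)
    (hj : j ∈ s.sub c σ) (hi : j ≠ i) (hn : ¬ s.Invalidates i d c) :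
    j ∈ (s.updated i d x).sub c σ := by
  rw [State.mem_sub] at hj ⊢
  rw [State.mem_updated_ds]
  refine ⟨⟨⟨hi, hj.1⟩, ?_⟩, ?_⟩
  · rintro ⟨ℓ, -, hinv, τ, hτ, hs⟩
    exact hn (Params.inSub_unique hw hτ hσ hs hj.2 ▸ hinv)
  · change p.InSub c σ (Function.update s.height i x j)
    rw [Function.update_of_ne hi]
    exact hj.2

lemma State.Valid.updated (hw : 0 < p.width) (hs : s.Valid) (i : p.Node) (d : D) (x : ℕ) :
    (s.updated i d x).Valid := by
  refine ⟨fun a ha b hb => ?_, fun r hr j hj => ?_, fun c a ha => ?_, fun c a ha => ?_⟩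
  · rw [State.mem_updated_ds] at ha hb
    simp only [State.updated, Function.update_of_ne ha.1.1, Function.update_of_ne hb.1.1]
    exact hs.left a ha.1.2 b hb.1.2
  · rw [State.mem_updated_ds] at hr
    have hj' : j ≠ i ∧ j ∉ s.touched := by simpa [State.updated] using hj
    simp only [State.updated, Function.update_of_ne hr.1.1, Function.update_of_ne hj'.1]
    exact hs.above r hr.1.2 j hj'.2
  · by_cases hn : s.Invalidates i d c
    · simp [State.updated, hn] at ha
    · have ha' : s.alarm c = some a := by simpa [State.updated, hn] using ha
      refine ⟨(hs.alarm_mem c a ha').1, State.mem_updated_sub hw (Or.inl rfl)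
        (hs.alarm_mem c a ha').2 ?_ hn⟩
      rintro rfl
      exact hn (Or.inl ha')
  · by_cases hn : s.Invalidates i d c
    · simp [State.updated, hn] at ha
    · have ha' : s.rep c = some a := by simpa [State.updated, hn] using ha
      refine ⟨(hs.rep_mem c a ha').1, State.mem_updated_sub hw (Or.inr rfl)
        (hs.rep_mem c a ha').2 ?_ hn⟩
      rintro rfl
      exact hn (Or.inr (Or.inl ha'))

/-- The update of a node of small height leaves the higher classes alone. -/
lemma State.Valid.filled_updated (hw : 0 < p.width) (hs : s.Valid) {L c : ℕ} (hc : L ≤ c)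
    (hf : s.Filled c) (hi : (s.height i : ℝ) ≤ 8 * L * p.width) : (s.updated i d x).Filled c := by
  have hc' : (L : ℝ) ≤ c := by exact_mod_cast hc
  have key : ∀ σ, σ = 1 ∨ σ = 2 → ∀ a ∈ s.sub c σ, s.height i < s.height a := by
    intro σ hσ a ha
    have h1 := (Params.inSub_iff.1 (State.mem_sub.1 ha).2).1
    have hσ0 : (0 : ℝ) ≤ σ := by positivity
    have : (s.height i : ℝ) < s.height a := by
      refine hi.trans_lt (lt_of_le_of_lt ?_ h1)
      nlinarith
    exact_mod_cast this
  have hn : ¬ s.Invalidates i d c := by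
    rintro (h | h | ⟨a, r, ha, -, hai, -⟩)
    · exact lt_irrefl _ (key 1 (Or.inl rfl) i (hs.alarm_mem c i h).2)
    · exact lt_irrefl _ (key 2 (Or.inr rfl) i (hs.rep_mem c i h).2)
    · exact absurd (key 1 (Or.inl rfl) a (hs.alarm_mem c a ha).2) (by omega)
  obtain ⟨⟨a, ha, ha'⟩, ⟨r, hr, hr'⟩⟩ := hf
  refine ⟨⟨a, State.mem_updated_sub hw (Or.inl rfl) ha ?_ hn, ?_⟩,
    ⟨r, State.mem_updated_sub hw (Or.inr rfl) hr ?_ hn, ?_⟩⟩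
  · rintro rfl; exact lt_irrefl _ (key 1 (Or.inl rfl) _ ha)
  · simpa [State.updated, hn] using ha'
  · rintro rfl; exact lt_irrefl _ (key 2 (Or.inr rfl) _ hr)
  · simpa [State.updated, hn] using hr'

end Update

/-! ### The number of classes -/

section Classes

variable {p : Params}

lemma Params.classes_eq (p : Params) : p.classes = ⌊p.logPhi p.n / (8 * p.width)⌋₊ := by
  unfold Params.classes Params.width
  congr 2
  ring

lemma Params.Large.classes_mul_le (hp : p.Large) : 8 * p.classes * p.width ≤ p.logPhi p.n := by
  have hw := hp.width_pos
  have h0 : 0 ≤ p.logPhi p.n := by linarith [hp.unit_le, hp.one_le_unit]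
  have := Nat.floor_le (div_nonneg h0 (by positivity : 0 ≤ 8 * p.width))
  rw [← p.classes_eq, le_div_iff₀ (by positivity)] at this
  linarith

lemma Params.Large.lt_classes_mul (hp : p.Large) :
    p.logPhi p.n < 8 * (p.classes + 1) * p.width := by
  have hw := hp.width_pos
  have := Nat.lt_floor_add_one (p.logPhi p.n / (8 * p.width))
  rw [← p.classes_eq, div_lt_iff₀ (by positivity)] at this
  linarith

lemma Params.Large.logPhi_n_le (hp : p.Large) : p.logPhi p.n ≤ p.logN * p.unit := by
  have h1 : Real.log p.n = p.logN * Real.log 2 := by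
    unfold Params.logN Real.logb
    field_simp
  have h2 := p.log_inv_φ_pos
  unfold Params.unit Params.logPhi Real.logb
  rw [h1, ← mul_div_assoc]
  have h3 : Real.log 2 ≤ Real.log p.logN := by
    linarith [hp.one_le_log_logN, Real.log_two_lt_d9]
  exact div_le_div_of_nonneg_right (mul_le_mul_of_nonneg_left h3 hp.logN_pos.le) h2.le

lemma Params.Large.classes_le (hp : p.Large) : 80 * (p.classes : ℝ) ≤ p.logN := by
  have h1 := hp.classes_mul_le.trans hp.logPhi_n_le
  have hu := hp.one_le_unit
  unfold Params.width at h1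
  have h2 : 8 * (p.classes : ℝ) * p.κ ≤ p.logN := by
    refine le_of_mul_le_mul_right ?_ (by linarith : 0 < p.unit)
    linarith
  have := hp.κ_ge
  have h3 : (0 : ℝ) ≤ p.classes := by positivity
  nlinarith

lemma Params.Large.classes_le_logPhi (hp : p.Large) : 2 * (p.classes : ℝ) ≤ p.logPhi p.n := by
  refine le_trans ?_ hp.classes_mul_le
  have h1 : 10 * 1 ≤ p.width :=
    mul_le_mul hp.κ_ge hp.one_le_unit (by norm_num) (by linarith [hp.κ_ge])
  have h3 : (0 : ℝ) ≤ p.classes := by positivity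
  nlinarith

lemma Params.Large.rpow_logN (hp : p.Large) (x : ℝ) :
    p.logN ^ x = (1 / p.φ) ^ (x * p.unit) := by
  have h1 : (1 / p.φ) ^ p.unit = p.logN :=
    Real.rpow_logb (by have := p.one_lt_inv_φ; linarith) p.one_lt_inv_φ.ne' hp.logN_pos
  rw [mul_comm, Real.rpow_mul (by linarith [p.one_lt_inv_φ]), h1]

lemma Params.Large.logPhi_rpow (hp : p.Large) (x : ℝ) : p.logPhi (p.logN ^ x) = x * p.unit := by
  rw [hp.rpow_logN]
  exact Real.logb_rpow (by linarith [p.one_lt_inv_φ]) p.one_lt_inv_φ.ne'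

lemma Params.Large.rpow_classes_le (hp : p.Large) : p.logN ^ (p.κ * (8 * p.classes)) ≤ p.n := by
  have h1 : (p.n : ℝ) = (1 / p.φ) ^ p.logPhi p.n :=
    (Real.rpow_logb (by linarith [p.one_lt_inv_φ]) p.one_lt_inv_φ.ne' hp.n_pos).symm
  rw [hp.rpow_logN, h1]
  refine Real.rpow_le_rpow_of_exponent_le p.one_lt_inv_φ.le ?_
  have := hp.classes_mul_le
  unfold Params.width at this
  linarith

lemma Params.Large.n_le_rpow (hp : p.Large) : p.n ≤ p.logN ^ (p.κ * (8 * (p.classes + 1))) := by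
  have h1 : (p.n : ℝ) = (1 / p.φ) ^ p.logPhi p.n :=
    (Real.rpow_logb (by linarith [p.one_lt_inv_φ]) p.one_lt_inv_φ.ne' hp.n_pos).symm
  rw [hp.rpow_logN, h1]
  refine Real.rpow_le_rpow_of_exponent_le p.one_lt_inv_φ.le ?_
  have := hp.lt_classes_mul
  unfold Params.width at this
  linarith

lemma Params.Large.lt_hmax (hp : p.Large) {x : ℝ} (hx : x < 8 * p.classes) :
    x * p.width < p.hmax := by
  have hw := hp.width_pos
  exact (mul_lt_mul_of_pos_right hx hw).trans_le
    (hp.classes_mul_le.trans p.logPhi_n_le_hmax)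

lemma one_sub_pow_le_exp {t : ℝ≥0∞} {a y : ℝ} {N : ℕ} (ht : t ≤ 1) (ha0 : 0 ≤ a)
    (ha : ENNReal.ofReal a ≤ t) (hy : y ≤ N * a) :
    (1 - t) ^ N ≤ ENNReal.ofReal (Real.exp (-y)) := by
  have ha1 : a ≤ 1 := by
    by_contra h
    have := (ENNReal.one_lt_ofReal.2 (not_le.1 h)).trans_le (ha.trans ht)
    exact lt_irrefl _ this
  calc (1 - t) ^ N ≤ (1 - ENNReal.ofReal a) ^ N := by gcongr
    _ = ENNReal.ofReal ((1 - a) ^ N) := by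
        rw [← ENNReal.ofReal_one, ← ENNReal.ofReal_sub _ ha0, ENNReal.ofReal_pow (by linarith)]
    _ ≤ _ := by
        refine ENNReal.ofReal_le_ofReal ?_
        calc (1 - a) ^ N ≤ Real.exp (-a) ^ N := by
              exact pow_le_pow_left₀ (by linarith) (Real.one_sub_le_exp_neg a) N
          _ = Real.exp (-(N * a)) := by rw [← Real.exp_nat_mul]; congr 1; ring
          _ ≤ _ := Real.exp_le_exp.2 (by linarith)

lemma exp_neg_le_inv {y : ℝ} (hy : 0 < y) : Real.exp (-y) ≤ y⁻¹ := by
  rw [Real.exp_neg]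
  exact inv_anti₀ hy (by linarith [Real.add_one_le_exp y])

/-- If `N` new heights are drawn, where `N` exceeds the inverse of the tail at a height by a factor
of `(log n)^κ`, then all of them are below this height with small probability. -/
lemma Params.Large.one_sub_tail_pow_le (hp : p.Large) {x : ℝ} {N : ℕ} (hx : 0 ≤ x)
    (hxc : x < 8 * p.classes) (hN : p.logN ^ (p.κ * (x + 1)) ≤ N) :
    (1 - p.tail (x * p.width)) ^ N ≤ ENNReal.ofReal (p.logN ^ (-p.κ)) := by
  have hl := hp.logN_pos
  refine (one_sub_pow_le_exp (y := p.logN ^ p.κ) (p.tail_le_one _) (Real.rpow_nonneg hl.le _)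
    (hp.le_tail hx (hp.lt_hmax hxc)) ?_).trans (ENNReal.ofReal_le_ofReal ?_)
  · calc p.logN ^ p.κ = p.logN ^ (p.κ * (x + 1)) * p.logN ^ (-(p.κ * x)) := by
          rw [← Real.rpow_add hl]; congr 1; ring
      _ ≤ _ := by gcongr
  · rw [Real.rpow_neg hl.le]
    exact exp_neg_le_inv (Real.rpow_pos_of_pos hl _)

/-- The probability that a sub-class is skipped is at most `(log n)^(-κ)`. -/
lemma Params.Large.skip_le (hp : p.Large) :
    p.classes * (2 * ENNReal.ofReal (p.logN ^ (1 - 2 * p.κ))) ≤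
      ENNReal.ofReal (p.logN ^ (-p.κ)) := by
  have hl := hp.logN_pos
  rw [← ENNReal.ofReal_natCast, show (2 : ℝ≥0∞) = ENNReal.ofReal 2 by simp,
    ← ENNReal.ofReal_mul (by norm_num), ← ENNReal.ofReal_mul (by positivity)]
  refine ENNReal.ofReal_le_ofReal ?_
  have h1 := hp.classes_le
  have h2 : p.logN ^ (1 - 2 * p.κ) ≤ p.logN ^ (-p.κ - 1) :=
    Real.rpow_le_rpow_of_exponent_le (by linarith [hp.logN_ge]) (by linarith [hp.κ_ge])
  have h3 : p.logN * p.logN ^ (-p.κ - 1) = p.logN ^ (-p.κ) := by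
    rw [← Real.rpow_one_add' hl.le (by linarith [hp.κ_ge])]; congr 1; ring
  have h4 : 0 ≤ p.logN ^ (1 - 2 * p.κ) := Real.rpow_nonneg hl.le _
  rw [← h3]
  have h5 : (p.classes : ℝ) * 2 ≤ p.logN := by
    have : (0 : ℝ) ≤ p.classes := by positivity
    linarith
  nlinarith

lemma Params.Large.four_mul_rpow_le (hp : p.Large) :
    4 * (p.classes + 1) * p.logN ^ (-p.κ) ≤ 1 := by
  have hl := hp.logN_ge
  have h1 : p.logN ^ (-p.κ) ≤ p.logN ^ (-1 : ℝ) :=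
    Real.rpow_le_rpow_of_exponent_le (by linarith) (by linarith [hp.κ_ge])
  rw [Real.rpow_neg_one] at h1
  have h2 := hp.classes_le
  calc 4 * (p.classes + 1) * p.logN ^ (-p.κ) ≤ p.logN * p.logN⁻¹ := by
        gcongr
        linarith
    _ = 1 := mul_inv_cancel₀ hp.logN_pos.ne'

end Classes

/-! ### Success of one execution of INITIALIZE or REFRESH -/

section Success

variable {p : Params} {D : Type*} [LinearOrder D] {s : State p D}

/-- A run on all nodes fills all classes with high probability. -/
lemma expect_build_univ_fail_le (hp : p.Large) (hd : Function.Injective s.data) :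
    expect (build Finset.univ s) (fun q => ind (¬ q.1.AllFilled)) ≤
      ENNReal.ofReal (2 * p.logN ^ (-p.κ)) := by
  have hl := hp.logN_pos
  have hw := hp.width_pos
  rcases Nat.eq_zero_or_pos p.classes with h0 | hpos
  · rw [← expect_const (build Finset.univ s) (ENNReal.ofReal _)]
    refine expect_mono fun q _ => ?_
    rw [ind_of_not]
    · exact zero_le
    · exact not_not.2 fun c hc => by omega
  have hpos' : (1 : ℝ) ≤ p.classes := by exact_mod_cast hpos
  calc _ ≤ expect (draws Finset.univ s.height) (fun h => ind (¬ NoBadEdge s.data Finset.univ h) +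
        ind (∀ i ∈ Finset.univ, (h i : ℝ) ≤ (8 * p.classes - 3) * p.width)) := by
        refine expect_build_le fun h hh q ho => ?_
        refine le_trans (ind_mono fun hf => ?_) (ind_or_le _ _)
        by_contra hcon
        push Not at hcon
        exact hf (ho.allFilled_of_univ hw hp.one_le_hmax hd hh hcon.1 hcon.2)
    _ ≤ ENNReal.ofReal (p.logN ^ (-p.κ)) + ENNReal.ofReal (p.logN ^ (-p.κ)) := by
        rw [expect_add, expect_draws_forall_le]
        refine add_le_add ((expect_not_noBadEdge_le hp hd _ _).trans hp.skip_le)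
          (hp.one_sub_tail_pow_le (by linarith) (by linarith) ?_)
        rw [Finset.card_univ, Fintype.card_fin]
        refine le_trans ?_ hp.rpow_classes_le
        refine Real.rpow_le_rpow_of_exponent_le (by linarith [hp.logN_ge]) ?_
        have := hp.κ_ge
        nlinarith
    _ = _ := by
        rw [← ENNReal.ofReal_add (Real.rpow_nonneg hl.le _) (Real.rpow_nonneg hl.le _), two_mul]

variable {b : ℕ} {r : p.Node}

/-- A run on the nodes below `r_b` fills all classes with high probability, if there are many of
them. -/
lemma expect_build_below_fail_le (hp : p.Large) (hs : s.Valid) (hd : Function.Injective s.data)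
    (hr : s.rep b = some r) (hu : s.unfilledTop ≤ b) (ht : s.touchedTop ≤ b + 1)
    (hcard : p.logN ^ (p.κ * (8 * b + 4)) ≤ (s.below b).card) :
    expect (build (s.below b) s) (fun q => ind (¬ q.1.AllFilled)) ≤
      ENNReal.ofReal (2 * p.logN ^ (-p.κ)) := by
  have hl := hp.logN_pos
  have hw := hp.width_pos
  have hb : (b : ℝ) + 1 ≤ p.classes := by exact_mod_cast (hs.rep_mem b r hr).1
  calc _ ≤ expect (draws (s.below b) s.height) (fun h => ind (¬ NoBadEdge s.data (s.below b) h) +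
        ind (∀ i ∈ s.below b, (h i : ℝ) ≤ (8 * b + 3) * p.width)) := by
        refine expect_build_le fun h hh q ho => ?_
        refine le_trans (ind_mono fun hf => ?_) (ind_or_le _ _)
        by_contra hcon
        push Not at hcon
        exact hf (ho.allFilled_of_below hw hs hp.one_le_hmax hd hr
          (hs.admissible_below hw hd hr ht) hu hh hcon.1 hcon.2)
    _ ≤ ENNReal.ofReal (p.logN ^ (-p.κ)) + ENNReal.ofReal (p.logN ^ (-p.κ)) := by
        rw [expect_add, expect_draws_forall_le]
        refine add_le_add ((expect_not_noBadEdge_le hp hd _ _).trans hp.skip_le)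
          (hp.one_sub_tail_pow_le (by positivity) (by linarith) ?_)
        convert hcard using 3
        ring
    _ = _ := by
        rw [← ENNReal.ofReal_add (Real.rpow_nonneg hl.le _) (Real.rpow_nonneg hl.le _), two_mul]

/-- A run on the nodes below `r_b` fills all classes or leaves an unfilled class from `b` on, except
with small probability. -/
lemma expect_build_below_stuck_le (hp : p.Large) (hs : s.Valid) (hd : Function.Injective s.data)
    (hr : s.rep b = some r) (hu : s.unfilledTop ≤ b) (ht : s.touchedTop ≤ b + 1) :
    expect (build (s.below b) s) (fun q => ind (¬ q.1.AllFilled ∧ ¬ b < q.1.unfilledTop)) ≤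
      ENNReal.ofReal (p.logN ^ (-p.κ)) := by
  have hw := hp.width_pos
  refine le_trans ?_ ((expect_not_noBadEdge_le hp hd (s.below b) s.height).trans hp.skip_le)
  refine expect_build_le fun h hh q ho => ind_mono fun hf hn => ?_
  by_cases he : ∃ i ∈ s.below b, (8 * b + 3) * p.width < h i
  · exact hf.1 (ho.allFilled_of_below hw hs hp.one_le_hmax hd hr
      (hs.admissible_below hw hd hr ht) hu hh hn he)
  · push Not at he
    exact hf.2 (ho.lt_unfilledTop_of_below hs hp.one_le_hmax hd hr hh he)

lemma expect_build_empty_fail (hp : p.Large) (hs : s.Valid) (hd : Function.Injective s.data)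
    (hf : s.AllFilled) : expect (build ∅ s) (fun q => ind (¬ q.1.AllFilled)) = 0 := by
  refine le_antisymm ?_ zero_le
  rw [← expect_const (draws ∅ s.height) 0]
  exact expect_build_le fun h hh q ho => (ind_of_not (not_not.2
    (ho.allFilled_of_empty hs hp.one_le_hmax hd hh hf))).le

/-- A bound on the expected number of repetitions of REFRESH. -/
noncomputable def State.patience (s : State p D) : ℕ := 2 * (p.classes + 1 - s.unfilledTop)

/-- Each repetition of REFRESH decreases `patience` by one in expectation: it fills all classes or
makes the level of the next repetition grow, except with small probability. -/
lemma expect_refresh_patience (hp : p.Large) (hs : s.Valid) (hd : Function.Injective s.data) :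
    1 + expect (refresh s) (fun q => ind (¬ q.1.AllFilled) * q.1.patience) ≤ s.patience := by
  have hl := hp.logN_pos
  unfold refresh
  rw [expect_map]
  have hg2 : (2 : ℝ≥0∞) ≤ s.patience := by
    have h2 : 2 ≤ s.patience := by
      unfold State.patience; have := s.unfilledTop_le_classes; omega
    exact_mod_cast h2
  have hgmax : ∀ s' : State p D, (s'.patience : ℝ≥0∞) ≤ ((2 * (p.classes + 1) : ℕ) : ℝ≥0∞) := by
    intro s'
    refine Nat.cast_le.2 ?_
    unfold State.patience; omega
  have hsmall : ENNReal.ofReal (2 * p.logN ^ (-p.κ)) * ((2 * (p.classes + 1) : ℕ) : ℝ≥0∞) ≤ 1 := by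
    rw [← ENNReal.ofReal_natCast, ← ENNReal.ofReal_mul (by positivity), ← ENNReal.ofReal_one]
    refine ENNReal.ofReal_le_ofReal ?_
    have := hp.four_mul_rpow_le
    push_cast
    linarith
  rcases s.participants_cases with ⟨hP, hf, -⟩ | ⟨hP, -⟩ | ⟨b, r, hr, hP, hu, ht, -⟩
  · rw [hP]
    have : expect (build ∅ s) (fun q => ind (¬ q.1.AllFilled) * (q.1.patience : ℝ≥0∞)) ≤ 0 := by
      calc _ ≤ expect (build ∅ s) (fun q => ind (¬ q.1.AllFilled) *
            ((2 * (p.classes + 1) : ℕ) : ℝ≥0∞)) :=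
            expect_mono fun q _ => mul_le_mul_right (hgmax q.1) _
        _ = 0 := by rw [expect_mul_const, expect_build_empty_fail hp hs hd hf, zero_mul]
    calc _ ≤ 1 + (0 : ℝ≥0∞) := add_le_add le_rfl this
      _ ≤ 2 := by norm_num
      _ ≤ _ := hg2
  · rw [hP]
    have : expect (build Finset.univ s)
        (fun q => ind (¬ q.1.AllFilled) * (q.1.patience : ℝ≥0∞)) ≤ 1 := by
      calc _ ≤ expect (build Finset.univ s) (fun q => ind (¬ q.1.AllFilled) *
            ((2 * (p.classes + 1) : ℕ) : ℝ≥0∞)) :=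
            expect_mono fun q _ => mul_le_mul_right (hgmax q.1) _
        _ ≤ 1 := by
            rw [expect_mul_const]
            exact (mul_le_mul_left (expect_build_univ_fail_le hp hd) _).trans hsmall
    calc _ ≤ 1 + (1 : ℝ≥0∞) := add_le_add le_rfl this
      _ = 2 := by norm_num
      _ ≤ _ := hg2
  · rw [hP]
    have hb := (hs.rep_mem b r hr).1
    have : expect (build (s.below b) s)
        (fun q => ind (¬ q.1.AllFilled) * (q.1.patience : ℝ≥0∞)) ≤
          1 + ((2 * (p.classes - b) : ℕ) : ℝ≥0∞) := by
      calc _ ≤ expect (build (s.below b) s) (fun q =>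
            ind (¬ q.1.AllFilled ∧ ¬ b < q.1.unfilledTop) * ((2 * (p.classes + 1) : ℕ) : ℝ≥0∞) +
              ((2 * (p.classes - b) : ℕ) : ℝ≥0∞)) := by
            refine expect_mono fun q _ => ?_
            by_cases hb' : b < q.1.unfilledTop
            · calc _ ≤ 1 * (q.1.patience : ℝ≥0∞) := mul_le_mul_left (ind_le_one _) _
                _ ≤ ((2 * (p.classes - b) : ℕ) : ℝ≥0∞) := by
                    rw [one_mul]
                    refine Nat.cast_le.2 ?_
                    unfold State.patience; omega
                _ ≤ _ := le_add_self
            · refine le_trans ?_ le_self_add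
              exact mul_le_mul' (ind_mono fun h => ⟨h, hb'⟩) (hgmax q.1)
        _ ≤ _ := by
            rw [expect_add, expect_mul_const, expect_const]
            refine add_le_add (le_trans (mul_le_mul_left
              ((expect_build_below_stuck_le hp hs hd hr hu ht).trans
                (ENNReal.ofReal_le_ofReal ?_)) _) hsmall) le_rfl
            linarith [Real.rpow_nonneg hl.le (-p.κ)]
    calc _ ≤ 1 + (1 + ((2 * (p.classes - b) : ℕ) : ℝ≥0∞)) := add_le_add le_rfl this
      _ = ((2 + 2 * (p.classes - b) : ℕ) : ℝ≥0∞) := by push_cast; ring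
      _ ≤ _ := by
          refine Nat.cast_le.2 ?_
          unfold State.patience; omega

end Success

/-! ### The cost of one execution of INITIALIZE or REFRESH -/

section Cost

variable {p : Params} {D : Type*} [LinearOrder D] {s : State p D} {P : Finset p.Node}

lemma card_le_n (P : Finset p.Node) : (P.card : ℝ) ≤ p.n := by
  have := P.card_le_univ
  rw [Fintype.card_fin] at this
  exact_mod_cast this

/-- A bound on the expected cost of one execution of INITIALIZE or REFRESH. -/
noncomputable def Params.fullCost (p : Params) : ℝ := 6 * (1 / p.φ * p.logPhi p.n)

lemma Params.Large.fullCost_ge (hp : p.Large) :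
    2 + 1 / p.φ * (p.logPhi p.n + 3 * p.unit) + 2 * p.classes ≤ p.fullCost + 1 := by
  have h1 := hp.unit_le
  have h2 := hp.one_le_unit
  have h3 := hp.classes_le_logPhi
  have h4 := p.one_lt_inv_φ
  unfold Params.fullCost
  have h5 : 1 * p.logPhi p.n ≤ 1 / p.φ * p.logPhi p.n :=
    mul_le_mul_of_nonneg_right h4.le (by linarith)
  have h6 : 1 / p.φ * p.unit ≤ 1 / p.φ * p.logPhi p.n :=
    mul_le_mul_of_nonneg_left h1 (by linarith)
  nlinarith

lemma expect_build_cost_le_fullCost (hp : p.Large) (hd : Function.Injective s.data)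
    (P : Finset p.Node) :
    expect (build P s) (fun q => (q.2 : ℝ≥0∞)) ≤ ENNReal.ofReal p.fullCost := by
  have h2 := hp.one_le_unit
  have h3 : 0 ≤ 1 / p.φ * (p.logPhi p.n + 3 * p.unit) := by
    have := p.one_lt_inv_φ
    have := hp.unit_le
    exact mul_nonneg (by linarith) (by linarith)
  calc _ ≤ expect (draws P s.height) (fun h =>
        1 + ((sweep s.data h P p.hmax ⊤).1 : ℝ≥0∞) + 2 * p.classes) := by
        refine expect_build_le fun h hh q ⟨c, C, hq⟩ => ?_
        rw [hq]
        have := C.cost p.classes fun c h1 h2 => absurd h2 (by omega)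
        dsimp only at this
        exact_mod_cast Nat.add_le_add_left this _
    _ ≤ 1 + ENNReal.ofReal (1 / p.φ * (p.logPhi p.n + 3 * p.unit)) + 2 * p.classes := by
        rw [expect_add, expect_add, expect_const, expect_const]
        gcongr
        exact expect_sweep_le hp hd P _ (card_le_n P) (by linarith [hp.logN_le_n, hp.logN_ge])
    _ = ENNReal.ofReal (1 + 1 / p.φ * (p.logPhi p.n + 3 * p.unit) + 2 * p.classes) := by
        rw [ENNReal.ofReal_add (by linarith) (by positivity), ENNReal.ofReal_add zero_le_one h3,
          ENNReal.ofReal_mul (zero_le_two (α := ℝ)), ENNReal.ofReal_one, ENNReal.ofReal_natCast,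
          ENNReal.ofReal_ofNat]
    _ ≤ _ := ENNReal.ofReal_le_ofReal (by linarith [hp.fullCost_ge])

/-- Classes above the participating nodes and their new heights keep their alarms and
representatives, so that only the lower ones have to be paid for. -/
lemma expect_build_cost_le (hp : p.Large) (hs : s.Valid) (hd : Function.Injective s.data) {L : ℕ}
    {K : ℝ} (hPK : (P.card : ℝ) ≤ K) (hK : 1 ≤ K)
    (hf : ∀ c, L ≤ c → c < p.classes → s.Filled c)
    (ha : ∀ c, L ≤ c → ∀ i, s.alarm c = some i → i ∉ P)
    (hr : ∀ c, L ≤ c → ∀ i, s.rep c = some i → i ∉ P) :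
    expect (build P s) (fun q => (q.2 : ℝ≥0∞)) ≤
      1 + ENNReal.ofReal (1 / p.φ * (p.logPhi K + 3 * p.unit)) + 2 * L +
        2 * p.classes * (P.card * p.tail (8 * L * p.width)) := by
  have hw := hp.width_pos
  calc _ ≤ expect (draws P s.height) (fun h =>
        1 + ((sweep s.data h P p.hmax ⊤).1 : ℝ≥0∞) + 2 * L +
          2 * p.classes * ind (∃ j ∈ P, 8 * L * p.width < (h j : ℝ))) := by
        refine expect_build_le fun h hh q ⟨c, C, hq⟩ => ?_
        rw [hq]
        by_cases he : ∃ j ∈ P, 8 * L * p.width < (h j : ℝ)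
        · have := C.cost p.classes fun c h1 h2 => absurd h2 (by omega)
          dsimp only at this
          rw [ind_of he, mul_one]
          have h4 : 1 + (sweep s.data h P p.hmax ⊤).1 + c ≤
              1 + (sweep s.data h P p.hmax ⊤).1 + 2 * L + 2 * p.classes := by omega
          exact_mod_cast h4
        · have := C.cost L ?_
          · dsimp only at this
            rw [ind_of_not he, mul_zero, add_zero]
            exact_mod_cast Nat.add_le_add_left this _
          intro c hc hcc
          push Not at he
          have hcL : (L : ℝ) ≤ c := by exact_mod_cast hc
          have key : ∀ τ, τ = 1 ∨ τ = 2 → ∀ a ∈ s.sub c τ, a ∉ P →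
              a ∈ (s.prepared P h).sub c τ := by
            intro τ hτ a ha haP
            rw [State.mem_sub] at ha
            have hha := (draws_support hh).1 a haP
            have ha2 := ha.2
            rw [← hha] at ha2
            refine State.mem_sub.2 ⟨mem_prepared_ds_of_old hs hp.one_le_hmax hd hh ha.1 haP
              fun j hj => ?_, ha2⟩
            have h1 := (Params.inSub_iff.1 ha2).1
            have hτ0 : (0 : ℝ) ≤ τ := by positivity
            have : (h j : ℝ) < h a := (he j hj).trans_lt (lt_of_le_of_lt (by nlinarith) h1)
            exact_mod_cast this
          obtain ⟨⟨a, ha1, ha2⟩, ⟨a', ha1', ha2'⟩⟩ := hf c hc hcc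
          have haP := ha c hc a ha2
          have haP' := hr c hc a' ha2'
          refine ⟨⟨a, key 1 (Or.inl rfl) a ha1 haP, ?_⟩, ⟨a', key 2 (Or.inr rfl) a' ha1' haP', ?_⟩⟩
          · simp [State.prepared, ha2, haP]
          · simp [State.prepared, ha2', haP']
    _ ≤ _ := by
        rw [expect_add, expect_add, expect_add, expect_const, expect_const, expect_const_mul]
        gcongr
        · exact expect_sweep_le hp hd P _ hPK hK
        · exact expect_draws_exists_lt P _ _

end Cost

/-! ### The execution as a process -/

section Operations

variable {p : Params} {D : Type*}

lemma State.patience_le (s : State p D) : s.patience ≤ 2 * (p.classes + 1) := by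
  unfold State.patience; omega

lemma next_of_allFilled {o : Op p D} {os : List (Op p D)} {m : ℕ} {q : State p D × ℕ}
    (h : q.1.AllFilled) : Config.next o os m q = ⟨q.1, os, (Config.next o os m q).msgs⟩ := by
  simp [Config.next, h]

lemma next_of_not {o : Op p D} {os : List (Op p D)} {m : ℕ} {q : State p D × ℕ}
    (h : ¬ q.1.AllFilled) : Config.next o os m q = ⟨q.1, o :: os, (Config.next o os m q).msgs⟩ := by
  simp [Config.next, h]

lemma next_msgs_nil {o : Op p D} {m : ℕ} {q : State p D × ℕ} :
    (Config.next o [] m q).msgs = m + q.2 := by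
  simp [Config.next]

lemma next_msgs_of_ne {o : Op p D} {os : List (Op p D)} {m : ℕ} {q : State p D × ℕ} (h : os ≠ []) :
    (Config.next o os m q).msgs = m := by
  simp [Config.next, h]

lemma distinct_cons {e : p.Node → D} {B : List (p.Node × D)} {Bs : List (List (p.Node × D))} :
    Distinct e (B :: Bs) ↔ Function.Injective e ∧ Distinct (dataAfter e B) Bs := by
  constructor
  · intro h
    refine ⟨by simpa [dataAfter] using h 0 (by simp), fun k hk => ?_⟩
    have := h (k + 1) (by simpa using hk)
    simpa [dataAfter, List.foldl_append] using this
  · rintro ⟨h0, h⟩ k hk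
    rcases k with _ | k
    · simpa [dataAfter] using h0
    · have := h k (by simpa using hk)
      simpa [dataAfter, List.foldl_append] using this

lemma Distinct.injective {e : p.Node → D} {Bs : List (List (p.Node × D))} (h : Distinct e Bs) :
    Function.Injective e := by
  simpa [dataAfter] using h 0 (by simp)

end Operations

section Execution

variable {p : Params} {D : Type*} [LinearOrder D]

/-- The law of the configuration `k` steps after the configuration `c`. -/
noncomputable def run : ℕ → Config p D → PMF (Config p D)
  | 0, c => PMF.pure c
  | k + 1, c => c.step.bind (run k)

lemma run_succ' (k : ℕ) (c : Config p D) : run (k + 1) c = (run k c).bind Config.step := by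
  induction k generalizing c with
  | zero => simp [run]
  | succ k ih =>
    calc run (k + 2) c = c.step.bind fun c' => (run k c').bind Config.step := by
          rw [run]; congr 1; funext c'; exact ih c'
      _ = _ := (PMF.bind_bind _ _ _).symm

lemma law_eq_run (d : p.Node → D) (ops : List (Op p D)) (k : ℕ) :
    law d ops k = run k (start d ops) := by
  induction k with
  | zero => rfl
  | succ k ih => rw [law, ih, run_succ']

/-- The expected number of messages counted `k` steps after the configuration `c`. -/
noncomputable def msgsAfter (k : ℕ) (c : Config p D) : ℝ≥0∞ :=
  expect (run k c) fun c => (c.msgs : ℝ≥0∞)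

lemma expectedMessages_eq (d : p.Node → D) (ops : List (Op p D)) :
    expectedMessages d ops = ⨆ k, msgsAfter k (start d ops) := by
  unfold expectedMessages msgsAfter expect
  simp_rw [law_eq_run]

lemma msgsAfter_zero (c : Config p D) : msgsAfter 0 c = c.msgs := expect_pure _ _

lemma msgsAfter_succ (k : ℕ) (c : Config p D) :
    msgsAfter (k + 1) c = expect c.step (msgsAfter k) := expect_bind _ _ _

/-- The expected number of steps among the first `k` ones after the configuration `c` that are
executed before all operations are finished. -/
noncomputable def timeAfter (k : ℕ) (c : Config p D) : ℝ≥0∞ :=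
  ∑ j ∈ Finset.range k, expect (run j c) fun c => ind (c.todo ≠ [])

lemma timeAfter_zero (c : Config p D) : timeAfter 0 c = 0 := by simp [timeAfter]

lemma timeAfter_succ (k : ℕ) (c : Config p D) :
    timeAfter (k + 1) c = ind (c.todo ≠ []) + expect c.step (timeAfter k) := by
  unfold timeAfter
  rw [Finset.sum_range_succ', add_comm]
  congr 1
  · exact expect_pure _ _
  · rw [expect_sum]
    exact Finset.sum_congr rfl fun j _ => expect_bind _ _ _

lemma terminates_of_timeAfter_le {d : p.Node → D} {ops : List (Op p D)} {R : ℝ≥0∞} (hR : R ≠ ⊤)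
    (h : ∀ k, timeAfter k (start d ops) ≤ R) : Terminates d ops := by
  unfold Terminates
  have hle : ∀ k, (law d ops k).toOuterMeasure {c | c.todo = []} =
      1 - expect (run k (start d ops)) fun c => ind (c.todo ≠ []) := by
    intro k
    have h1 : (law d ops k).toOuterMeasure {c | c.todo = []} =
        expect (run k (start d ops)) fun c => ind (c.todo = []) := by
      rw [PMF.toOuterMeasure_apply, law_eq_run]
      refine tsum_congr fun c => ?_
      by_cases hc : c.todo = [] <;> simp [Set.indicator, ind, hc]
    have h2 : expect (run k (start d ops)) (fun c => ind (c.todo = [])) +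
        expect (run k (start d ops)) (fun c => ind (c.todo ≠ [])) = 1 := by
      rw [← expect_add, ← expect_const (run k (start d ops)) 1]
      exact expect_congr fun c _ => ind_add_not _
    rw [h1, ← h2, ENNReal.add_sub_cancel_right]
    exact ne_top_of_le_ne_top ENNReal.one_ne_top (expect_le_of_forall fun _ _ => ind_le_one _)
  refine le_antisymm (iSup_le fun k => by rw [hle]; exact tsub_le_self) ?_
  have hsum : ∑' k, expect (run k (start d ops)) (fun c => ind (c.todo ≠ [])) ≠ ⊤ := by
    refine ne_top_of_le_ne_top hR ?_
    rw [ENNReal.tsum_eq_iSup_nat]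
    exact iSup_le h
  have hlim := ENNReal.tendsto_atTop_zero_of_tsum_ne_top hsum
  have hlim' := ENNReal.Tendsto.sub (f := Filter.atTop) (tendsto_const_nhds (x := (1 : ℝ≥0∞))) hlim
    (Or.inl ENNReal.one_ne_top)
  rw [tsub_zero] at hlim'
  refine le_of_tendsto hlim' (Filter.Eventually.of_forall fun k => ?_)
  rw [← hle k]
  exact le_iSup (fun k => (law d ops k).toOuterMeasure {c | c.todo = []}) k

lemma expect_step_update (f : Config p D → ℝ≥0∞) (s : State p D) (i : p.Node) (d : D)
    (os : List (Op p D)) (m : ℕ) :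
    expect (Config.step ⟨s, Op.update i d :: os, m⟩) f =
      expect (update i d s) fun s' => f ⟨s', os, m⟩ := expect_map _ _ _

lemma expect_step_setup (f : Config p D → ℝ≥0∞) (s : State p D) (os : List (Op p D)) (m : ℕ) :
    expect (Config.step ⟨s, Op.setup :: os, m⟩) f =
      expect (build Finset.univ s) fun q => f (Config.next Op.setup os m q) := expect_map _ _ _

lemma expect_step_refresh (f : Config p D → ℝ≥0∞) (s : State p D) (os : List (Op p D)) (m : ℕ) :
    expect (Config.step ⟨s, Op.refresh :: os, m⟩) f =
      expect (refresh s) fun q => f (Config.next Op.refresh os m q) := expect_map _ _ _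

/-- The law of the state after a batch of updates. -/
noncomputable def updates : List (p.Node × D) → State p D → PMF (State p D)
  | [], s => PMF.pure s
  | u :: B, s => (update u.1 u.2 s).bind (updates B)

/-- The state `s` is valid and its data items are `e`. -/
def Ready (e : p.Node → D) (s : State p D) : Prop := s.Valid ∧ s.data = e

/-- The state `s` is valid, its data items are `e`, and no node was updated. -/
def Fresh (e : p.Node → D) (s : State p D) : Prop := Ready e s ∧ s.touched = ∅

lemma fresh_of_mem_build {e : p.Node → D} {s : State p D} {P : Finset p.Node} (hp : p.Large)
    (hs : Ready e s) (he : Function.Injective e) (hP : s.Admissible P) {q : State p D × ℕ}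
    (hq : q ∈ (build P s).support) : Fresh e q.1 := by
  obtain ⟨h, hh, ho⟩ := outcome_of_mem_support hq
  have hd : Function.Injective s.data := hs.2 ▸ he
  exact ⟨⟨ho.valid hp.width_pos hs.1 hp.one_le_hmax hd hP hh, ho.data_eq.trans hs.2⟩, ho.touched_eq⟩

lemma fresh_of_mem_refresh {e : p.Node → D} {s : State p D} (hp : p.Large) (hs : Ready e s)
    (he : Function.Injective e) {q : State p D × ℕ} (hq : q ∈ (refresh s).support) :
    Fresh e q.1 := by
  unfold refresh at hq
  rw [PMF.mem_support_map_iff] at hq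
  obtain ⟨q', hq', rfl⟩ := hq
  have h : Fresh e q'.1 := fresh_of_mem_build hp hs he
    (hs.1.admissible_participants hp.width_pos (hs.2 ▸ he)) hq'
  exact h

lemma ready_of_mem_update {e : p.Node → D} {s s' : State p D} (hp : p.Large) (hs : Ready e s)
    {i : p.Node} {d : D} (h : s' ∈ (update i d s).support) :
    Ready (Function.update e i d) s' := by
  rw [update_eq, PMF.mem_support_map_iff] at h
  obtain ⟨x, -, rfl⟩ := h
  exact ⟨hs.1.updated hp.width_pos i d x, by rw [← hs.2]; rfl⟩

lemma ready_of_mem_updates {e : p.Node → D} {s s' : State p D} {B : List (p.Node × D)}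
    (hp : p.Large) (hs : Ready e s) (h : s' ∈ (updates B s).support) :
    Ready (dataAfter e B) s' := by
  induction B generalizing s e with
  | nil =>
    rw [updates, PMF.support_pure, Set.mem_singleton_iff] at h
    exact h ▸ hs
  | cons u B ih =>
    rw [updates, PMF.mem_support_bind_iff] at h
    obtain ⟨s₁, h1, h2⟩ := h
    exact ih (ready_of_mem_update hp hs h1) h2

lemma touched_of_mem_updates {s s' : State p D} {B : List (p.Node × D)}
    (h : s' ∈ (updates B s).support) : s'.touched = s.touched ∪ (B.map Prod.fst).toFinset := by
  induction B generalizing s with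
  | nil =>
    rw [updates, PMF.support_pure, Set.mem_singleton_iff] at h
    simp [h]
  | cons u B ih =>
    rw [updates, PMF.mem_support_bind_iff] at h
    obtain ⟨s₁, h1, h2⟩ := h
    rw [update_eq, PMF.mem_support_map_iff] at h1
    obtain ⟨x, -, rfl⟩ := h1
    rw [ih h2]
    ext j
    simp [State.updated]

lemma expect_updates_height (B : List (p.Node × D)) (s : State p D)
    (F : (p.Node → ℕ) → ℝ≥0∞) :
    expect (updates B s) (fun s' => F s'.height) =
      expect (draws (B.map Prod.fst).toFinset s.height) F := by
  rw [← redraw_eq_draws]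
  induction B generalizing s with
  | nil => simp [updates, redraw, expect_pure]
  | cons u B ih =>
    rw [updates, expect_bind, List.map_cons, redraw, expect_bind, update_eq, expect_map]
    refine expect_congr fun x _ => ?_
    rw [ih]
    rfl

end Execution

/-! ### Termination -/

section Termination

variable {p : Params} {D : Type*} [LinearOrder D]

lemma timeAfter_nil (k : ℕ) (s : State p D) (m : ℕ) : timeAfter k ⟨s, [], m⟩ = 0 := by
  induction k with
  | zero => exact timeAfter_zero _
  | succ k ih =>
    rw [timeAfter_succ, ind_of_not (by simp), zero_add]
    exact (expect_pure _ _).trans ih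

lemma timeAfter_refresh_le (hp : p.Large) {e : p.Node → D} (he : Function.Injective e)
    {os : List (Op p D)} {F : ℝ≥0∞} (hF : ∀ k q m, Fresh e q → timeAfter k ⟨q, os, m⟩ ≤ F) (k : ℕ)
    {s : State p D} (hs : Ready e s) (m : ℕ) :
    timeAfter k ⟨s, Op.refresh :: os, m⟩ ≤ s.patience + F := by
  induction k generalizing s m with
  | zero => rw [timeAfter_zero]; exact zero_le
  | succ k ih =>
    rw [timeAfter_succ, ind_of (by simp), expect_step_refresh]
    calc _ ≤ 1 + expect (refresh s) (fun q => ind (¬ q.1.AllFilled) * q.1.patience + F) := by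
          gcongr
          refine expect_mono fun q hq => ?_
          have hf := fresh_of_mem_refresh hp hs he hq
          by_cases hA : q.1.AllFilled
          · rw [next_of_allFilled hA]
            exact (hF _ _ _ hf).trans le_add_self
          · rw [next_of_not hA, ind_of hA, one_mul]
            exact ih hf.1 _
      _ ≤ _ := by
          rw [expect_add, expect_const, ← add_assoc]
          gcongr
          exact expect_refresh_patience hp hs.1 (hs.2 ▸ he)

lemma Params.Large.fail_le_half (hp : p.Large) :
    ENNReal.ofReal (2 * p.logN ^ (-p.κ)) * 2 ≤ 1 := by
  rw [← ENNReal.ofReal_ofNat, ← ENNReal.ofReal_mul', ← ENNReal.ofReal_one]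
  · refine ENNReal.ofReal_le_ofReal ?_
    have h1 := hp.four_mul_rpow_le
    have h2 : (0 : ℝ) ≤ p.classes := by positivity
    have h3 := Real.rpow_nonneg hp.logN_pos.le (-p.κ)
    nlinarith
  · norm_num

lemma timeAfter_setup_le (hp : p.Large) {e : p.Node → D} (he : Function.Injective e)
    {os : List (Op p D)} {F : ℝ≥0∞} (hF : ∀ k q m, Fresh e q → timeAfter k ⟨q, os, m⟩ ≤ F) (k : ℕ)
    {s : State p D} (hs : Ready e s) (m : ℕ) :
    timeAfter k ⟨s, Op.setup :: os, m⟩ ≤ 2 + F := by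
  induction k generalizing s m with
  | zero => rw [timeAfter_zero]; exact zero_le
  | succ k ih =>
    rw [timeAfter_succ, ind_of (by simp), expect_step_setup]
    calc _ ≤ 1 + expect (build Finset.univ s) (fun q => ind (¬ q.1.AllFilled) * 2 + F) := by
          gcongr
          refine expect_mono fun q hq => ?_
          have hf := fresh_of_mem_build hp hs he (admissible_univ s) hq
          by_cases hA : q.1.AllFilled
          · rw [next_of_allFilled hA]
            exact (hF _ _ _ hf).trans le_add_self
          · rw [next_of_not hA, ind_of hA, one_mul]
            exact ih hf.1 _
      _ ≤ 1 + (1 + F) := by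
          rw [expect_add, expect_const, expect_mul_const]
          gcongr
          exact (mul_le_mul_left (expect_build_univ_fail_le hp (hs.2 ▸ he)) _).trans
            hp.fail_le_half
      _ = _ := by rw [← add_assoc]; norm_num

lemma timeAfter_updates_le (hp : p.Large) {os : List (Op p D)} {F : ℝ≥0∞}
    (B : List (p.Node × D)) {e : p.Node → D}
    (hF : ∀ k s m, Ready (dataAfter e B) s → timeAfter k ⟨s, os, m⟩ ≤ F) (k : ℕ)
    {s : State p D} (hs : Ready e s) (m : ℕ) :
    timeAfter k ⟨s, B.map (fun u => Op.update u.1 u.2) ++ os, m⟩ ≤ B.length + F := by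
  induction B generalizing e s k with
  | nil => simpa using hF k s m hs
  | cons u B ih =>
    rcases k with _ | k
    · rw [timeAfter_zero]; exact zero_le
    · rw [timeAfter_succ, List.map_cons, List.cons_append, ind_of (by simp), expect_step_update]
      calc _ ≤ 1 + ((B.length : ℝ≥0∞) + F) := by
            gcongr
            exact expect_le_of_forall fun s' hs' =>
              ih (e := Function.update e u.1 u.2) hF k (ready_of_mem_update hp hs hs')
        _ = _ := by rw [List.length_cons]; push_cast; ring

lemma timeAfter_rounds_le (hp : p.Large) (Bs : List (List (p.Node × D))) {e : p.Node → D}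
    (he : Distinct e Bs) (k : ℕ) {s : State p D} (hs : Ready e s) (m : ℕ) :
    timeAfter k ⟨s, Bs.flatMap cycle, m⟩ ≤
      ((Bs.map fun B => B.length + 2 * (p.classes + 1)).sum : ℕ) := by
  induction Bs generalizing e s k m with
  | nil => simp [timeAfter_nil]
  | cons B Bs ih =>
    rw [distinct_cons] at he
    rw [List.flatMap_cons, cycle, List.append_assoc, List.map_cons, List.sum_cons, Nat.cast_add,
      Nat.cast_add, add_assoc]
    refine timeAfter_updates_le hp B (fun k s m hs => ?_) k hs m
    refine (timeAfter_refresh_le hp he.2.injective (fun k q m hq => ih he.2 k hq.1 m) k hs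
      m).trans ?_
    gcongr
    exact s.patience_le

lemma ready_start (d : p.Node → D) (ops : List (Op p D)) : Ready d (start d ops).state := by
  refine ⟨⟨?_, ?_, ?_, ?_⟩, rfl⟩ <;> simp [start]

lemma terminates_setup (hp : p.Large) {d : p.Node → D} (hd : Function.Injective d) :
    Terminates d [Op.setup] :=
  terminates_of_timeAfter_le (R := 2 + 0) (by simp) fun k =>
    timeAfter_setup_le hp hd (fun k q m _ => (timeAfter_nil k q m).le) k
      (ready_start d [Op.setup]) 0

lemma terminates_history (hp : p.Large) {d : p.Node → D} {Bs : List (List (p.Node × D))}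
    (hd : Distinct d Bs) : Terminates d (history Bs) :=
  terminates_of_timeAfter_le
    (R := 2 + (((Bs.map fun B => B.length + 2 * (p.classes + 1)).sum : ℕ) : ℝ≥0∞)) (by finiteness)
    fun k => timeAfter_setup_le hp hd.injective
      (fun k _ m hq => timeAfter_rounds_le hp Bs hd k hq.1 m) k (ready_start d (history Bs)) 0

end Termination

/-! ### Bounds on the expected number of messages from an arbitrary state -/

section Messages

variable {p : Params} {D : Type*} [LinearOrder D]

lemma msgsAfter_nil (k : ℕ) (s : State p D) (m : ℕ) : msgsAfter k ⟨s, [], m⟩ = m := by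
  induction k with
  | zero => exact msgsAfter_zero _
  | succ k ih =>
    rw [msgsAfter_succ]
    exact (expect_pure _ _).trans ih

lemma msgsAfter_setup_le (hp : p.Large) {e : p.Node → D} (he : Function.Injective e) (k : ℕ)
    {s : State p D} (hs : Ready e s) (m : ℕ) :
    msgsAfter k ⟨s, [Op.setup], m⟩ ≤ m + 2 * ENNReal.ofReal p.fullCost := by
  induction k generalizing s m with
  | zero => rw [msgsAfter_zero]; exact le_self_add
  | succ k ih =>
    rw [msgsAfter_succ, expect_step_setup]
    calc _ ≤ expect (build Finset.univ s) (fun q => (m : ℝ≥0∞) + q.2 +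
          ind (¬ q.1.AllFilled) * (2 * ENNReal.ofReal p.fullCost)) := by
          refine expect_mono fun q hq => ?_
          have hf := fresh_of_mem_build hp hs he (admissible_univ s) hq
          by_cases hA : q.1.AllFilled
          · rw [next_of_allFilled hA, msgsAfter_nil, next_msgs_nil, Nat.cast_add]
            exact le_self_add
          · rw [next_of_not hA, ind_of hA, one_mul, next_msgs_nil, ← Nat.cast_add]
            exact ih hf.1 _
      _ ≤ m + ENNReal.ofReal p.fullCost + 1 * ENNReal.ofReal p.fullCost := by
          rw [expect_add, expect_add, expect_const, expect_mul_const, ← mul_assoc]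
          gcongr
          · exact expect_build_cost_le_fullCost hp (hs.2 ▸ he) _
          · exact (mul_le_mul_left (expect_build_univ_fail_le hp (hs.2 ▸ he)) _).trans
              hp.fail_le_half
      _ = _ := by ring

/-- The number of updated nodes of maximal height. -/
noncomputable def State.maxTouched (s : State p D) : ℕ :=
  open scoped Classical in
  (s.touched.filter fun i => ∀ j ∈ s.touched, s.height j ≤ s.height i).card

/-- A bound on the expected cost of the later repetitions of REFRESH, if the first one fails. -/
noncomputable def Params.failCost (p : Params) : ℝ≥0∞ :=
  (1 + ENNReal.ofReal p.fullCost) * (2 * (p.classes + 1) : ℕ)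

lemma expect_refresh_cost (s : State p D) : expect (refresh s) (fun q => (q.2 : ℝ≥0∞)) =
    s.maxTouched + 1 + expect (build s.participants s) fun q => (q.2 : ℝ≥0∞) := by
  unfold refresh
  rw [expect_map, ← expect_const (build s.participants s) ((s.maxTouched : ℝ≥0∞) + 1),
    ← expect_add]
  refine expect_congr fun q _ => ?_
  unfold State.maxTouched
  push_cast
  ring

lemma State.maxTouched_of_fresh {e : p.Node → D} {s : State p D} (hs : Fresh e s) :
    s.maxTouched = 0 := by
  unfold State.maxTouched
  rw [hs.2]
  simp

lemma msgsAfter_refresh_le (hp : p.Large) {e : p.Node → D} (he : Function.Injective e) (k : ℕ)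
    {s : State p D} (hs : Ready e s) (m : ℕ) :
    msgsAfter k ⟨s, [Op.refresh], m⟩ ≤
      m + s.maxTouched + (1 + ENNReal.ofReal p.fullCost) * s.patience := by
  induction k generalizing s m with
  | zero => rw [msgsAfter_zero, add_assoc]; exact le_self_add
  | succ k ih =>
    rw [msgsAfter_succ, expect_step_refresh]
    calc _ ≤ expect (refresh s) (fun q => (m : ℝ≥0∞) + q.2 + (1 + ENNReal.ofReal p.fullCost) *
          (ind (¬ q.1.AllFilled) * q.1.patience)) := by
          refine expect_mono fun q hq => ?_
          have hf := fresh_of_mem_refresh hp hs he hq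
          by_cases hA : q.1.AllFilled
          · rw [next_of_allFilled hA, msgsAfter_nil, next_msgs_nil, Nat.cast_add]
            exact le_self_add
          · rw [next_of_not hA, ind_of hA, one_mul, next_msgs_nil, ← Nat.cast_add]
            refine (ih hf.1 _).trans_eq ?_
            rw [State.maxTouched_of_fresh hf, Nat.cast_zero, add_zero]
      _ ≤ m + (s.maxTouched + 1 + ENNReal.ofReal p.fullCost) + (1 + ENNReal.ofReal p.fullCost) *
            expect (refresh s) (fun q => ind (¬ q.1.AllFilled) * q.1.patience) := by
          rw [expect_add, expect_add, expect_const, expect_const_mul, expect_refresh_cost]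
          gcongr
          exact expect_build_cost_le_fullCost hp (hs.2 ▸ he) _
      _ = m + s.maxTouched + (1 + ENNReal.ofReal p.fullCost) *
            (1 + expect (refresh s) (fun q => ind (¬ q.1.AllFilled) * q.1.patience)) := by ring
      _ ≤ _ := by
          gcongr
          exact expect_refresh_patience hp hs.1 (hs.2 ▸ he)

/-- The cost of the last REFRESH, split into the first repetition and the others. -/
lemma msgsAfter_refresh_le_first (hp : p.Large) {e : p.Node → D} (he : Function.Injective e)
    (k : ℕ) {s : State p D} (hs : Ready e s) :
    msgsAfter k ⟨s, [Op.refresh], 0⟩ ≤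
      s.maxTouched + 1 + expect (build s.participants s) (fun q => (q.2 : ℝ≥0∞)) +
        expect (refresh s) (fun q => ind (¬ q.1.AllFilled)) * p.failCost := by
  rcases k with _ | k
  · rw [msgsAfter_zero]; simp
  · rw [msgsAfter_succ, expect_step_refresh, ← expect_refresh_cost, ← expect_mul_const,
      ← expect_add]
    refine expect_mono fun q hq => ?_
    have hf := fresh_of_mem_refresh hp hs he hq
    by_cases hA : q.1.AllFilled
    · rw [next_of_allFilled hA, msgsAfter_nil, next_msgs_nil, zero_add]
      exact le_self_add
    · rw [next_of_not hA, ind_of hA, one_mul, next_msgs_nil, zero_add]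
      refine (msgsAfter_refresh_le hp he k hf.1 _).trans ?_
      rw [State.maxTouched_of_fresh hf, Nat.cast_zero, add_zero]
      unfold Params.failCost
      gcongr
      exact State.patience_le _

open scoped Classical in
/-- The nodes of maximal height are the first ones to respond in CoFaSel. -/
lemma card_max_le_sweep (data : p.Node → D) (height : p.Node → ℕ) (P : Finset p.Node) (H : ℕ)
    (h1 : ∀ i ∈ P, 1 ≤ height i) (hH : ∀ i ∈ P, height i ≤ H) :
    (P.filter fun i => ∀ j ∈ P, height j ≤ height i).card ≤ (sweep data height P H ⊤).1 := by
  induction H with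
  | zero =>
    rw [Finset.card_eq_zero.2]
    · exact Nat.zero_le _
    · refine Finset.filter_eq_empty_iff.2 fun i hi => ?_
      have := h1 i hi
      have := hH i hi
      omega
  | succ H ih =>
    by_cases he : ∃ i ∈ P, height i = H + 1
    · obtain ⟨i, hi, hie⟩ := he
      simp only [sweep]
      refine le_trans (Finset.card_le_card fun j hj => ?_) ((Nat.le_add_left _ _).trans
        (Nat.le_add_right _ _))
      rw [Finset.mem_filter] at hj ⊢
      have h3 := hj.2 i hi
      have h4 := hH j hj.1
      exact ⟨hj.1, by omega, WithTop.coe_lt_top _⟩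
    · push Not at he
      refine (ih fun i hi => ?_).trans ?_
      · have := hH i hi
        have := he i hi
        omega
      · have hR : (P.filter fun i => height i = H + 1 ∧ (data i : WithTop D) < ⊤) = ∅ :=
          Finset.filter_eq_empty_iff.2 fun i hi h => he i hi h.1
        simp only [sweep, hR]
        simp

/-- The expected number of updated nodes of maximal height. -/
lemma expect_updates_maxTouched_le (hp : p.Large) {e : p.Node → D} {B : List (p.Node × D)}
    (he : Function.Injective (dataAfter e B)) {s : State p D} (hs : Fresh e s) {K : ℝ}
    (hK : (((B.map Prod.fst).toFinset.card : ℕ) : ℝ) ≤ K) (hK1 : 1 ≤ K) :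
    expect (updates B s) (fun s' => (s'.maxTouched : ℝ≥0∞)) ≤
      ENNReal.ofReal (1 / p.φ * (p.logPhi K + 3 * p.unit)) := by
  classical
  set T := (B.map Prod.fst).toFinset with hT
  calc _ = expect (updates B s) (fun s' =>
        ((T.filter fun i => ∀ j ∈ T, s'.height j ≤ s'.height i).card : ℝ≥0∞)) := by
        refine expect_congr fun s' hs' => ?_
        unfold State.maxTouched
        rw [touched_of_mem_updates hs', hs.2, Finset.empty_union]
    _ = expect (draws T s.height) (fun h =>
        ((T.filter fun i => ∀ j ∈ T, h j ≤ h i).card : ℝ≥0∞)) :=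
        expect_updates_height B s fun h => ((T.filter fun i => ∀ j ∈ T, h j ≤ h i).card : ℝ≥0∞)
    _ ≤ expect (draws T s.height) (fun h =>
        ((sweep (dataAfter e B) h T p.hmax ⊤).1 : ℝ≥0∞)) := by
        refine expect_mono fun h hh => Nat.cast_le.2 ?_
        have h2 := (draws_support hh).2
        refine le_trans (le_of_eq ?_) (card_max_le_sweep (dataAfter e B) h T p.hmax
          (fun i hi => Params.pos_of_mem_support hp.one_le_hmax (h2 i hi))
          (fun i hi => Params.le_hmax_of_mem_support (h2 i hi)))
        congr!
    _ ≤ _ := expect_sweep_le hp he T _ hK hK1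

end Messages

/-! ### Histories in which each operation runs once -/

section TameLaws

variable {p : Params} {D : Type*} [LinearOrder D]

/-- A law of the state at which the heights are about as small and as large as they are after new
draws for all nodes, although the nodes that drew new heights depended on older heights. There were
at most `r` executions of INITIALIZE or REFRESH, which enter as a factor for the choice of the last
draw of a single node, and as a factor `(n + 2) ^ r` for the choices of the participants. -/
structure Tame (ν : PMF (State p D)) (e : p.Node → D) (r : ℕ) : Prop where
  ready : ∀ s ∈ ν.support, Ready e s
  tail : ∀ i, ∀ x : ℝ, 0 ≤ x → expect ν (fun s => ind (x < (s.height i : ℝ))) ≤ r * p.tail x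
  low : ∀ (A : Finset p.Node) (x : ℝ), 0 ≤ x →
    expect ν (fun s => ∏ i ∈ A, ind ((s.height i : ℝ) ≤ x)) ≤
      ((p.n + 2 : ℕ) : ℝ≥0∞) ^ r * (1 - p.tail x) ^ A.card

lemma expect_build_height_le (P : Finset p.Node) (s : State p D) (F : (p.Node → ℕ) → ℝ≥0∞) :
    expect (build P s) (fun q => F q.1.height) ≤ expect (draws P s.height) F :=
  expect_build_le fun h _ q ho => by rw [ho.height_eq]

lemma expect_draws_low (P A : Finset p.Node) (x : ℝ) (h : p.Node → ℕ) :
    expect (draws P h) (fun h' => ∏ i ∈ A, ind ((h' i : ℝ) ≤ x)) =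
      (∏ i ∈ A \ P, ind ((h i : ℝ) ≤ x)) * (1 - p.tail x) ^ (A ∩ P).card := by
  have := expect_draws_prod P A (fun y => ind ((y : ℝ) ≤ x)) h
  rwa [p.expect_not_lt] at this

lemma tame_setup (hp : p.Large) {e : p.Node → D} (he : Function.Injective e) {s : State p D}
    (hs : Ready e s) : Tame ((build Finset.univ s).map Prod.fst) e 1 := by
  refine ⟨fun s' hs' => ?_, fun i x hx => ?_, fun A x hx => ?_⟩
  · rw [PMF.mem_support_map_iff] at hs'
    obtain ⟨q, hq, rfl⟩ := hs'
    exact (fresh_of_mem_build hp hs he (admissible_univ s) hq).1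
  · rw [expect_map]
    refine (expect_build_height_le _ s fun h => ind (x < (h i : ℝ))).trans ?_
    rw [expect_draws_of_mem (Finset.mem_univ i) (fun y => ind (x < (y : ℝ)))]
    simp [Params.tail]
  · rw [expect_map]
    refine (expect_build_height_le _ s fun h => ∏ i ∈ A, ind ((h i : ℝ) ≤ x)).trans ?_
    rw [expect_draws_low]
    simp only [Finset.inter_univ, pow_one]
    have e1 : A \ Finset.univ = ∅ := by simp
    rw [e1, Finset.prod_empty]
    gcongr
    exact_mod_cast (by omega : 1 ≤ p.n + 2)

lemma Tame.update (hp : p.Large) {ν : PMF (State p D)} {e : p.Node → D} {r : ℕ} (hν : Tame ν e r)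
    (hr : 1 ≤ r) (i : p.Node) (d : D) :
    Tame (ν.bind (update i d)) (Function.update e i d) r := by
  refine ⟨fun s' hs' => ?_, fun j x hx => ?_, fun A x hx => ?_⟩
  · rw [PMF.mem_support_bind_iff] at hs'
    obtain ⟨s, hs, hs'⟩ := hs'
    exact ready_of_mem_update hp (hν.ready s hs) hs'
  · rw [expect_bind]
    simp_rw [update_eq, expect_map]
    by_cases hj : j = i
    · subst hj
      have : ∀ s : State p D, expect p.heightLaw (fun y =>
          ind (x < ((s.updated j d y).height j : ℝ))) = p.tail x := by
        intro s; simp [State.updated, Params.tail]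
      simp_rw [this, expect_const]
      exact le_mul_of_one_le_left zero_le (by exact_mod_cast hr)
    · have : ∀ s : State p D, expect p.heightLaw (fun y =>
          ind (x < ((s.updated i d y).height j : ℝ))) = ind (x < (s.height j : ℝ)) := by
        intro s; simp [State.updated, hj, expect_const]
      simp_rw [this]
      exact hν.tail j x hx
  · rw [expect_bind]
    simp_rw [update_eq, expect_map]
    by_cases hi : i ∈ A
    · have : ∀ s : State p D, expect p.heightLaw (fun y =>
          ∏ j ∈ A, ind (((s.updated i d y).height j : ℝ) ≤ x)) =
            (1 - p.tail x) * ∏ j ∈ A.erase i, ind ((s.height j : ℝ) ≤ x) := by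
        intro s
        rw [← p.expect_not_lt, ← expect_mul_const]
        refine expect_congr fun y _ => ?_
        rw [← Finset.mul_prod_erase A _ hi]
        congr 1
        · simp [State.updated]
        · refine Finset.prod_congr rfl fun j hj => ?_
          simp [State.updated, Finset.ne_of_mem_erase hj]
      simp_rw [this, expect_const_mul]
      calc _ ≤ (1 - p.tail x) * (((p.n + 2 : ℕ) : ℝ≥0∞) ^ r *
            (1 - p.tail x) ^ (A.erase i).card) := mul_le_mul_right (hν.low _ x hx) _
        _ = _ := by
            rw [← Finset.card_erase_add_one hi, pow_succ]; ring
    · have : ∀ s : State p D, expect p.heightLaw (fun y =>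
          ∏ j ∈ A, ind (((s.updated i d y).height j : ℝ) ≤ x)) =
            ∏ j ∈ A, ind ((s.height j : ℝ) ≤ x) := by
        intro s
        rw [← expect_const p.heightLaw (∏ j ∈ A, ind ((s.height j : ℝ) ≤ x))]
        refine expect_congr fun y _ => Finset.prod_congr rfl fun j hj => ?_
        have : j ≠ i := fun h => hi (h ▸ hj)
        simp [State.updated, this]
      simp_rw [this]
      exact hν.low A x hx

lemma Tame.updates (hp : p.Large) {ν : PMF (State p D)} {e : p.Node → D} {r : ℕ} (hν : Tame ν e r)
    (hr : 1 ≤ r) (B : List (p.Node × D)) : Tame (ν.bind (updates B)) (dataAfter e B) r := by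
  induction B generalizing ν e with
  | nil =>
    have : ν.bind (SeleMon.updates []) = ν := by
      simp only [SeleMon.updates]; exact PMF.bind_pure ν
    rw [this]; exact hν
  | cons u B ih =>
    have := ih (hν.update hp hr u.1 u.2)
    rwa [PMF.bind_bind] at this

open scoped Classical in
/-- The sets on which REFRESH may call INITIALIZE, if the data items are `e`. -/
noncomputable def candidates (e : p.Node → D) : Finset (Finset p.Node) :=
  insert ∅ (insert Finset.univ (Finset.univ.image fun r => Finset.univ.filter fun i => e i < e r))

lemma card_candidates_le (e : p.Node → D) : (candidates e).card ≤ p.n + 2 := by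
  classical
  unfold candidates
  refine (Finset.card_insert_le _ _).trans (Nat.succ_le_succ ((Finset.card_insert_le _ _).trans
    (Nat.succ_le_succ (Finset.card_image_le.trans ?_))))
  simp

lemma Ready.participants_mem {e : p.Node → D} {s : State p D} (hs : Ready e s) :
    s.participants ∈ candidates e := by
  classical
  unfold candidates
  rcases s.participants_cases with ⟨hP, -⟩ | ⟨hP, -⟩ | ⟨b, r, hr, hP, -⟩
  · rw [hP]; simp
  · rw [hP]; simp
  · rw [hP, State.below_eq hr, hs.2]
    refine Finset.mem_insert_of_mem (Finset.mem_insert_of_mem (Finset.mem_image.2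
      ⟨r, Finset.mem_univ r, ?_⟩))
    congr!

/-- One execution of REFRESH. The participants depend on the heights; summing over all sets that are
possible for the given data items turns them into fixed ones. -/
lemma Tame.refresh (hp : p.Large) {ν : PMF (State p D)} {e : p.Node → D} {r : ℕ} (hν : Tame ν e r)
    (he : Function.Injective e) :
    Tame (ν.bind fun s => (refresh s).map Prod.fst) e (r + 1) := by
  refine ⟨fun s' hs' => ?_, fun i x hx => ?_, fun A x hx => ?_⟩
  · rw [PMF.mem_support_bind_iff] at hs'
    obtain ⟨s, hs, hs'⟩ := hs'
    rw [PMF.mem_support_map_iff] at hs'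
    obtain ⟨q, hq, rfl⟩ := hs'
    exact (fresh_of_mem_refresh hp (hν.ready s hs) he hq).1
  · rw [expect_bind]
    simp_rw [expect_map, SeleMon.refresh, expect_map]
    calc _ ≤ expect ν (fun s => ind (x < (s.height i : ℝ)) + p.tail x) := by
          refine expect_mono fun s _ => ?_
          refine (expect_build_height_le _ s fun h => ind (x < (h i : ℝ))).trans ?_
          by_cases hi : i ∈ s.participants
          · rw [expect_draws_of_mem hi (fun y => ind (x < (y : ℝ)))]
            exact le_add_self
          · rw [expect_draws_of_notMem hi (fun y => ind (x < (y : ℝ)))]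
            exact le_self_add
      _ ≤ r * p.tail x + p.tail x := by
          rw [expect_add, expect_const]
          gcongr
          exact hν.tail i x hx
      _ = _ := by push_cast; ring
  · rw [expect_bind]
    simp_rw [expect_map, SeleMon.refresh, expect_map]
    calc _ ≤ expect ν (fun s => ∑ P ∈ candidates e,
          (∏ i ∈ A \ P, ind ((s.height i : ℝ) ≤ x)) * (1 - p.tail x) ^ (A ∩ P).card) := by
          refine expect_mono fun s hs => ?_
          refine (expect_build_height_le _ s fun h => ∏ i ∈ A, ind ((h i : ℝ) ≤ x)).trans ?_
          rw [expect_draws_low]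
          exact Finset.single_le_sum (f := fun P => (∏ i ∈ A \ P, ind ((s.height i : ℝ) ≤ x)) *
            (1 - p.tail x) ^ (A ∩ P).card) (fun _ _ => zero_le) (hν.ready s hs).participants_mem
      _ ≤ ∑ P ∈ candidates e, ((p.n + 2 : ℕ) : ℝ≥0∞) ^ r * (1 - p.tail x) ^ A.card := by
          rw [expect_sum]
          refine Finset.sum_le_sum fun P _ => ?_
          rw [expect_mul_const]
          calc _ ≤ ((p.n + 2 : ℕ) : ℝ≥0∞) ^ r * (1 - p.tail x) ^ (A \ P).card *
                (1 - p.tail x) ^ (A ∩ P).card := mul_le_mul_left (hν.low _ x hx) _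
            _ = _ := by
                rw [mul_assoc, ← pow_add, add_comm (A \ P).card, Finset.card_inter_add_card_sdiff]
      _ ≤ _ := by
          rw [Finset.sum_const, nsmul_eq_mul, pow_succ', mul_assoc]
          gcongr
          exact card_candidates_le e

/-- There are initial segments of each size. -/
lemma exists_initial {e : p.Node → D} (he : Function.Injective e) (N : ℕ) :
    ∃ A : Finset p.Node, A.card ≤ N ∧ (A.card = N ∨ A = Finset.univ) ∧
      ∀ i ∈ A, ∀ j ∉ A, e i < e j := by
  induction N with
  | zero => exact ⟨∅, by simp⟩
  | succ N ih =>
    obtain ⟨A, h1, h2, h3⟩ := ih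
    by_cases hA : A = Finset.univ
    · exact ⟨A, by omega, Or.inr hA, h3⟩
    · have hne : (Finset.univ \ A).Nonempty := by
        rw [Finset.sdiff_nonempty]
        exact fun h => hA (Finset.univ_subset_iff.1 h)
      obtain ⟨a, ha, hmin⟩ := Finset.exists_min_image _ e hne
      have haA : a ∉ A := by simpa using ha
      have hcard := Finset.card_insert_of_notMem haA
      have hN := h2.resolve_right hA
      refine ⟨insert a A, by omega, Or.inl (by omega), fun i hi j hj => ?_⟩
      rw [Finset.mem_insert, not_or] at hj
      rcases Finset.mem_insert.1 hi with rfl | hi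
      · refine lt_of_le_of_ne (hmin j (by simpa using hj.2)) fun h => hj.1 (he h).symm
      · exact h3 i hi j hj.2

/-- The probability that an execution of REFRESH does not fill all classes. -/
noncomputable def Params.failProb (p : Params) : ℝ := 3 * p.logN ^ (3 - p.κ)

lemma Params.Large.rpow_le_failProb (hp : p.Large) : 2 * p.logN ^ (-p.κ) ≤ p.failProb := by
  have h1 : p.logN ^ (-p.κ) ≤ p.logN ^ (3 - p.κ) :=
    Real.rpow_le_rpow_of_exponent_le (by linarith [hp.logN_ge]) (by linarith)
  have h2 := Real.rpow_nonneg hp.logN_pos.le (3 - p.κ)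
  unfold Params.failProb
  linarith

/-- REFRESH fails with small probability: a representative `r_b` with few smaller data items would
be a node of great height among the nodes with the smallest data items. -/
lemma Tame.expect_fail_le (hp : p.Large) {ν : PMF (State p D)} {e : p.Node → D} {r : ℕ}
    (hν : Tame ν e r) (he : Function.Injective e) (hr : (r : ℝ) ≤ p.logN) :
    expect ν (fun s => expect (SeleMon.refresh s) fun q => ind (¬ q.1.AllFilled)) ≤
      ENNReal.ofReal p.failProb := by
  have hl := hp.logN_pos
  have hl1 : 1 ≤ p.logN := by linarith [hp.logN_ge]
  have hw := hp.width_pos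
  have hκ := hp.κ_ge
  choose Low hLow1 hLow2 hLow3 using fun b : ℕ =>
    exists_initial he ⌈p.logN ^ (p.κ * (8 * b + 4))⌉₊
  calc _ ≤ expect ν (fun s => ENNReal.ofReal (2 * p.logN ^ (-p.κ)) +
        ∑ b ∈ Finset.range p.classes, ∑ i ∈ Low b,
          ind ((8 * b + 5) * p.width < (s.height i : ℝ))) := by
        refine expect_mono fun s hs => ?_
        have hrdy := hν.ready s hs
        have hd : Function.Injective s.data := hrdy.2 ▸ he
        unfold SeleMon.refresh
        rw [expect_map]
        rcases s.participants_cases with ⟨hP, hf, -⟩ | ⟨hP, -⟩ | ⟨b, r, hr, hP, hu, ht, -⟩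
        · rw [hP, expect_build_empty_fail hp hrdy.1 hd hf]; exact zero_le
        · rw [hP]
          exact (expect_build_univ_fail_le hp hd).trans le_self_add
        · rw [hP]
          by_cases hcard : p.logN ^ (p.κ * (8 * b + 4)) ≤ (s.below b).card
          · exact (expect_build_below_fail_le hp hrdy.1 hd hr hu ht hcard).trans le_self_add
          · have hrm := hrdy.1.rep_mem b r hr
            have hlt : (s.below b).card < ⌈p.logN ^ (p.κ * (8 * b + 4))⌉₊ := by
              rw [Nat.lt_ceil]; exact not_le.1 hcard
            have hrLow : r ∈ Low b := by
              by_contra hrn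
              have hsub : Low b ⊆ s.below b := by
                intro i hi
                rw [State.mem_below hr, hrdy.2]
                exact hLow3 b i hi r hrn
              rcases hLow2 b with h | h
              · have := Finset.card_le_card hsub
                omega
              · rw [h] at hrn; simp at hrn
            have hrh : (8 * b + 5) * p.width < (s.height r : ℝ) := by
              have := (Params.inSub_iff.1 (State.mem_sub.1 hrm.2).2).1
              push_cast at this
              linarith
            calc _ ≤ (1 : ℝ≥0∞) := expect_le_of_forall fun _ _ => ind_le_one _
              _ = ind ((8 * b + 5) * p.width < (s.height r : ℝ)) := (ind_of hrh).symm
              _ ≤ ∑ i ∈ Low b, ind ((8 * b + 5) * p.width < (s.height i : ℝ)) :=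
                  Finset.single_le_sum
                    (f := fun i => ind ((8 * b + 5) * p.width < (s.height i : ℝ)))
                    (fun _ _ => zero_le) hrLow
              _ ≤ ∑ b ∈ Finset.range p.classes, ∑ i ∈ Low b,
                    ind ((8 * b + 5) * p.width < (s.height i : ℝ)) :=
                  Finset.single_le_sum (f := fun b : ℕ => ∑ i ∈ Low b,
                    ind ((8 * b + 5) * p.width < (s.height i : ℝ)))
                    (fun _ _ => zero_le) (Finset.mem_range.2 hrm.1)
              _ ≤ _ := le_add_self
    _ ≤ ENNReal.ofReal (2 * p.logN ^ (-p.κ)) + ∑ b ∈ Finset.range p.classes,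
          ENNReal.ofReal (2 * p.logN ^ (2 - p.κ)) := by
        rw [expect_add, expect_const, expect_sum]
        refine add_le_add le_rfl (Finset.sum_le_sum fun b _ => ?_)
        rw [expect_sum]
        calc _ ≤ ∑ i ∈ Low b, (r : ℝ≥0∞) * p.tail ((8 * b + 5) * p.width) :=
              Finset.sum_le_sum fun i _ => hν.tail i _ (by positivity)
          _ ≤ (⌈p.logN ^ (p.κ * (8 * b + 4))⌉₊ : ℝ≥0∞) * ((r : ℝ≥0∞) *
                ENNReal.ofReal (p.logN ^ (1 - p.κ * (8 * b + 5)))) := by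
              rw [Finset.sum_const, nsmul_eq_mul]
              gcongr
              · exact hLow1 b
              · exact hp.tail_le (by positivity)
          _ ≤ _ := by
              rw [← ENNReal.ofReal_natCast, ← ENNReal.ofReal_natCast,
                ← ENNReal.ofReal_mul (by positivity), ← ENNReal.ofReal_mul (by positivity)]
              refine ENNReal.ofReal_le_ofReal ?_
              have h1 : (1 : ℝ) ≤ p.logN ^ (p.κ * (8 * b + 4)) :=
                Real.one_le_rpow hl1 (by positivity)
              have h2 : (⌈p.logN ^ (p.κ * (8 * b + 4))⌉₊ : ℝ) ≤
                  2 * p.logN ^ (p.κ * (8 * b + 4)) := by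
                have := (Nat.ceil_lt_add_one (show 0 ≤ p.logN ^ (p.κ * (8 * b + 4)) by
                  positivity)).le
                linarith
              calc _ ≤ 2 * p.logN ^ (p.κ * (8 * b + 4)) *
                    (p.logN ^ (1 : ℝ) * p.logN ^ (1 - p.κ * (8 * b + 5))) := by
                    rw [Real.rpow_one]
                    gcongr
                _ = 2 * p.logN ^ (2 - p.κ) := by
                    rw [← Real.rpow_add hl, mul_assoc, ← Real.rpow_add hl]
                    congr 2; ring
    _ ≤ _ := by
        rw [Finset.sum_const, Finset.card_range, nsmul_eq_mul, ← ENNReal.ofReal_natCast,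
          ← ENNReal.ofReal_mul (by positivity), ← ENNReal.ofReal_add (by positivity)
            (by positivity)]
        refine ENNReal.ofReal_le_ofReal ?_
        have h1 : p.logN ^ (-p.κ) ≤ p.logN ^ (3 - p.κ) :=
          Real.rpow_le_rpow_of_exponent_le hl1 (by linarith)
        have h2 : p.logN * p.logN ^ (2 - p.κ) = p.logN ^ (3 - p.κ) := by
          rw [← Real.rpow_one_add' hl.le (by linarith)]; congr 1; ring
        have h3 := hp.classes_le
        have h4 : (p.classes : ℝ) * 2 ≤ p.logN := by
          have : (0 : ℝ) ≤ p.classes := by positivity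
          linarith
        have h5 := Real.rpow_nonneg hl.le (2 - p.κ)
        unfold Params.failProb
        nlinarith

end TameLaws

/-! ### The level of a REFRESH and the number of its participants -/

section LevelBound

variable {p : Params} {D : Type*}

/-- All classes from `L` on are filled, and the updated nodes have smaller heights. -/
def State.Calm (s : State p D) (L : ℕ) : Prop :=
  (∀ c, L ≤ c → c < p.classes → s.Filled c) ∧
    ∀ i ∈ s.touched, (s.height i : ℝ) ≤ 8 * L * p.width

variable {s : State p D} {L : ℕ}

lemma State.Calm.touchedTop_le (hw : 0 < p.width) (hL : 1 ≤ L) (hc : s.Calm L) :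
    s.touchedTop ≤ L := by
  refine Finset.sup_le fun i hi => ?_
  obtain ⟨L', rfl⟩ : ∃ L', L = L' + 1 := ⟨L - 1, by omega⟩
  have := hc.2 i hi
  push_cast at this
  have := (Params.levelOf_le_iff hw).2 this
  omega

variable [LinearOrder D]

/-- Classes from `L` on survive a batch of updates, if neither the old nor the new heights of the
updated nodes exceed the heights of the classes below `L`. -/
lemma expect_updates_not_calm_le (hp : p.Large) (L : ℕ) (B : List (p.Node × D)) {s : State p D}
    (hs : s.Valid) :
    expect (updates B s) (fun s' => ind (¬ s'.Calm L)) ≤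
      ind ((∃ u ∈ B, 8 * L * p.width < (s.height u.1 : ℝ)) ∨ ¬ s.Calm L) +
        B.length * p.tail (8 * L * p.width) := by
  induction B generalizing s with
  | nil =>
    rw [updates, expect_pure]
    simp
  | cons u B ih =>
    rw [updates, expect_bind, update_eq, expect_map]
    calc _ ≤ expect p.heightLaw (fun x =>
          ind ((∃ v ∈ u :: B, 8 * L * p.width < (s.height v.1 : ℝ)) ∨ ¬ s.Calm L) +
            ind (8 * L * p.width < (x : ℝ)) + B.length * p.tail (8 * L * p.width)) := by
          refine expect_mono fun x _ => (ih (hs.updated hp.width_pos u.1 u.2 x)).trans ?_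
          gcongr
          refine le_trans (ind_mono fun h => ?_) (ind_or_le _ _)
          by_contra hcon
          push Not at hcon
          obtain ⟨⟨h1, h2⟩, h3⟩ := hcon
          have hnew : ∀ i, (s.height i : ℝ) ≤ 8 * L * p.width →
              ((s.updated u.1 u.2 x).height i : ℝ) ≤ 8 * L * p.width := by
            intro i hi
            by_cases hiu : i = u.1
            · subst hiu; simpa [State.updated] using h3
            · simpa [State.updated, hiu] using hi
          rcases h with ⟨v, hv, hlt⟩ | hc
          · exact absurd (hnew v.1 (h1 v (List.mem_cons_of_mem _ hv))) (not_le.2 hlt)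
          · refine hc ⟨fun c hc hcc => hs.filled_updated hp.width_pos hc (h2.1 c hc hcc)
              (h1 u List.mem_cons_self), fun i hi => hnew i ?_⟩
            have hi' : i = u.1 ∨ i ∈ s.touched := by simpa [State.updated] using hi
            rcases hi' with rfl | hi'
            · exact h1 u List.mem_cons_self
            · exact h2.2 i hi'
      _ = _ := by
          rw [expect_add, expect_add, expect_const, expect_const, List.length_cons]
          unfold Params.tail
          push_cast
          ring

lemma State.Valid.height_le_of_lt (hw : 0 < p.width) (hs : s.Valid) {b c τ : ℕ} {r i : p.Node}
    (hr : s.rep b = some r) (hbc : b < c) (hi : i ∈ s.sub c τ) : s.height r ≤ s.height i := by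
  have h1 := (Params.inSub_iff.1 (State.mem_sub.1 (hs.rep_mem b r hr).2).2).2
  have h2 := (Params.inSub_iff.1 (State.mem_sub.1 hi).2).1
  have hbc' : (b : ℝ) + 1 ≤ c := by exact_mod_cast hbc
  have hτ0 : (0 : ℝ) ≤ τ := by positivity
  have : (s.height r : ℝ) ≤ s.height i := by
    refine h1.trans (le_trans ?_ h2.le)
    push_cast
    nlinarith
  exact_mod_cast this

/-- Alarms and representatives of higher classes do not take part in a REFRESH. -/
lemma State.Calm.not_mem_participants (hw : 0 < p.width) (hL : 1 ≤ L) (hs : s.Valid)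
    (hc : s.Calm L) {c τ : ℕ} (hLc : L < c) (hcc : c < p.classes) {i : p.Node}
    (hi : i ∈ s.sub c τ) : i ∉ s.participants := by
  have h1 := hc.touchedTop_le hw hL
  have h2 := State.unfilledTop_le hc.1
  rcases s.participants_cases with ⟨hP, -⟩ | ⟨hP, hcl⟩ | ⟨b, r, hr, hP, -, -, hb⟩
  · rw [hP]; simp
  · exact absurd hcl (by omega)
  · rw [hP]
    exact hs.not_mem_below hr (State.mem_sub.1 hi).1 (hs.height_le_of_lt hw hr (by omega) hi)

/-- If a REFRESH of level at most `L` has more than `(log n)^(8κ(L+2))` participants, then as many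
nodes with the smallest data items precede the representative `r_L`, so none of their heights is in
a class above `L`. This is unlikely, even with the factor `(n + 2) ^ r`. -/
lemma Tame.expect_many_participants_le (hp : p.Large) {ν : PMF (State p D)} {e : p.Node → D}
    {r : ℕ} (hν : Tame ν e r) (he : Function.Injective e) (hr : (r : ℝ) ≤ p.logN) (hL : 1 ≤ L)
    {N : ℕ} (hN : p.logN ^ (p.κ * (8 * L + 16)) ≤ N) :
    expect ν (fun s => ind (s.Calm L ∧ N < s.participants.card)) ≤
      ENNReal.ofReal (p.logN)⁻¹ := by
  have hl := hp.logN_pos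
  have hl1 : 1 ≤ p.logN := by linarith [hp.logN_ge]
  have hw := hp.width_pos
  have hκ := hp.κ_ge
  by_cases hLc : p.classes ≤ L + 1
  · rw [← expect_const ν (ENNReal.ofReal _)]
    refine expect_mono fun s _ => ?_
    rw [ind_of_not]
    · exact zero_le
    · rintro ⟨-, h⟩
      have h1 : (N : ℝ) < s.participants.card := by exact_mod_cast h
      have h2 := h1.trans_le (card_le_n s.participants)
      have h3 : p.logN ^ (p.κ * (8 * (p.classes + 1))) ≤ p.logN ^ (p.κ * (8 * L + 16)) := by
        refine Real.rpow_le_rpow_of_exponent_le hl1 ?_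
        have : (p.classes : ℝ) ≤ L + 1 := by exact_mod_cast hLc
        nlinarith
      have := hp.n_le_rpow
      linarith
  rw [not_le] at hLc
  have hLc' : (L : ℝ) + 2 ≤ p.classes := by exact_mod_cast hLc
  obtain ⟨A, hA1, hA2, hA3⟩ := exists_initial he N
  rcases lt_or_ge p.n N with hnN | hnN
  · rw [← expect_const ν (ENNReal.ofReal _)]
    refine expect_mono fun s _ => ?_
    rw [ind_of_not]
    · exact zero_le
    · rintro ⟨-, h⟩
      have h2 := card_le_n s.participants
      have : s.participants.card ≤ p.n := by exact_mod_cast h2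
      omega
  have hAcard : N ≤ A.card := by
    rcases hA2 with h | h
    · exact h.ge
    · rw [h, Finset.card_univ, Fintype.card_fin]; exact hnN
  calc _ ≤ expect ν (fun s => ∏ i ∈ A, ind ((s.height i : ℝ) ≤ (8 * L + 8) * p.width)) := by
        refine expect_mono fun s hs => ?_
        by_cases h : s.Calm L ∧ N < s.participants.card
        · rw [Finset.prod_eq_one]
          · exact ind_le_one _
          obtain ⟨hc, hcard⟩ := h
          obtain ⟨hv, hdata⟩ := hν.ready s hs
          have h1 := hc.touchedTop_le hw hL
          have h2 := State.unfilledTop_le hc.1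
          obtain ⟨-, r', -, hr'⟩ := hc.1 L le_rfl (by omega)
          have hr'm := hv.rep_mem L r' hr'
          have hsub : s.participants ⊆ s.below L := by
            rcases s.participants_cases with ⟨hP, -⟩ | ⟨hP, hcl⟩ | ⟨b, r, hr, hP, -, -, hb⟩
            · rw [hP]; simp
            · exact absurd hcl (by omega)
            · rw [hP]
              rcases (show b ≤ L by omega).eq_or_lt with rfl | hlt
              · exact subset_rfl
              · intro j hj
                rw [State.mem_below hr] at hj
                rw [State.mem_below hr']
                exact hj.trans_le (hv.left r (State.mem_sub.1 (hv.rep_mem b r hr).2).1 r'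
                  (State.mem_sub.1 hr'm.2).1 (hv.height_le_of_lt hw hr hlt hr'm.2))
          intro i hi
          have hib : i ∈ s.below L := by
            by_contra hib
            have hbA : s.below L ⊆ A := by
              intro j hj
              by_contra hjA
              have hij := hA3 i hi j hjA
              rw [State.mem_below hr'] at hj hib
              rw [hdata] at hj hib
              exact hib (hij.trans hj)
            have h3 := Finset.card_le_card hsub
            have h4 : (s.below L).card < A.card := Finset.card_lt_card
              ⟨hbA, fun hsubA => hib (hsubA hi)⟩
            omega
          refine ind_of ?_
          have hlev : p.levelOf (s.height i) ≤ L := by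
            by_cases hit : i ∈ s.touched
            · have := State.level_lt_touchedTop hit
              omega
            · have := hv.above r' (State.mem_sub.1 hr'm.2).1 i hit ((State.mem_below hr').1 hib)
              rwa [Params.levelOf_of_inSub hw le_rfl (State.mem_sub.1 hr'm.2).2] at this
          have := (Params.levelOf_le_iff hw).1 hlev
          linarith
        · rw [ind_of_not h]; exact zero_le
    _ ≤ ((p.n + 2 : ℕ) : ℝ≥0∞) ^ r * (1 - p.tail ((8 * L + 8) * p.width)) ^ A.card :=
        hν.low A _ (by positivity)
    _ ≤ ((p.n + 2 : ℕ) : ℝ≥0∞) ^ r *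
          ENNReal.ofReal (Real.exp (-(p.logN ^ (p.κ * 8)))) := by
        gcongr
        refine one_sub_pow_le_exp (p.tail_le_one _) (Real.rpow_nonneg hl.le _)
          (hp.le_tail (by positivity) (hp.lt_hmax (by linarith))) ?_
        calc p.logN ^ (p.κ * 8) =
              p.logN ^ (p.κ * (8 * L + 16)) * p.logN ^ (-(p.κ * (8 * L + 8))) := by
              rw [← Real.rpow_add hl]; congr 1; ring
          _ ≤ _ := by
              gcongr
              exact hN.trans (by exact_mod_cast hAcard)
    _ ≤ _ := by
        rw [← ENNReal.ofReal_natCast, ← ENNReal.ofReal_pow (by positivity),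
          ← ENNReal.ofReal_mul (by positivity)]
        refine ENNReal.ofReal_le_ofReal ?_
        have hn16 : (16 : ℝ) ≤ p.n := hp.logN_ge.trans hp.logN_le_n
        have h1 : Real.log ((p.n + 2 : ℕ) : ℝ) ≤ 2 * p.logN := by
          have h2 : ((p.n + 2 : ℕ) : ℝ) ≤ (p.n : ℝ) ^ 2 := by push_cast; nlinarith
          have h3 := Real.log_le_log (by positivity) h2
          rw [Real.log_pow] at h3
          have h4 : Real.log p.n = p.logN * Real.log 2 := by
            unfold Params.logN Real.logb
            field_simp
          rw [h4] at h3
          push_cast at h3 ⊢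
          have h5 := Real.log_two_lt_d9
          nlinarith
        have h2 : ((p.n + 2 : ℕ) : ℝ) ^ r ≤ Real.exp (2 * p.logN ^ 2) := by
          rw [← Real.exp_log (show (0 : ℝ) < ((p.n + 2 : ℕ) : ℝ) by positivity),
            ← Real.exp_nat_mul]
          refine Real.exp_le_exp.2 ?_
          calc (r : ℝ) * Real.log ((p.n + 2 : ℕ) : ℝ) ≤ p.logN * (2 * p.logN) := by gcongr
            _ = _ := by ring
        have h3 : p.logN ^ 3 ≤ p.logN ^ (p.κ * 8) := by
          rw [← Real.rpow_natCast]
          exact Real.rpow_le_rpow_of_exponent_le hl1 (by push_cast; linarith)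
        have h4 : 2 * p.logN ^ 2 + p.logN ≤ p.logN ^ 3 := by
          have := hp.logN_ge
          nlinarith [mul_pos hl hl]
        calc _ ≤ Real.exp (2 * p.logN ^ 2) * Real.exp (-(p.logN ^ (p.κ * 8))) := by gcongr
          _ = Real.exp (2 * p.logN ^ 2 + -(p.logN ^ (p.κ * 8))) := (Real.exp_add _ _).symm
          _ ≤ Real.exp (-p.logN) := Real.exp_le_exp.2 (by linarith)
          _ ≤ _ := exp_neg_le_inv hl

end LevelBound

/-! ### The messages of a history -/

section Histories

variable {p : Params} {D : Type*}

lemma rounds_ne_nil (Bs : List (List (p.Node × D))) (B : List (p.Node × D)) :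
    (Bs ++ [B]).flatMap cycle ≠ [] := by
  simp [cycle]

variable [LinearOrder D]

lemma msgsAfter_updates_le (os : List (Op p D)) (B : List (p.Node × D)) (k : ℕ) (s : State p D) :
    msgsAfter k ⟨s, B.map (fun u => Op.update u.1 u.2) ++ os, 0⟩ ≤
      expect (updates B s) fun s' => msgsAfter (k - B.length) ⟨s', os, 0⟩ := by
  induction B generalizing k s with
  | nil => rw [updates, expect_pure]; simp
  | cons u B ih =>
    rcases k with _ | k
    · rw [msgsAfter_zero]; simp
    · rw [msgsAfter_succ, List.map_cons, List.cons_append, expect_step_update, updates, expect_bind,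
        List.length_cons, Nat.add_sub_add_right]
      exact expect_mono fun s' _ => ih k s'

/-- The messages of a REFRESH that is not the last operation are not counted. -/
lemma msgsAfter_refresh_cons_le (hp : p.Large) {e : p.Node → D} (he : Function.Injective e)
    {os : List (Op p D)} (hos : os ≠ []) {F : ℝ≥0∞}
    (hF : ∀ k s, Fresh e s → msgsAfter k ⟨s, os, 0⟩ ≤ F) (k : ℕ) {s : State p D}
    (hs : Ready e s) : msgsAfter k ⟨s, Op.refresh :: os, 0⟩ ≤ F := by
  induction k generalizing s with
  | zero => rw [msgsAfter_zero]; simp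
  | succ k ih =>
    rw [msgsAfter_succ, expect_step_refresh]
    refine expect_le_of_forall fun q hq => ?_
    have hf := fresh_of_mem_refresh hp hs he hq
    by_cases hA : q.1.AllFilled
    · rw [next_of_allFilled hA, next_msgs_of_ne hos]
      exact hF k _ hf
    · rw [next_of_not hA, next_msgs_of_ne hos]
      exact ih hf.1

lemma msgsAfter_setup_cons_le (hp : p.Large) {e : p.Node → D} (he : Function.Injective e)
    {os : List (Op p D)} (hos : os ≠ []) {F : ℝ≥0∞}
    (hF : ∀ k s, Fresh e s → msgsAfter k ⟨s, os, 0⟩ ≤ F) (k : ℕ) {s : State p D}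
    (hs : Ready e s) : msgsAfter k ⟨s, Op.setup :: os, 0⟩ ≤ F := by
  induction k generalizing s with
  | zero => rw [msgsAfter_zero]; simp
  | succ k ih =>
    rw [msgsAfter_succ, expect_step_setup]
    refine expect_le_of_forall fun q hq => ?_
    have hf := fresh_of_mem_build hp hs he (admissible_univ s) hq
    by_cases hA : q.1.AllFilled
    · rw [next_of_allFilled hA, next_msgs_of_ne hos]
      exact hF k _ hf
    · rw [next_of_not hA, next_msgs_of_ne hos]
      exact ih hf.1

/-- A bound on the expected cost of the last REFRESH from an arbitrary state. -/
noncomputable def Params.refreshCost (p : Params) : ℝ≥0∞ :=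
  ENNReal.ofReal p.fullCost + p.failCost

lemma msgsAfter_rounds_le (hp : p.Large) (Bs : List (List (p.Node × D))) (B : List (p.Node × D))
    {e : p.Node → D} (he : Distinct e (Bs ++ [B])) (k : ℕ) {s : State p D} (hs : Fresh e s) :
    msgsAfter k ⟨s, (Bs ++ [B]).flatMap cycle, 0⟩ ≤ p.refreshCost := by
  induction Bs generalizing e s k with
  | nil =>
    rw [List.nil_append] at he ⊢
    have he' := (distinct_cons.1 he).2.injective
    rw [List.flatMap_cons, List.flatMap_nil, List.append_nil, cycle]
    refine (msgsAfter_updates_le _ B k s).trans ?_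
    calc _ ≤ expect (updates B s) (fun s' => (s'.maxTouched : ℝ≥0∞) + p.failCost) := by
          refine expect_mono fun s' hs' =>
            (msgsAfter_refresh_le hp he' _ (ready_of_mem_updates hp hs.1 hs') 0).trans ?_
          rw [Nat.cast_zero, zero_add]
          unfold Params.failCost
          gcongr
          exact s'.patience_le
      _ ≤ _ := by
          rw [expect_add, expect_const]
          unfold Params.refreshCost
          gcongr
          refine (expect_updates_maxTouched_le hp he' hs (K := p.n) (card_le_n _)
            (by linarith [hp.logN_le_n, hp.logN_ge])).trans (ENNReal.ofReal_le_ofReal ?_)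
          have h := hp.fullCost_ge
          have : (0 : ℝ) ≤ p.classes := by positivity
          linarith
  | cons B' Bs ih =>
    rw [List.cons_append, distinct_cons] at he
    rw [List.cons_append, List.flatMap_cons, cycle, List.append_assoc]
    refine (msgsAfter_updates_le _ B' k s).trans (expect_le_of_forall fun s' hs' => ?_)
    exact msgsAfter_refresh_cons_le hp he.2.injective (rounds_ne_nil Bs B)
      (fun k s hs => ih he.2 k hs) _ (ready_of_mem_updates hp hs.1 hs')

/-- A law of the state between two rounds: tame, without updated nodes, and with all classes filled
up to a small probability. -/
structure Steady (ν : PMF (State p D)) (e : p.Node → D) (r : ℕ) : Prop extends Tame ν e r where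
  fresh : ∀ s ∈ ν.support, Fresh e s
  filled : expect ν (fun s => ind (¬ s.AllFilled)) ≤ ENNReal.ofReal p.failProb

lemma steady_setup (hp : p.Large) {e : p.Node → D} (he : Function.Injective e) {s : State p D}
    (hs : Ready e s) : Steady ((build Finset.univ s).map Prod.fst) e 1 := by
  refine ⟨tame_setup hp he hs, fun s' hs' => ?_, ?_⟩
  · rw [PMF.mem_support_map_iff] at hs'
    obtain ⟨q, hq, rfl⟩ := hs'
    exact fresh_of_mem_build hp hs he (admissible_univ s) hq
  · rw [expect_map]
    exact (expect_build_univ_fail_le hp (hs.2 ▸ he)).trans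
      (ENNReal.ofReal_le_ofReal hp.rpow_le_failProb)

lemma Tame.steady_refresh (hp : p.Large) {ν : PMF (State p D)} {e : p.Node → D} {r : ℕ}
    (hν : Tame ν e r) (he : Function.Injective e) (hr : (r : ℝ) ≤ p.logN) :
    Steady (ν.bind fun s => (SeleMon.refresh s).map Prod.fst) e (r + 1) := by
  refine ⟨hν.refresh hp he, fun s' hs' => ?_, ?_⟩
  · rw [PMF.mem_support_bind_iff] at hs'
    obtain ⟨s, hs, hs'⟩ := hs'
    rw [PMF.mem_support_map_iff] at hs'
    obtain ⟨q, hq, rfl⟩ := hs'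
    exact fresh_of_mem_refresh hp (hν.ready s hs) he hq
  · rw [expect_bind]
    simp_rw [expect_map]
    exact hν.expect_fail_le hp he hr

/-- Each REFRESH before the last one is treated as if its first repetition were successful; what is
wrong with this is paid for with the probability of a failure. -/
lemma expect_msgsAfter_rounds_le (hp : p.Large) {B : List (p.Node × D)} {G : ℝ≥0∞}
    (hG : ∀ (ν : PMF (State p D)) (e : p.Node → D) (r k : ℕ), Steady ν e r → 1 ≤ r →
      (r : ℝ) ≤ p.logN → Function.Injective (dataAfter e B) →
      expect ν (fun s => msgsAfter k ⟨s, cycle B, 0⟩) ≤ G)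
    (Bs : List (List (p.Node × D))) {ν : PMF (State p D)} {e : p.Node → D} {r : ℕ}
    (hν : Steady ν e r) (hr1 : 1 ≤ r) (hr : ((r + Bs.length : ℕ) : ℝ) ≤ p.logN)
    (he : Distinct e (Bs ++ [B])) (k : ℕ) :
    expect ν (fun s => msgsAfter k ⟨s, (Bs ++ [B]).flatMap cycle, 0⟩) ≤
      G + Bs.length * (ENNReal.ofReal p.failProb * p.refreshCost) := by
  induction Bs generalizing ν e r k with
  | nil =>
    rw [List.nil_append] at he
    simpa using hG ν e r k hν hr1 (by simpa using hr) (distinct_cons.1 he).2.injective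
  | cons B' Bs ih =>
    rw [List.cons_append, distinct_cons] at he
    obtain ⟨-, he'⟩ := he
    have hei := he'.injective
    rw [List.length_cons] at hr ⊢
    have hr' : (r : ℝ) ≤ p.logN := le_trans (by exact_mod_cast (by omega)) hr
    have hν' := hν.toTame.updates hp hr1 B'
    simp only [List.cons_append, List.flatMap_cons]
    set os := (Bs ++ [B]).flatMap cycle with hos
    calc _ ≤ expect ν (fun s => expect (updates B' s) fun s' =>
          msgsAfter (k - B'.length) ⟨s', Op.refresh :: os, 0⟩) := by
          refine expect_mono fun s _ => ?_
          rw [cycle, List.append_assoc]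
          exact msgsAfter_updates_le _ B' k s
      _ = expect (ν.bind (updates B')) (fun s' =>
          msgsAfter (k - B'.length) ⟨s', Op.refresh :: os, 0⟩) := (expect_bind _ _ _).symm
      _ ≤ _ := ?_
    rcases hk : k - B'.length with _ | j
    · refine (expect_le_of_forall (c := 0) fun s _ => ?_).trans zero_le
      rw [msgsAfter_zero]; simp
    calc _ ≤ expect (ν.bind (updates B')) (fun s' => expect (SeleMon.refresh s') fun q =>
          msgsAfter j ⟨q.1, os, 0⟩ + ind (¬ q.1.AllFilled) * p.refreshCost) := by
          refine expect_mono fun s' hs' => ?_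
          rw [msgsAfter_succ, expect_step_refresh]
          refine expect_mono fun q hq => ?_
          have hf := fresh_of_mem_refresh hp (hν'.ready s' hs') hei hq
          by_cases hA : q.1.AllFilled
          · rw [next_of_allFilled hA, next_msgs_of_ne (rounds_ne_nil Bs B)]
            exact le_self_add
          · rw [next_of_not hA, next_msgs_of_ne (rounds_ne_nil Bs B), ind_of hA, one_mul]
            exact (msgsAfter_refresh_cons_le hp hei (rounds_ne_nil Bs B)
              (fun k s hs => msgsAfter_rounds_le hp Bs B he' k hs) j hf.1).trans le_add_self
      _ = expect ((ν.bind (updates B')).bind fun s => (SeleMon.refresh s).map Prod.fst)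
            (fun s => msgsAfter j ⟨s, os, 0⟩) +
          expect (ν.bind (updates B')) (fun s' => expect (SeleMon.refresh s') fun q =>
            ind (¬ q.1.AllFilled)) * p.refreshCost := by
          simp only [expect_bind, expect_map, expect_add, expect_mul_const]
      _ ≤ (G + Bs.length * (ENNReal.ofReal p.failProb * p.refreshCost)) +
          ENNReal.ofReal p.failProb * p.refreshCost := by
          gcongr
          · exact ih (hν'.steady_refresh hp hei hr') (by omega)
              (le_trans (by exact_mod_cast (by omega)) hr) he' j
          · exact hν'.expect_fail_le hp hei hr'
      _ = _ := by push_cast; ring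

lemma expectedMessages_history_le (hp : p.Large) {B : List (p.Node × D)} {G : ℝ≥0∞}
    (hG : ∀ (ν : PMF (State p D)) (e : p.Node → D) (r k : ℕ), Steady ν e r → 1 ≤ r →
      (r : ℝ) ≤ p.logN → Function.Injective (dataAfter e B) →
      expect ν (fun s => msgsAfter k ⟨s, cycle B, 0⟩) ≤ G)
    {Bs : List (List (p.Node × D))} {d : p.Node → D} (hB : ((Bs.length + 1 : ℕ) : ℝ) ≤ p.logN)
    (hd : Distinct d (Bs ++ [B])) :
    expectedMessages d (history (Bs ++ [B])) ≤
      G + (Bs.length + 1) * (ENNReal.ofReal p.failProb * p.refreshCost) := by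
  rw [expectedMessages_eq]
  refine iSup_le fun k => ?_
  have hs := ready_start d (history (Bs ++ [B]))
  have hd' := hd.injective
  rcases k with _ | k
  · rw [msgsAfter_zero]; simp [start]
  unfold start at hs ⊢
  set s : State p D := ⟨d, fun _ => 0, ∅, fun _ => none, fun _ => none, ∅⟩
  have hν := steady_setup hp hd' hs
  rw [history, msgsAfter_succ, expect_step_setup]
  calc _ ≤ expect (build Finset.univ s) (fun q =>
        msgsAfter k ⟨q.1, (Bs ++ [B]).flatMap cycle, 0⟩ +
          ind (¬ q.1.AllFilled) * p.refreshCost) := by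
        refine expect_mono fun q hq => ?_
        have hf := fresh_of_mem_build hp hs hd' (admissible_univ s) hq
        by_cases hA : q.1.AllFilled
        · rw [next_of_allFilled hA, next_msgs_of_ne (rounds_ne_nil Bs B)]
          exact le_self_add
        · rw [next_of_not hA, next_msgs_of_ne (rounds_ne_nil Bs B), ind_of hA, one_mul]
          exact (msgsAfter_setup_cons_le hp hd' (rounds_ne_nil Bs B)
            (fun k s hs => msgsAfter_rounds_le hp Bs B hd k hs) k hf.1).trans le_add_self
    _ ≤ (G + Bs.length * (ENNReal.ofReal p.failProb * p.refreshCost)) +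
          ENNReal.ofReal p.failProb * p.refreshCost := by
        rw [expect_add, expect_mul_const]
        have h1 := expect_msgsAfter_rounds_le hp hG Bs hν le_rfl (by rwa [add_comm]) hd k
        have h2 := hν.filled
        rw [expect_map] at h1 h2
        gcongr
    _ = _ := by ring

end Histories

/-! ### The last round -/

section LastRound

variable {p : Params} {D : Type*} [LinearOrder D]

lemma Steady.expect_not_calm_le (hp : p.Large) {ν : PMF (State p D)} {e : p.Node → D} {r : ℕ}
    (hν : Steady ν e r) (B : List (p.Node × D)) (L : ℕ) :
    expect (ν.bind (updates B)) (fun s => ind (¬ s.Calm L)) ≤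
      B.length * ((r + 1) * p.tail (8 * L * p.width)) + ENNReal.ofReal p.failProb := by
  classical
  have hw := hp.width_pos
  rw [expect_bind]
  calc _ ≤ expect ν (fun s => ∑ i ∈ (B.map Prod.fst).toFinset,
        ind (8 * L * p.width < (s.height i : ℝ)) + ind (¬ s.AllFilled) +
          B.length * p.tail (8 * L * p.width)) := by
        refine expect_mono fun s hs =>
          (expect_updates_not_calm_le hp L B (hν.ready s hs).1).trans ?_
        gcongr
        refine (ind_or_le _ _).trans (add_le_add (le_trans (ind_mono ?_) ind_exists_mem_le)
          (ind_mono fun h hf => h ⟨fun c _ hc => hf c hc, fun i hi => ?_⟩))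
        · rintro ⟨u, hu, h⟩
          exact ⟨u.1, by simpa using ⟨u.2, hu⟩, h⟩
        · rw [(hν.fresh s hs).2] at hi
          simp at hi
    _ ≤ B.length * (r * p.tail (8 * L * p.width)) + ENNReal.ofReal p.failProb +
          B.length * p.tail (8 * L * p.width) := by
        rw [expect_add, expect_add, expect_const, expect_sum]
        gcongr
        · calc _ ≤ ∑ i ∈ (B.map Prod.fst).toFinset, (r : ℝ≥0∞) * p.tail (8 * L * p.width) :=
                Finset.sum_le_sum fun i _ => hν.tail i _ (by positivity)
            _ ≤ _ := by
                rw [Finset.sum_const, nsmul_eq_mul]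
                gcongr
                exact (List.toFinset_card_le _).trans (List.length_map _).le
        · exact hν.filled
    _ = _ := by ring

/-- The first repetition of the last REFRESH on a typical state, and on the others. -/
lemma expect_build_participants_le (hp : p.Large) {e : p.Node → D} (he : Function.Injective e)
    {s : State p D} (hs : Ready e s) {L N : ℕ} (hL : 1 ≤ L) (hN : 1 ≤ N) :
    expect (build s.participants s) (fun q => (q.2 : ℝ≥0∞)) ≤
      1 + ENNReal.ofReal (1 / p.φ * (p.logPhi N + 3 * p.unit)) + 2 * (L + 3 : ℕ) +
        2 * p.classes * (N * p.tail (8 * (L + 3 : ℕ) * p.width)) +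
        (ind (¬ s.Calm L) + ind (s.Calm L ∧ N < s.participants.card)) *
          ENNReal.ofReal p.fullCost := by
  have hd : Function.Injective s.data := hs.2 ▸ he
  by_cases hc : s.Calm L
  · by_cases hcard : N < s.participants.card
    · rw [ind_of (P := s.Calm L ∧ N < s.participants.card) ⟨hc, hcard⟩]
      refine (expect_build_cost_le_fullCost hp hd _).trans (le_trans ?_ le_add_self)
      exact le_mul_of_one_le_left zero_le le_add_self
    · rw [not_lt] at hcard
      refine le_trans ?_ le_self_add
      refine (expect_build_cost_le hp hs.1 hd (L := L + 3) (K := N) (by exact_mod_cast hcard)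
        (by exact_mod_cast hN) (fun c h1 h2 => hc.1 c (by omega) h2) (fun c h1 i hi => ?_)
        (fun c h1 i hi => ?_)).trans ?_
      · have := hs.1.alarm_mem c i hi
        exact hc.not_mem_participants hp.width_pos hL hs.1 (by omega) this.1 this.2
      · have := hs.1.rep_mem c i hi
        exact hc.not_mem_participants hp.width_pos hL hs.1 (by omega) this.1 this.2
      · gcongr
  · rw [ind_of hc]
    refine (expect_build_cost_le_fullCost hp hd _).trans (le_trans ?_ le_add_self)
    exact le_mul_of_one_le_left zero_le le_self_add

/-- The cost of the last REFRESH: the updated nodes of maximal height, the first repetition with at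
most `N` participants up to level `L`, its cost on the exceptional states, and the repetitions after
a failure. -/
lemma Steady.expect_last_le (hp : p.Large) {ν : PMF (State p D)} {e : p.Node → D} {r : ℕ}
    (hν : Steady ν e r) (hr1 : 1 ≤ r) (hr : (r : ℝ) ≤ p.logN) {B : List (p.Node × D)}
    (he : Function.Injective (dataAfter e B)) (k : ℕ) {L N : ℕ} (hL : 1 ≤ L)
    (hN : p.logN ^ (p.κ * (8 * L + 16)) ≤ N) (hN1 : 1 ≤ N) :
    expect ν (fun s => msgsAfter k ⟨s, cycle B, 0⟩) ≤
      ENNReal.ofReal (1 / p.φ * (p.logPhi (max (B.length : ℝ) 1) + 3 * p.unit)) + 1 +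
        (1 + ENNReal.ofReal (1 / p.φ * (p.logPhi N + 3 * p.unit)) + 2 * (L + 3 : ℕ) +
          2 * p.classes * (N * p.tail (8 * (L + 3 : ℕ) * p.width)) +
          (B.length * ((r + 1) * p.tail (8 * L * p.width)) + ENNReal.ofReal p.failProb +
            ENNReal.ofReal (p.logN)⁻¹) * ENNReal.ofReal p.fullCost) +
        ENNReal.ofReal p.failProb * p.failCost := by
  have hν' := hν.toTame.updates hp hr1 B
  calc _ ≤ expect (ν.bind (updates B)) (fun s =>
        s.maxTouched + 1 + (1 + ENNReal.ofReal (1 / p.φ * (p.logPhi N + 3 * p.unit)) +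
          2 * (L + 3 : ℕ) + 2 * p.classes * (N * p.tail (8 * (L + 3 : ℕ) * p.width)) +
          (ind (¬ s.Calm L) + ind (s.Calm L ∧ N < s.participants.card)) *
            ENNReal.ofReal p.fullCost) +
          expect (refresh s) (fun q => ind (¬ q.1.AllFilled)) * p.failCost) := by
        rw [expect_bind]
        refine expect_mono fun s hs => (msgsAfter_updates_le _ B k s).trans
          (expect_mono fun s' hs' => ?_)
        have hs'' := ready_of_mem_updates hp (hν.ready s hs) hs'
        refine (msgsAfter_refresh_le_first hp he _ hs'').trans ?_
        gcongr
        exact expect_build_participants_le hp he hs'' hL hN1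
    _ ≤ _ := by
        simp only [expect_add, expect_const, expect_mul_const]
        gcongr
        · rw [expect_bind]
          refine expect_le_of_forall fun s hs =>
            expect_updates_maxTouched_le hp he (hν.fresh s hs) ?_ (le_max_right _ _)
          refine le_trans ?_ (le_max_left _ _)
          exact_mod_cast (List.toFinset_card_le _).trans (List.length_map _).le
        · exact hν.expect_not_calm_le hp B L
        · exact hν'.expect_many_participants_le hp he hr hL hN
        · exact hν'.expect_fail_le hp he hr

end LastRound

/-! ### Summing up the costs -/

section Numerics

variable {p : Params}

lemma Params.Large.fullCost_nonneg (hp : p.Large) : 0 ≤ p.fullCost := by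
  have := hp.unit_le
  have := hp.one_le_unit
  have := p.one_lt_inv_φ
  unfold Params.fullCost
  exact mul_nonneg (by norm_num) (mul_nonneg (by linarith) (by linarith))

lemma Params.Large.one_le_inv_φ_mul_unit (hp : p.Large) : 1 ≤ 1 / p.φ * p.unit :=
  one_le_mul_of_one_le_of_one_le p.one_lt_inv_φ.le hp.one_le_unit

lemma Params.Large.fullCost_le (hp : p.Large) :
    p.fullCost ≤ 6 * p.logN * (1 / p.φ * p.unit) := by
  have h1 : 1 / p.φ * p.logPhi p.n ≤ 1 / p.φ * (p.logN * p.unit) :=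
    mul_le_mul_of_nonneg_left hp.logPhi_n_le (by linarith [p.one_lt_inv_φ])
  unfold Params.fullCost
  linarith

lemma Params.Large.failProb_nonneg (hp : p.Large) : 0 ≤ p.failProb :=
  mul_nonneg (by norm_num) (Real.rpow_nonneg hp.logN_pos.le _)

lemma Params.Large.failProb_mul_le (hp : p.Large) : p.failProb * p.logN ^ 3 ≤ 3 := by
  have h : p.logN ^ (3 - p.κ) * p.logN ^ 3 ≤ 1 := by
    rw [← Real.rpow_natCast, ← Real.rpow_add hp.logN_pos]
    exact Real.rpow_le_one_of_one_le_of_nonpos (by linarith [hp.logN_ge])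
      (by push_cast; linarith [hp.κ_ge])
  unfold Params.failProb
  linarith

lemma Params.Large.failCost_le (hp : p.Large) :
    p.failCost ≤ ENNReal.ofReal (7 * p.logN ^ 2 * (1 / p.φ * p.unit)) := by
  have hl := hp.logN_ge
  have hU := hp.one_le_inv_φ_mul_unit
  have hf := hp.fullCost_nonneg
  unfold Params.failCost
  rw [← ENNReal.ofReal_one, ← ENNReal.ofReal_add zero_le_one hf, ← ENNReal.ofReal_natCast,
    ← ENNReal.ofReal_mul (by linarith)]
  refine ENNReal.ofReal_le_ofReal ?_
  have h1 : 1 + p.fullCost ≤ 7 * p.logN * (1 / p.φ * p.unit) := by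
    have := hp.fullCost_le
    nlinarith
  have h2 : ((2 * (p.classes + 1) : ℕ) : ℝ) ≤ p.logN := by
    have := hp.classes_le
    have : (0 : ℝ) ≤ p.classes := by positivity
    push_cast
    linarith
  calc _ ≤ 7 * p.logN * (1 / p.φ * p.unit) * p.logN :=
        mul_le_mul h1 h2 (by positivity) (by nlinarith)
    _ = _ := by ring

lemma Params.Large.failProb_mul_fullCost_le (hp : p.Large) :
    ENNReal.ofReal p.failProb * ENNReal.ofReal p.fullCost ≤
      ENNReal.ofReal (18 * (1 / p.φ * p.unit)) := by
  have hl := hp.logN_ge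
  have hU := hp.one_le_inv_φ_mul_unit
  rw [← ENNReal.ofReal_mul hp.failProb_nonneg]
  refine ENNReal.ofReal_le_ofReal ?_
  have hpow : p.logN ≤ p.logN ^ 3 := le_self_pow₀ (by linarith) (by norm_num)
  calc p.failProb * p.fullCost ≤ p.failProb * (6 * p.logN ^ 3 * (1 / p.φ * p.unit)) := by
        refine mul_le_mul_of_nonneg_left (hp.fullCost_le.trans ?_) hp.failProb_nonneg
        gcongr
    _ = p.failProb * p.logN ^ 3 * (6 * (1 / p.φ * p.unit)) := by ring
    _ ≤ 3 * (6 * (1 / p.φ * p.unit)) :=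
        mul_le_mul_of_nonneg_right hp.failProb_mul_le (by linarith)
    _ = _ := by ring

lemma Params.Large.failProb_mul_failCost_le (hp : p.Large) :
    ENNReal.ofReal p.failProb * p.failCost ≤ ENNReal.ofReal (21 * (1 / p.φ * p.unit)) := by
  have hl := hp.logN_ge
  have hU := hp.one_le_inv_φ_mul_unit
  refine (mul_le_mul_right hp.failCost_le _).trans ?_
  rw [← ENNReal.ofReal_mul hp.failProb_nonneg]
  refine ENNReal.ofReal_le_ofReal ?_
  have hpow : p.logN ^ 2 ≤ p.logN ^ 3 := pow_le_pow_right₀ (by linarith) (by norm_num)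
  calc _ ≤ p.failProb * (7 * p.logN ^ 3 * (1 / p.φ * p.unit)) := by
        refine mul_le_mul_of_nonneg_left ?_ hp.failProb_nonneg
        gcongr
    _ = p.failProb * p.logN ^ 3 * (7 * (1 / p.φ * p.unit)) := by ring
    _ ≤ 3 * (7 * (1 / p.φ * p.unit)) :=
        mul_le_mul_of_nonneg_right hp.failProb_mul_le (by linarith)
    _ = _ := by ring

/-- The failures of all operations before the last REFRESH contribute little, as there are at most
`log n` of them. -/
lemma Params.Large.mul_failProb_mul_refreshCost_le (hp : p.Large) {N : ℕ}
    (hN : ((N + 1 : ℕ) : ℝ) ≤ p.logN) :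
    (N + 1 : ℝ≥0∞) * (ENNReal.ofReal p.failProb * p.refreshCost) ≤
      ENNReal.ofReal (39 * (1 / p.φ * p.unit)) := by
  have hl := hp.logN_ge
  have hU := hp.one_le_inv_φ_mul_unit
  have h1 : p.refreshCost ≤ ENNReal.ofReal (13 * p.logN ^ 2 * (1 / p.φ * p.unit)) := by
    unfold Params.refreshCost
    refine (add_le_add le_rfl hp.failCost_le).trans ?_
    rw [← ENNReal.ofReal_add hp.fullCost_nonneg (by positivity)]
    refine ENNReal.ofReal_le_ofReal ?_
    have hpow : p.logN ≤ p.logN ^ 2 := le_self_pow₀ (by linarith) (by norm_num)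
    have h2 : 6 * p.logN * (1 / p.φ * p.unit) ≤ 6 * p.logN ^ 2 * (1 / p.φ * p.unit) := by gcongr
    linarith [hp.fullCost_le]
  have h2 : (N + 1 : ℝ≥0∞) ≤ ENNReal.ofReal p.logN := by
    have := ENNReal.ofReal_le_ofReal hN
    rw [ENNReal.ofReal_natCast] at this
    exact_mod_cast this
  calc _ ≤ ENNReal.ofReal p.logN * (ENNReal.ofReal p.failProb *
        ENNReal.ofReal (13 * p.logN ^ 2 * (1 / p.φ * p.unit))) := by gcongr
    _ = ENNReal.ofReal (p.failProb * p.logN ^ 3 * (13 * (1 / p.φ * p.unit))) := by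
        rw [← ENNReal.ofReal_mul hp.failProb_nonneg, ← ENNReal.ofReal_mul hp.logN_pos.le]
        congr 1; ring
    _ ≤ ENNReal.ofReal (39 * (1 / p.φ * p.unit)) := by
        refine ENNReal.ofReal_le_ofReal ?_
        calc _ ≤ 3 * (13 * (1 / p.φ * p.unit)) :=
              mul_le_mul_of_nonneg_right hp.failProb_mul_le (by linarith)
          _ = _ := by ring

lemma Params.Large.inv_logN_mul_fullCost_le (hp : p.Large) :
    ENNReal.ofReal (p.logN)⁻¹ * ENNReal.ofReal p.fullCost ≤
      ENNReal.ofReal (6 * (1 / p.φ * p.unit)) := by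
  have hl := hp.logN_pos
  rw [← ENNReal.ofReal_mul (by positivity)]
  refine ENNReal.ofReal_le_ofReal ?_
  calc _ ≤ (p.logN)⁻¹ * (6 * p.logN * (1 / p.φ * p.unit)) :=
        mul_le_mul_of_nonneg_left hp.fullCost_le (by positivity)
    _ = _ := by field_simp

/-- For `m` updates, the level `L` is such that `m` heights rarely exceed `8L` widths. -/
lemma Params.Large.length_mul_tail_mul_fullCost_le (hp : p.Large) {m r L : ℕ}
    (hr : (r : ℝ) ≤ p.logN) (hm : (m : ℝ) ≤ p.logN ^ (p.κ * (8 * L - 8))) :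
    m * ((r + 1) * p.tail (8 * L * p.width)) * ENNReal.ofReal p.fullCost ≤
      ENNReal.ofReal (12 * (1 / p.φ * p.unit)) := by
  have hl := hp.logN_pos
  have hl1 : 1 ≤ p.logN := by linarith [hp.logN_ge]
  have hU := hp.one_le_inv_φ_mul_unit
  have hf := hp.fullCost_nonneg
  calc _ ≤ ENNReal.ofReal m * (ENNReal.ofReal (r + 1) *
        ENNReal.ofReal (p.logN ^ (1 - p.κ * (8 * L)))) * ENNReal.ofReal p.fullCost := by
        rw [ENNReal.ofReal_add (by positivity) zero_le_one, ENNReal.ofReal_one,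
          ENNReal.ofReal_natCast, ENNReal.ofReal_natCast]
        gcongr
        exact hp.tail_le (by positivity)
    _ = ENNReal.ofReal (m * ((r + 1) * p.logN ^ (1 - p.κ * (8 * L))) * p.fullCost) := by
        rw [← ENNReal.ofReal_mul (by positivity), ← ENNReal.ofReal_mul (by positivity),
          ← ENNReal.ofReal_mul (by positivity)]
    _ ≤ _ := ENNReal.ofReal_le_ofReal ?_
  calc _ ≤ p.logN ^ (p.κ * (8 * L - 8)) * (2 * p.logN ^ (1 : ℝ) * p.logN ^ (1 - p.κ * (8 * L))) *
        (6 * p.logN ^ (1 : ℝ) * (1 / p.φ * p.unit)) := by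
        rw [Real.rpow_one]
        gcongr
        · linarith
        · exact hp.fullCost_le
    _ = 12 * (p.logN ^ (p.κ * (8 * L - 8)) * p.logN ^ (1 : ℝ) * p.logN ^ (1 - p.κ * (8 * L)) *
          p.logN ^ (1 : ℝ)) * (1 / p.φ * p.unit) := by ring
    _ ≤ 12 * 1 * (1 / p.φ * p.unit) := by
        gcongr
        rw [← Real.rpow_add hl, ← Real.rpow_add hl, ← Real.rpow_add hl]
        exact Real.rpow_le_one_of_one_le_of_nonpos hl1 (by nlinarith [hp.κ_ge])
    _ = _ := by ring

lemma Params.Large.classes_mul_tail_le (hp : p.Large) {N L : ℕ}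
    (hN : (N : ℝ) ≤ 2 * p.logN ^ (p.κ * (8 * L + 16))) :
    2 * p.classes * (N * p.tail (8 * (L + 3 : ℕ) * p.width)) ≤ 1 := by
  have hl := hp.logN_pos
  have hl1 : 1 ≤ p.logN := by linarith [hp.logN_ge]
  calc _ ≤ ENNReal.ofReal (2 * p.classes) * (ENNReal.ofReal N *
        ENNReal.ofReal (p.logN ^ (1 - p.κ * (8 * (L + 3 : ℕ))))) := by
        rw [ENNReal.ofReal_mul zero_le_two, ENNReal.ofReal_ofNat, ENNReal.ofReal_natCast,
          ENNReal.ofReal_natCast]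
        gcongr
        exact hp.tail_le (by positivity)
    _ = ENNReal.ofReal (2 * p.classes * (N * p.logN ^ (1 - p.κ * (8 * (L + 3 : ℕ))))) := by
        rw [← ENNReal.ofReal_mul (by positivity), ← ENNReal.ofReal_mul (by positivity)]
    _ ≤ ENNReal.ofReal 1 := ENNReal.ofReal_le_ofReal ?_
    _ = 1 := ENNReal.ofReal_one
  have h1 : 4 * (p.classes : ℝ) ≤ p.logN ^ (1 : ℝ) := by
    have := hp.classes_le
    have : (0 : ℝ) ≤ p.classes := by positivity
    rw [Real.rpow_one]
    linarith
  calc _ ≤ 2 * p.classes * (2 * p.logN ^ (p.κ * (8 * L + 16)) *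
        p.logN ^ (1 - p.κ * (8 * (L + 3 : ℕ)))) := by gcongr
    _ = 4 * p.classes * (p.logN ^ (p.κ * (8 * L + 16)) *
        p.logN ^ (1 - p.κ * (8 * (L + 3 : ℕ)))) := by ring
    _ ≤ p.logN ^ (1 : ℝ) * (p.logN ^ (p.κ * (8 * L + 16)) *
        p.logN ^ (1 - p.κ * (8 * (L + 3 : ℕ)))) := by gcongr
    _ ≤ 1 := by
        rw [← Real.rpow_add hl, ← Real.rpow_add hl]
        refine Real.rpow_le_one_of_one_le_of_nonpos hl1 ?_
        push_cast
        nlinarith [hp.κ_ge]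

variable {D : Type*} [LinearOrder D]

/-- The choice of the level up to which the last REFRESH acts: it exceeds
`log m / (8κ log log n)` by at least one, so that `m` new heights rarely reach it, and by at most
two. -/
lemma Params.Large.exists_level (hp : p.Large) (m : ℕ) :
    ∃ L : ℕ, 1 ≤ L ∧ (m : ℝ) ≤ p.logN ^ (p.κ * (8 * L - 8)) ∧
      8 * p.κ * p.unit * L ≤ p.logPhi (max (m : ℝ) 1) + 16 * p.κ * p.unit := by
  have hu := hp.one_le_unit
  have hκ := hp.κ_ge
  have hφ := p.one_lt_inv_φ
  have hm1 : (0 : ℝ) < max (m : ℝ) 1 := lt_max_of_lt_right one_pos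
  have hv : 0 ≤ p.logPhi (max (m : ℝ) 1) := Real.logb_nonneg hφ (le_max_right _ _)
  have hc : 0 < 8 * p.κ * p.unit := by positivity
  refine ⟨⌈p.logPhi (max (m : ℝ) 1) / (8 * p.κ * p.unit)⌉₊ + 1, by omega, ?_, ?_⟩
  · rw [hp.rpow_logN]
    refine (le_max_left (m : ℝ) 1).trans
      ((Real.rpow_logb (by linarith) hφ.ne' hm1).symm.le.trans
        (Real.rpow_le_rpow_of_exponent_le hφ.le ?_))
    have := Nat.le_ceil (p.logPhi (max (m : ℝ) 1) / (8 * p.κ * p.unit))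
    rw [div_le_iff₀ hc] at this
    push_cast
    unfold Params.logPhi at this ⊢
    linarith
  · have := (Nat.ceil_lt_add_one (div_nonneg hv hc.le)).le
    have h2 := mul_le_mul_of_nonneg_left this hc.le
    rw [mul_add, mul_div_cancel₀ _ hc.ne'] at h2
    push_cast
    linarith

lemma Steady.expect_last_le_logPhi (hp : p.Large) {ν : PMF (State p D)} {e : p.Node → D} {r : ℕ}
    (hν : Steady ν e r) (hr1 : 1 ≤ r) (hr : (r : ℝ) ≤ p.logN) {B : List (p.Node × D)}
    (he : Function.Injective (dataAfter e B)) (k : ℕ) :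
    expect ν (fun s => msgsAfter k ⟨s, cycle B, 0⟩) ≤
      ENNReal.ofReal ((32 * p.κ + 81) * (1 / p.φ * p.logPhi (max (B.length : ℝ) p.logN))) := by
  have hl := hp.logN_pos
  have hl16 := hp.logN_ge
  have hu := hp.one_le_unit
  have hκ := hp.κ_ge
  have hφ := p.one_lt_inv_φ
  have hU := hp.one_le_inv_φ_mul_unit
  obtain ⟨L, hL1, hLm, hL⟩ := hp.exists_level B.length
  set V := p.logPhi (max (B.length : ℝ) p.logN) with hV
  set v := p.logPhi (max (B.length : ℝ) 1) with hv
  have hvV : v ≤ V := Real.logb_le_logb_of_le hφ (lt_max_of_lt_right one_pos)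
    (max_le_max le_rfl (by linarith))
  have huV : p.unit ≤ V := Real.logb_le_logb_of_le hφ hl (le_max_right _ _)
  have hv0 : 0 ≤ v := Real.logb_nonneg hφ (le_max_right _ _)
  set x := p.logN ^ (p.κ * (8 * L + 16)) with hx
  have hx1 : 1 ≤ x := Real.one_le_rpow (by linarith) (by positivity)
  set N := ⌈x⌉₊ with hN
  have hxN : x ≤ N := Nat.le_ceil x
  have hN2 : (N : ℝ) ≤ 2 * x := by
    have := (Nat.ceil_lt_add_one (by linarith : 0 ≤ x)).le
    linarith
  have hN1 : 1 ≤ N := by exact_mod_cast hx1.trans hxN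
  have hlogN : p.logPhi N ≤ (32 * p.κ + 2) * V := by
    have h1 : (N : ℝ) ≤ p.logN ^ (p.κ * (8 * L + 16) + 1) := by
      rw [Real.rpow_add hl, Real.rpow_one, ← hx]
      nlinarith
    have h2 : p.logPhi N ≤ (p.κ * (8 * L + 16) + 1) * p.unit := by
      rw [← hp.logPhi_rpow]
      exact Real.logb_le_logb_of_le hφ (by exact_mod_cast hN1) h1
    nlinarith
  have hN0 : 0 ≤ p.logPhi N := Real.logb_nonneg hφ (by exact_mod_cast hN1)
  have hLV : (L : ℝ) ≤ 3 * V := by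
    have h1 : 8 * p.κ * L ≤ 8 * p.κ * p.unit * L := by
      have : (0 : ℝ) ≤ 8 * p.κ * L := by positivity
      nlinarith
    have h2 : 8 * p.κ * L ≤ 8 * p.κ * (3 * V) := by nlinarith
    exact le_of_mul_le_mul_left h2 (by positivity)
  have hφ0 : 0 ≤ 1 / p.φ := by linarith
  refine (hν.expect_last_le hp hr1 hr he k hL1 hxN hN1).trans ?_
  rw [add_mul, add_mul]
  calc _ ≤ ENNReal.ofReal (1 / p.φ * (v + 3 * p.unit)) + ENNReal.ofReal 1 +
        (ENNReal.ofReal 1 + ENNReal.ofReal (1 / p.φ * (p.logPhi N + 3 * p.unit)) +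
          ENNReal.ofReal (2 * (L + 3 : ℕ)) + ENNReal.ofReal 1 +
          (ENNReal.ofReal (12 * (1 / p.φ * p.unit)) + ENNReal.ofReal (18 * (1 / p.φ * p.unit)) +
            ENNReal.ofReal (6 * (1 / p.φ * p.unit)))) +
        ENNReal.ofReal (21 * (1 / p.φ * p.unit)) := by
        rw [ENNReal.ofReal_one, ENNReal.ofReal_mul (zero_le_two (α := ℝ)), ENNReal.ofReal_ofNat,
          ENNReal.ofReal_natCast]
        gcongr
        · exact hp.classes_mul_tail_le hN2
        · exact hp.length_mul_tail_mul_fullCost_le hr hLm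
        · exact hp.failProb_mul_fullCost_le
        · exact hp.inv_logN_mul_fullCost_le
        · exact hp.failProb_mul_failCost_le
    _ = ENNReal.ofReal (1 / p.φ * (v + 3 * p.unit) + 1 +
        (1 + 1 / p.φ * (p.logPhi N + 3 * p.unit) + 2 * (L + 3 : ℕ) + 1 +
          (12 * (1 / p.φ * p.unit) + 18 * (1 / p.φ * p.unit) + 6 * (1 / p.φ * p.unit))) +
        21 * (1 / p.φ * p.unit)) := by
        have a1 : 0 ≤ 1 / p.φ * (v + 3 * p.unit) := by positivity
        have a2 : 0 ≤ 1 / p.φ * (p.logPhi N + 3 * p.unit) := by positivity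
        have a3 : (0 : ℝ) ≤ 2 * (L + 3 : ℕ) := by positivity
        have a4 : 0 ≤ 1 / p.φ * p.unit := by linarith
        repeat rw [ENNReal.ofReal_add (by linarith) (by linarith)]
    _ ≤ _ := ENNReal.ofReal_le_ofReal ?_
  have b1 : 1 / p.φ * (v + 3 * p.unit) ≤ 4 * (1 / p.φ * V) := by
    calc _ ≤ 1 / p.φ * (4 * V) := mul_le_mul_of_nonneg_left (by linarith) hφ0
      _ = _ := by ring
  have b2 : 1 / p.φ * (p.logPhi N + 3 * p.unit) ≤ (32 * p.κ + 5) * (1 / p.φ * V) := by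
    calc _ ≤ 1 / p.φ * ((32 * p.κ + 5) * V) := mul_le_mul_of_nonneg_left (by linarith) hφ0
      _ = _ := by ring
  have b3 : 1 / p.φ * p.unit ≤ 1 / p.φ * V := mul_le_mul_of_nonneg_left huV hφ0
  have b4 : V ≤ 1 / p.φ * V := le_mul_of_one_le_left (by linarith) hφ.le
  push_cast
  linarith

end Numerics

section Theorem

variable {p : Params} {D : Type*} [LinearOrder D]

lemma expectedMessages_setup_le (hp : p.Large) {d : p.Node → D} (hd : Function.Injective d) :
    expectedMessages d [Op.setup] ≤ ENNReal.ofReal (12 * (1 / p.φ * p.logPhi p.n)) := by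
  rw [expectedMessages_eq]
  refine iSup_le fun k => (msgsAfter_setup_le hp hd k (ready_start d [Op.setup]) 0).trans_eq ?_
  rw [Nat.cast_zero, zero_add, ← ENNReal.ofReal_ofNat, ← ENNReal.ofReal_mul (by norm_num)]
  unfold Params.fullCost
  congr 1
  ring

lemma expectedMessages_history_le_logPhi (hp : p.Large) {d : p.Node → D}
    {Bs : List (List (p.Node × D))} {B : List (p.Node × D)}
    (hB : ((Bs.length + 1 : ℕ) : ℝ) ≤ p.logN) (hd : Distinct d (Bs ++ [B])) :
    expectedMessages d (history (Bs ++ [B])) ≤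
      ENNReal.ofReal ((32 * p.κ + 120) * (1 / p.φ * p.logPhi (max (B.length : ℝ) p.logN))) := by
  have hU := hp.one_le_inv_φ_mul_unit
  have huV : p.unit ≤ p.logPhi (max (B.length : ℝ) p.logN) :=
    Real.logb_le_logb_of_le p.one_lt_inv_φ hp.logN_pos (le_max_right _ _)
  have h1 : 1 / p.φ * p.unit ≤ 1 / p.φ * p.logPhi (max (B.length : ℝ) p.logN) :=
    mul_le_mul_of_nonneg_left huV (by linarith [p.one_lt_inv_φ])
  refine (expectedMessages_history_le hp
    (fun ν e r k hν hr1 hr he => hν.expect_last_le_logPhi hp hr1 hr he k) hB hd).trans ?_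
  refine (add_le_add le_rfl (hp.mul_failProb_mul_refreshCost_le hB)).trans ?_
  rw [← ENNReal.ofReal_add
    (mul_nonneg (by linarith [hp.κ_ge]) (by linarith)) (by linarith)]
  exact ENNReal.ofReal_le_ofReal (by linarith)

lemma Params.large_of_le {p : Params} (hκ : 10 ≤ p.κ) (hn : 2 ^ 16 ≤ p.n)
    (hφ : 1 / p.logN ≤ p.φ) : p.Large := by
  refine ⟨hκ, hφ, ?_⟩
  unfold Params.logN
  have h : ((2 : ℝ) ^ (16 : ℝ)) ≤ p.n := by
    rw [show (16 : ℝ) = ((16 : ℕ) : ℝ) by norm_num, Real.rpow_natCast]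
    exact_mod_cast hn
  exact (Real.le_logb_iff_rpow_le (by norm_num) (lt_of_lt_of_le (by positivity) h)).2 h

end Theorem

end SeleMon

theorem mainTheorem9 :
    ∃ κ₀ : ℝ, ∀ κ : ℝ, κ₀ ≤ κ → ∃ (C : ℝ) (n₀ : ℕ), ∀ p : SeleMon.Params,
      p.κ = κ → n₀ ≤ p.n → 1 / p.logN ≤ p.φ →
      ∀ (D : Type*) [LinearOrder D] (d : p.Node → D), Function.Injective d →
        (SeleMon.Terminates d [SeleMon.Op.setup] ∧
          SeleMon.expectedMessages d [SeleMon.Op.setup] ≤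
            ENNReal.ofReal (C * (1 / p.φ * p.logPhi p.n))) ∧
        ∀ (Bs : List (List (p.Node × D))) (B : List (p.Node × D)),
          ((Bs.length + 1 : ℕ) : ℝ) ≤ p.logN → SeleMon.Distinct d (Bs ++ [B]) →
            SeleMon.Terminates d (SeleMon.history (Bs ++ [B])) ∧
            SeleMon.expectedMessages d (SeleMon.history (Bs ++ [B])) ≤
              ENNReal.ofReal (C * (1 / p.φ * p.logPhi (max (B.length : ℝ) p.logN))) := by
  refine ⟨10, fun κ hκ => ⟨32 * κ + 120, 2 ^ 16, ?_⟩⟩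
  rintro p rfl hn hφ D _ d hd
  have hp := SeleMon.Params.large_of_le hκ hn hφ
  refine ⟨⟨SeleMon.terminates_setup hp hd, (SeleMon.expectedMessages_setup_le hp hd).trans
    (ENNReal.ofReal_le_ofReal ?_)⟩, fun Bs B hB hD => ⟨SeleMon.terminates_history hp hD,
    SeleMon.expectedMessages_history_le_logPhi hp hB hD⟩⟩
  refine mul_le_mul_of_nonneg_right (by linarith) (mul_nonneg ?_ ?_)
  · linarith [p.one_lt_inv_φ]
  · linarith [hp.unit_le, hp.one_le_unit]
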